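/- Let $M$ be a connected Riemann surface and let $f,\hat f:M\to S^n$ be smooth conformal (or anti-conformal) immersions with $\hat f(p)\neq f(p)$ for all $p\in M$. Represent points of $S^n$ by null lines of the Minkowski space $\mathbb R^{n+1,1}$. In a local coordinate $z$ let $Y$ be the canonical lift of $f$, i.e. the lift into the forward light cone with $|dY|^2=|dz|^2$, let $V=\mathrm{span}\{Y,dY,Y_{z\bar z}\}$ be the bundle of signature $(3,1)$ that represents the mean curvature spheres of $f$, let $D$ be the normal connection on $V^\perp$, and define the Schwarzian $s$ and the Hopf differential $\kappa\in\Gamma(V^\perp\otimes\mathbb C)$ by $Y_{zz}+\frac s2Y=\kappa$. The surface $f$ is called Willmore if it satisfies the Euler--Lagrange equation $D_{\bar z}D_{\bar z}\kappa+\frac12\bar s\kappa=0$ of the Willmore functional, and S-Willmore if, moreover, $\kappa$ and $D_{\bar z}\kappa$ are linearly dependent over $\mathbb C$ at every point. Suppose that $\hat f$ also envelops the mean curvature sphere congruence of $f$: for every $p$, $\hat f(p)$ lies on the mean curvature sphere of $f$ at $p$ and $d\hat f(T_pM)$ is tangent to that sphere. Then at least one of the following holds. 1. $f$ is S-Willmore.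 2. $f$ is Möbius equivalent to a surface of constant mean curvature $1$ in hyperbolic $3$-space. More precisely, there are a Möbius transformation $T$ of $S^n$, a great $3$-sphere $S^3\subset S^n$ and an open hemisphere of $S^3$, which carries the hyperbolic metric of curvature $-1$ as a conformal model of $H^3$, such that $T\circ f$ takes its values in this hemisphere and is an immersed surface in $H^3$ with constant mean curvature $1$ for a suitable smooth unit normal, and $T\circ\hat f$ takes its values in the round $2$-sphere that bounds the hemisphere, i.e. in the ideal boundary of $H^3$. In particular $f$ lies in a round $3$-sphere, and $\hat f$ is an immersion into a round $2$-sphere. -/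

import Mathlib

open scoped Manifold ContDiff

noncomputable section

namespace Moebius

/-! ### Minkowski space and the light-cone model of the conformal sphere -/

/-- The Lorentzian bilinear form of signature `(m, 1)`, with time coordinate `0`. For `K = ℝ` this
is the Minkowski space `ℝ^{m,1}`, for `K = ℂ` its complexification with the complex bilinear
extension of the form. -/
def lorentz {K : Type*} [CommRing K] {m : ℕ} (v w : Fin (m + 1) → K) : K :=
  (∑ i : Fin m, v i.succ * w i.succ) - v 0 * w 0

/-- The unit sphere `S^n` in `ℝ^{n+1}`. -/
abbrev Sph (n : ℕ) : Type := Metric.sphere (0 : EuclideanSpace ℝ (Fin (n + 1))) 1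

/-- The light-like vector `(1, x)` of `ℝ^{n+1,1}` that represents the point `x` of `S^n`. -/
def nullLift {n : ℕ} (x : EuclideanSpace ℝ (Fin (n + 1))) : Fin (n + 2) → ℝ :=
  Fin.cons 1 (fun i => x i)

/-- `nullLift`, regarded in the complexification of `ℝ^{n+1,1}`. -/
def nullLiftC {n : ℕ} (x : EuclideanSpace ℝ (Fin (n + 1))) : Fin (n + 2) → ℂ :=
  fun i => (nullLift x i : ℂ)

/-- A Möbius transformation of `S^n`: the action of a Lorentz transformation of `ℝ^{n+1,1}` on the
null lines. -/
def IsMoebius {n : ℕ} (T : Sph n → Sph n) : Prop :=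
  ∃ A : (Fin (n + 2) → ℝ) ≃ₗ[ℝ] (Fin (n + 2) → ℝ),
    (∀ v w, lorentz (A v) (A w) = lorentz v w) ∧
    ∀ x : Sph n, ∃ c : ℝ, c ≠ 0 ∧ A (nullLift x.1) = c • nullLift (T x).1

/-! ### Möbius invariants of a conformal immersion in a complex coordinate -/

/-- `∂/∂z` -/
def dz {X : Type*} [NormedAddCommGroup X] [NormedSpace ℂ X] (G : ℂ → X) (z : ℂ) : X :=
  (1 / 2 : ℂ) • (fderiv ℝ G z 1 - Complex.I • fderiv ℝ G z Complex.I)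

/-- `∂/∂z̄` -/
def dzbar {X : Type*} [NormedAddCommGroup X] [NormedSpace ℂ X] (G : ℂ → X) (z : ℂ) : X :=
  (1 / 2 : ℂ) • (fderiv ℝ G z 1 + Complex.I • fderiv ℝ G z Complex.I)

/-- The canonical lift `Y` of a conformal immersion `F` into `S^n` of a domain with coordinate `z`:
the lift into the forward light cone with `|dY|² = |dz|²`. -/
def canonicalLift {n : ℕ} (F : ℂ → EuclideanSpace ℝ (Fin (n + 1))) (z : ℂ) : Fin (n + 2) → ℂ :=
  ((‖fderiv ℝ F z 1‖⁻¹ : ℝ) : ℂ) • nullLiftC (F z)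

section Invariants

variable {m : ℕ} (Y : ℂ → Fin (m + 1) → ℂ)

/-- The fibre at `z` of the complexification `V ⊗ ℂ` of `V = span {Y, dY, Y_{z z̄}}`. The
mean curvature sphere at `z` consists of the points whose null line lies in `V`. (A real vector lies
in `V` if and only if it lies in `V ⊗ ℂ`.) -/
def centralSphere (z : ℂ) : Submodule ℂ (Fin (m + 1) → ℂ) :=
  Submodule.span ℂ {Y z, dz Y z, dzbar Y z, dz (dzbar Y) z}

/-- The section `N` of `V` with `⟨N, N⟩ = 0`, `⟨N, Y⟩ = -1`, `⟨N, Y_z⟩ = 0`, where `Y` is a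
canonical lift. -/
def nullSection (z : ℂ) : Fin (m + 1) → ℂ :=
  (2 : ℂ) • dz (dzbar Y) z + (2 * lorentz (dz (dzbar Y) z) (dz (dzbar Y) z)) • Y z

/-- The Schwarzian `s` of a canonical lift, determined by `Y_zz + (s/2) Y ∈ V^⊥ ⊗ ℂ`. -/
def schwarzian (z : ℂ) : ℂ := 2 * lorentz (dz (dz Y) z) (nullSection Y z)

/-- The Hopf differential `κ = Y_zz + (s/2) Y`, a section of `V^⊥ ⊗ ℂ`. -/
def hopf (z : ℂ) : Fin (m + 1) → ℂ := dz (dz Y) z + (schwarzian Y z / 2) • Y z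

/-- The orthogonal projection to `V^⊥ ⊗ ℂ`, in the frame `Y, Y_z, Y_z̄, N` of `V ⊗ ℂ`, whose only
non-zero products are `⟨Y_z, Y_z̄⟩ = 1/2` and `⟨Y, N⟩ = -1`. -/
def normalPart (z : ℂ) (w : Fin (m + 1) → ℂ) : Fin (m + 1) → ℂ :=
  w + lorentz w (nullSection Y z) • Y z + lorentz w (Y z) • nullSection Y z
    - (2 * lorentz w (dzbar Y z)) • dz Y z - (2 * lorentz w (dz Y z)) • dzbar Y z

/-- The normal connection `D_z̄ ψ` of `V^⊥ ⊗ ℂ`. -/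
def normalDzbar (ψ : ℂ → Fin (m + 1) → ℂ) (z : ℂ) : Fin (m + 1) → ℂ :=
  normalPart Y z (dzbar ψ z)

/-- The Willmore equation `D_z̄ D_z̄ κ + (s̄/2) κ = 0` at `z`. -/
def WillmoreEq (z : ℂ) : Prop :=
  normalDzbar Y (normalDzbar Y (hopf Y)) z
    + (starRingEnd ℂ (schwarzian Y z) / 2) • hopf Y z = 0

end Invariants

/-! ### Surfaces: maps of a Riemann surface `M`, described in all its charts -/

section Surfaces

variable {n : ℕ} {M : Type*} [TopologicalSpace M] [ChartedSpace ℂ M]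

/-- A map into `S^n ⊆ ℝ^{n+1}` in the complex coordinate given by the chart `φ`. -/
def localRep (f : M → Sph n) (φ : OpenPartialHomeomorph M ℂ) (z : ℂ) :
    EuclideanSpace ℝ (Fin (n + 1)) := (f (φ.symm z)).1

/-- Smooth conformal (or anti-conformal) immersions of a Riemann surface into `S^n`: the induced
metric is a nowhere vanishing multiple of `|dz|²`. -/
def IsConformalImmersion (f : M → Sph n) : Prop :=
  ContMDiff 𝓘(ℝ, ℂ) 𝓘(ℝ, EuclideanSpace ℝ (Fin (n + 1))) ∞ (fun p => (f p).1) ∧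
  ∀ φ ∈ atlas ℂ M, ∀ z ∈ φ.target, IsConformalMap (fderiv ℝ (localRep f φ) z)

/-- `h` envelops the mean curvature sphere congruence of `f`: at every point `p`, `h p` lies on the
mean curvature sphere of `f` at `p`, and `h` is tangent to that sphere there. -/
def EnvelopsCentralSpheres (f h : M → Sph n) : Prop :=
  ∀ φ ∈ atlas ℂ M, ∀ z ∈ φ.target,
    nullLiftC (localRep h φ z) ∈ centralSphere (canonicalLift (localRep f φ)) z ∧
    ∀ v : ℂ, fderiv ℝ (fun w => nullLiftC (localRep h φ w)) z v ∈
      centralSphere (canonicalLift (localRep f φ)) z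

/-- Willmore surfaces (Euler-Lagrange equation of the Willmore functional). -/
def IsWillmore (f : M → Sph n) : Prop :=
  ∀ φ ∈ atlas ℂ M, ∀ z ∈ φ.target, WillmoreEq (canonicalLift (localRep f φ)) z

/-- S-Willmore surfaces: Willmore surfaces with `κ` and `D_z̄ κ` linearly dependent everywhere. -/
def IsSWillmore (f : M → Sph n) : Prop :=
  IsWillmore f ∧
  ∀ φ ∈ atlas ℂ M, ∀ z ∈ φ.target,
    ¬ LinearIndependent ℂ ![hopf (canonicalLift (localRep f φ)) z,
      normalDzbar (canonicalLift (localRep f φ)) (hopf (canonicalLift (localRep f φ))) z]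

/-! ### Surfaces in hyperbolic 3-space -/

/-- Hyperbolic 3-space of curvature `-1`: the hyperboloid in `ℝ^{3,1}`. -/
def hyperbolic3 : Set (Fin 4 → ℝ) := {X | lorentz X X = -1 ∧ 0 < X 0}

/-- Determinant of the first fundamental form of `G : ℂ → ℝ^{3,1}` in the coordinates `x + i y`. -/
def firstFormDet (G : ℂ → Fin 4 → ℝ) (z : ℂ) : ℝ :=
  lorentz (fderiv ℝ G z 1) (fderiv ℝ G z 1) *
      lorentz (fderiv ℝ G z Complex.I) (fderiv ℝ G z Complex.I)
    - lorentz (fderiv ℝ G z 1) (fderiv ℝ G z Complex.I) ^ 2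

/-- Coefficient `⟨∂_a ∂_b G, ν⟩` of the second fundamental form with respect to the unit normal
`ν`. -/
def secondForm (G : ℂ → Fin 4 → ℝ) (ν : Fin 4 → ℝ) (z a b : ℂ) : ℝ :=
  lorentz (fderiv ℝ (fun w => fderiv ℝ G w b) z a) ν

/-- The mean curvature, half the trace of the second with respect to the first fundamental form. -/
def meanCurvature (G : ℂ → Fin 4 → ℝ) (ν : Fin 4 → ℝ) (z : ℂ) : ℝ :=
  (lorentz (fderiv ℝ G z 1) (fderiv ℝ G z 1) * secondForm G ν z Complex.I Complex.I
    - 2 * lorentz (fderiv ℝ G z 1) (fderiv ℝ G z Complex.I) * secondForm G ν z 1 Complex.I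
    + lorentz (fderiv ℝ G z Complex.I) (fderiv ℝ G z Complex.I) * secondForm G ν z 1 1)
    / (2 * firstFormDet G z)

/-- Smooth immersed surfaces in hyperbolic 3-space with constant mean curvature `1` for a suitable
smooth unit normal field `ν`. -/
def IsCMC1 (g : M → Fin 4 → ℝ) : Prop :=
  ContMDiff 𝓘(ℝ, ℂ) 𝓘(ℝ, Fin 4 → ℝ) ∞ g ∧
  (∀ p, g p ∈ hyperbolic3) ∧
  ∃ ν : M → Fin 4 → ℝ, ContMDiff 𝓘(ℝ, ℂ) 𝓘(ℝ, Fin 4 → ℝ) ∞ ν ∧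
    (∀ p, lorentz (ν p) (ν p) = 1 ∧ lorentz (ν p) (g p) = 0) ∧
    ∀ φ ∈ atlas ℂ M, ∀ z ∈ φ.target,
      0 < firstFormDet (fun w => g (φ.symm w)) z ∧
      (∀ v : ℂ, lorentz (ν (φ.symm z)) (fderiv ℝ (fun w => g (φ.symm w)) z v) = 0) ∧
      meanCurvature (fun w => g (φ.symm w)) (ν (φ.symm z)) z = 1

end Surfaces

/-- The conformal hemisphere model of hyperbolic 3-space: the point `(t, x)` of the hyperboloid goes
to the point `(x / t, 1 / t)` of `S^3 ⊆ ℝ^4`. -/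
def hemisphereModel (X : Fin 4 → ℝ) : EuclideanSpace ℝ (Fin 4) :=
  !₂[X 1 / X 0, X 2 / X 0, X 3 / X 0, 1 / X 0]

/-- The ideal boundary of the hemisphere model: the 2-sphere that bounds the open hemisphere of
`S^3`. -/
def idealBoundary : Set (EuclideanSpace ℝ (Fin 4)) := {y | ‖y‖ = 1 ∧ y 3 = 0}

end Moebius

end

/-!
Write `Y` for the canonical lift of `f` and let `Z` be the null lift of `f̂` with `⟨Y, Z⟩ = -1`.
That `f̂` envelops the mean curvature spheres of `f` means that `Z` and `dZ` take values in `V`.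
With `μ = 2⟨Z, Y_z⟩` and `P = Y_z + (μ/2) Y`, the vectors `Y, Z, P, P̄` form a frame of `V ⊗ ℂ`,
and `Z_z = (μ/2) Z + ρ P + θ P̄`. The normal component of `Z_z` vanishes, which says that `D_z̄ κ
= -(μ̄/2) κ` (`IsEnvelopePair.normalDzbar_hopf`). So `κ` and `D_z̄ κ` are always linearly
dependent, and the left-hand side of the Willmore equation turns out to be `-(θ̄/2) κ`
(`IsEnvelopePair.willmoreEq_iff`).

Since `f̂` is conformal, `θρ = 0`, and `θ`, `ρ` have no common zero since `f̂` is an immersion.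
As `M` is connected, `θ` or `ρ` vanishes identically (`IsEnvelopeFamily.theta_dichotomy`), and
`f` is S-Willmore in the first case. Let `ρ = 0`. Because `Z` is real, so is `Z_{z z̄}`;
comparing coefficients shows that `θ` is holomorphic and that `ξ = κ/θ` is real
(`IsEnvelopePair.theta_holomorphic_and_real`). The function `⟨ξ, ξ⟩` satisfies a linear
differential equation of the first order, so `κ` vanishes everywhere, which makes `f` S-Willmore
again, or nowhere (`IsEnvelopeFamily.hopf_dichotomy`).

If `κ` vanishes nowhere, put `a = 2|ξ|` and `ψ = ξ/|ξ|`, and rescale the lifts to `X = Y/a` and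
`H = aZ`. Then `e = ψ + H` is constant (`IsEnvelopePair.dz_E`), and so is the bundle `V ⊕ ℝψ` of
signature `(4, 1)` (`IsEnvelopePair.dz_proj`), so that both surfaces lie in a fixed `3`-sphere.
Here `⟨e, H⟩ = 0` and `⟨e, X⟩ = -1`, hence `X + e` is a surface in the hyperboloid of `e^⊥ ∩ (V ⊕
ℝψ)` with the unit normal `H - X - e`, and `H` represents points of its ideal boundary. Its mean
curvature is `1` because `⟨dX, dH⟩` is trace-free, which expresses that `ρ` vanishes
(`IsGaussPair.isCMC1`). A Lorentz transformation that moves an orthonormal frame to standard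
position gives the Möbius transformation (`IsGaussPair.exists_moebius`).
-/

namespace Moebius

/-! ### The Lorentzian form -/

section Lorentz

variable {K : Type*} [CommRing K] {m : ℕ}

lemma lorentz_comm (v w : Fin (m + 1) → K) : lorentz v w = lorentz w v := by
  simp only [lorentz, mul_comm]

@[simp] lemma lorentz_add_left (u v w : Fin (m + 1) → K) :
    lorentz (u + v) w = lorentz u w + lorentz v w := by
  simp only [lorentz, Pi.add_apply, add_mul, Finset.sum_add_distrib]; ring

@[simp] lemma lorentz_smul_left (c : K) (v w : Fin (m + 1) → K) :
    lorentz (c • v) w = c * lorentz v w := by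
  simp only [lorentz, Pi.smul_apply, smul_eq_mul, mul_sub, Finset.mul_sum, mul_assoc]

@[simp] lemma lorentz_add_right (u v w : Fin (m + 1) → K) :
    lorentz u (v + w) = lorentz u v + lorentz u w := by
  rw [lorentz_comm, lorentz_add_left, lorentz_comm v, lorentz_comm w]

@[simp] lemma lorentz_smul_right (c : K) (v w : Fin (m + 1) → K) :
    lorentz v (c • w) = c * lorentz v w := by
  rw [lorentz_comm, lorentz_smul_left, lorentz_comm]

@[simp] lemma lorentz_neg_left (v w : Fin (m + 1) → K) : lorentz (-v) w = -lorentz v w := by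
  rw [← neg_one_smul K, lorentz_smul_left]; ring

@[simp] lemma lorentz_neg_right (v w : Fin (m + 1) → K) : lorentz v (-w) = -lorentz v w := by
  rw [lorentz_comm, lorentz_neg_left, lorentz_comm]

@[simp] lemma lorentz_sub_left (u v w : Fin (m + 1) → K) :
    lorentz (u - v) w = lorentz u w - lorentz v w := by
  rw [sub_eq_add_neg, lorentz_add_left, lorentz_neg_left]; ring

@[simp] lemma lorentz_sub_right (u v w : Fin (m + 1) → K) :
    lorentz u (v - w) = lorentz u v - lorentz u w := by
  rw [sub_eq_add_neg, lorentz_add_right, lorentz_neg_right]; ring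

@[simp] lemma lorentz_zero_left (v : Fin (m + 1) → K) : lorentz 0 v = 0 := by simp [lorentz]

@[simp] lemma lorentz_zero_right (v : Fin (m + 1) → K) : lorentz v 0 = 0 := by simp [lorentz]

end Lorentz

lemma lorentz_star {m : ℕ} (v w : Fin (m + 1) → ℂ) :
    lorentz (star v) (star w) = star (lorentz v w) := by
  simp [lorentz]

/-- The Lorentzian form as a continuous `ℝ`-bilinear map. -/
noncomputable def lorentzL (K : Type*) [RCLike K] (m : ℕ) :
    (Fin (m + 1) → K) →L[ℝ] (Fin (m + 1) → K) →L[ℝ] K :=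
  (LinearMap.mk₂ ℝ (fun v w : Fin (m + 1) → K => lorentz v w) lorentz_add_left
    (fun c v w => by
      rw [← algebraMap_smul K c v, ← algebraMap_smul K c (lorentz v w), lorentz_smul_left,
        smul_eq_mul])
    lorentz_add_right
    (fun c v w => by
      rw [← algebraMap_smul K c w, ← algebraMap_smul K c (lorentz v w), lorentz_smul_right,
        smul_eq_mul])).toContinuousBilinearMap

@[simp] lemma lorentzL_apply {K : Type*} [RCLike K] {m : ℕ} (v w : Fin (m + 1) → K) :
    lorentzL K m v w = lorentz v w := rfl

lemma fderiv_lorentz {K : Type*} [RCLike K] {m : ℕ} {G H : ℂ → Fin (m + 1) → K} {z : ℂ}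
    (hG : DifferentiableAt ℝ G z) (hH : DifferentiableAt ℝ H z) (v : ℂ) :
    fderiv ℝ (fun w => lorentz (G w) (H w)) z v =
      lorentz (fderiv ℝ G z v) (H z) + lorentz (G z) (fderiv ℝ H z v) := by
  have h := ((lorentzL K m).hasFDerivAt_of_bilinear hG.hasFDerivAt hH.hasFDerivAt).fderiv
  simp only [lorentzL_apply] at h
  rw [h]
  simp [add_comm]

lemma contDiffOn_lorentz {K : Type*} [RCLike K] {m : ℕ} {Ω : Set ℂ} {G H : ℂ → Fin (m + 1) → K}
    (hG : ContDiffOn ℝ ∞ G Ω) (hH : ContDiffOn ℝ ∞ H Ω) :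
    ContDiffOn ℝ ∞ (fun w => lorentz (G w) (H w)) Ω :=
  (lorentzL K m).isBoundedBilinearMap.contDiff.comp_contDiffOn (hG.prodMk hH)

/-! ### Wirtinger calculus -/

section Wirtinger

variable {X : Type*} [NormedAddCommGroup X] [NormedSpace ℂ X]
variable {G H : ℂ → X} {z : ℂ} {Ω : Set ℂ}

lemma fderiv_eq_dz (G : ℂ → X) (z v : ℂ) :
    fderiv ℝ G z v = v • dz G z + (starRingEnd ℂ v) • dzbar G z := by
  have hv : v = v.re • (1 : ℂ) + v.im • Complex.I := by simp
  have h1 : fderiv ℝ G z v = v.re • fderiv ℝ G z 1 + v.im • fderiv ℝ G z Complex.I := by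
    conv_lhs => rw [hv]
    rw [map_add, map_smul, map_smul]
  have h2 : ∀ (r : ℝ) (x : X), r • x = (r : ℂ) • x := fun r x => (Complex.coe_smul r x).symm
  have e1 : (starRingEnd ℂ v) = v.re - v.im * Complex.I := by
    apply Complex.ext <;> simp
  have e2 : v = v.re + v.im * Complex.I := (Complex.re_add_im v).symm
  rw [h1, h2, h2, e1, dz, dzbar]
  conv_rhs => rw [e2]
  simp only [Complex.add_re, Complex.ofReal_re, Complex.mul_re, Complex.I_re, mul_zero,
    Complex.ofReal_im, Complex.I_im, mul_one, sub_self, add_zero, Complex.add_im, Complex.mul_im,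
    zero_add]
  match_scalars
  · ring
  · linear_combination (v.im : ℂ) * Complex.I_mul_I

lemma dz_congr (h : G =ᶠ[nhds z] H) : dz G z = dz H z := by
  rw [dz, dz, h.fderiv_eq]

lemma dzbar_congr (h : G =ᶠ[nhds z] H) : dzbar G z = dzbar H z := by
  rw [dzbar, dzbar, h.fderiv_eq]

lemma dz_congr_on (hΩ : IsOpen Ω) (h : ∀ w ∈ Ω, G w = H w) (hz : z ∈ Ω) : dz G z = dz H z :=
  dz_congr (Filter.mem_of_superset (hΩ.mem_nhds hz) h)

lemma dzbar_congr_on (hΩ : IsOpen Ω) (h : ∀ w ∈ Ω, G w = H w) (hz : z ∈ Ω) :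
    dzbar G z = dzbar H z :=
  dzbar_congr (Filter.mem_of_superset (hΩ.mem_nhds hz) h)

lemma dz_const (x : X) : dz (fun _ => x) z = 0 := by
  have : fderiv ℝ (fun _ : ℂ => x) z = 0 := by simp
  simp [dz, this]

lemma dzbar_const (x : X) : dzbar (fun _ => x) z = 0 := by
  have : fderiv ℝ (fun _ : ℂ => x) z = 0 := by simp
  simp [dzbar, this]

lemma dz_add (hG : DifferentiableAt ℝ G z) (hH : DifferentiableAt ℝ H z) :
    dz (fun w => G w + H w) z = dz G z + dz H z := by
  have := fderiv_add hG hH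
  have e : (G + H) = fun w => G w + H w := rfl
  rw [e] at this
  simp only [dz, this, add_apply]; module

lemma dzbar_add (hG : DifferentiableAt ℝ G z) (hH : DifferentiableAt ℝ H z) :
    dzbar (fun w => G w + H w) z = dzbar G z + dzbar H z := by
  have := fderiv_add hG hH
  have e : (G + H) = fun w => G w + H w := rfl
  rw [e] at this
  simp only [dzbar, this, add_apply]; module

lemma fderiv_smul_apply {c : ℂ → ℂ} (hc : DifferentiableAt ℝ c z) (hG : DifferentiableAt ℝ G z)
    (v : ℂ) : fderiv ℝ (fun w => c w • G w) z v = c z • fderiv ℝ G z v + fderiv ℝ c z v • G z := by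
  have e : (fun w => c w • G w) = c • G := rfl
  rw [e, (hc.hasFDerivAt.smul hG.hasFDerivAt).fderiv]
  simp

lemma dz_smul {c : ℂ → ℂ} (hc : DifferentiableAt ℝ c z) (hG : DifferentiableAt ℝ G z) :
    dz (fun w => c w • G w) z = c z • dz G z + dz c z • G z := by
  simp only [dz, fderiv_smul_apply hc hG, smul_eq_mul]; module

lemma dzbar_smul {c : ℂ → ℂ} (hc : DifferentiableAt ℝ c z) (hG : DifferentiableAt ℝ G z) :
    dzbar (fun w => c w • G w) z = c z • dzbar G z + dzbar c z • G z := by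
  simp only [dzbar, fderiv_smul_apply hc hG, smul_eq_mul]; module

lemma dz_const_smul (c : ℂ) (hG : DifferentiableAt ℝ G z) :
    dz (fun w => c • G w) z = c • dz G z := by
  rw [dz_smul (c := fun _ => c) (differentiableAt_const _) hG, dz_const]; simp

lemma dzbar_const_smul (c : ℂ) (hG : DifferentiableAt ℝ G z) :
    dzbar (fun w => c • G w) z = c • dzbar G z := by
  rw [dzbar_smul (c := fun _ => c) (differentiableAt_const _) hG, dzbar_const]; simp

lemma dz_neg (hG : DifferentiableAt ℝ G z) : dz (fun w => -G w) z = -dz G z := by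
  simpa using dz_const_smul (-1) hG

lemma dzbar_neg (hG : DifferentiableAt ℝ G z) : dzbar (fun w => -G w) z = -dzbar G z := by
  simpa using dzbar_const_smul (-1) hG

lemma dz_sub (hG : DifferentiableAt ℝ G z) (hH : DifferentiableAt ℝ H z) :
    dz (fun w => G w - H w) z = dz G z - dz H z := by
  simp only [sub_eq_add_neg]; rw [dz_add hG hH.fun_neg, dz_neg hH]

lemma dzbar_sub (hG : DifferentiableAt ℝ G z) (hH : DifferentiableAt ℝ H z) :
    dzbar (fun w => G w - H w) z = dzbar G z - dzbar H z := by
  simp only [sub_eq_add_neg]; rw [dzbar_add hG hH.fun_neg, dzbar_neg hH]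

lemma dz_mul {c d : ℂ → ℂ} (hc : DifferentiableAt ℝ c z) (hd : DifferentiableAt ℝ d z) :
    dz (fun w => c w * d w) z = c z * dz d z + dz c z * d z := dz_smul hc hd

lemma contDiffOn_dz (hΩ : IsOpen Ω) (hG : ContDiffOn ℝ ∞ G Ω) : ContDiffOn ℝ ∞ (dz G) Ω := by
  have h : ContDiffOn ℝ ∞ (fderiv ℝ G) Ω := hG.fderiv_of_isOpen hΩ (by simp)
  have h' : ∀ v : ℂ, ContDiffOn ℝ ∞ (fun w => fderiv ℝ G w v) Ω :=
    fun v => h.clm_apply contDiffOn_const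
  exact ((h' 1).sub ((h' Complex.I).const_smul Complex.I)).const_smul (1 / 2 : ℂ)

lemma contDiffOn_dzbar (hΩ : IsOpen Ω) (hG : ContDiffOn ℝ ∞ G Ω) :
    ContDiffOn ℝ ∞ (dzbar G) Ω := by
  have h : ContDiffOn ℝ ∞ (fderiv ℝ G) Ω := hG.fderiv_of_isOpen hΩ (by simp)
  have h' : ∀ v : ℂ, ContDiffOn ℝ ∞ (fun w => fderiv ℝ G w v) Ω :=
    fun v => h.clm_apply contDiffOn_const
  exact ((h' 1).add ((h' Complex.I).const_smul Complex.I)).const_smul (1 / 2 : ℂ)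

lemma diffAt_of_contDiffOn {F : Type*} [NormedAddCommGroup F] [NormedSpace ℝ F] {G : ℂ → F}
    (hΩ : IsOpen Ω) (hG : ContDiffOn ℝ ∞ G Ω) (hz : z ∈ Ω) :
    DifferentiableAt ℝ G z :=
  (hG.contDiffAt (hΩ.mem_nhds hz)).differentiableAt (by simp)

/-- Mixed second derivatives commute. -/
lemma dz_dzbar_comm (hΩ : IsOpen Ω) (hG : ContDiffOn ℝ ∞ G Ω) (hz : z ∈ Ω) :
    dzbar (dz G) z = dz (dzbar G) z := by
  have h : DifferentiableAt ℝ (fderiv ℝ G) z :=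
    diffAt_of_contDiffOn hΩ (hG.fderiv_of_isOpen hΩ (by simp)) hz
  have hsymm : IsSymmSndFDerivAt ℝ G z :=
    (hG.contDiffAt (hΩ.mem_nhds hz)).isSymmSndFDerivAt
      (by simpa using WithTop.coe_le_coe.2 (le_top : (2 : ℕ∞) ≤ ⊤))
  have h' : ∀ v : ℂ, DifferentiableAt ℝ (fun w => fderiv ℝ G w v) z :=
    fun v => h.clm_apply (differentiableAt_const _)
  have h2 : ∀ u v : ℂ, fderiv ℝ (fun w => fderiv ℝ G w v) z u = fderiv ℝ (fderiv ℝ G) z u v := by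
    intro u v
    rw [fderiv_clm_apply h (differentiableAt_const _)]; simp
  have e1 : dz G = fun w => (1 / 2 : ℂ) • (fderiv ℝ G w 1 - Complex.I • fderiv ℝ G w Complex.I) :=
    rfl
  have e2 : dzbar G =
    fun w => (1 / 2 : ℂ) • (fderiv ℝ G w 1 + Complex.I • fderiv ℝ G w Complex.I) := rfl
  have hI : DifferentiableAt ℝ (fun w => Complex.I • fderiv ℝ G w Complex.I) z :=
    (h' _).const_smul Complex.I
  rw [e1, e2, dzbar_const_smul _ ((h' 1).fun_sub hI), dz_const_smul _ ((h' 1).fun_add hI),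
    dzbar_sub (h' 1) hI, dz_add (h' 1) hI, dzbar_const_smul _ (h' _), dz_const_smul _ (h' _)]
  simp only [dz, dzbar, h2]
  have hs : fderiv ℝ (fderiv ℝ G) z Complex.I 1 = fderiv ℝ (fderiv ℝ G) z 1 Complex.I := hsymm _ _
  rw [hs]
  module

end Wirtinger

section WirtingerLorentz

variable {m : ℕ} {G H : ℂ → Fin (m + 1) → ℂ} {z : ℂ} {Ω : Set ℂ}

lemma dz_lorentz (hG : DifferentiableAt ℝ G z) (hH : DifferentiableAt ℝ H z) :
    dz (fun w => lorentz (G w) (H w)) z = lorentz (dz G z) (H z) + lorentz (G z) (dz H z) := by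
  simp only [dz, fderiv_lorentz hG hH, lorentz_smul_left, lorentz_smul_right, lorentz_sub_left,
    lorentz_sub_right, smul_eq_mul]
  ring

lemma dzbar_lorentz (hG : DifferentiableAt ℝ G z) (hH : DifferentiableAt ℝ H z) :
    dzbar (fun w => lorentz (G w) (H w)) z =
      lorentz (dzbar G z) (H z) + lorentz (G z) (dzbar H z) := by
  simp only [dzbar, fderiv_lorentz hG hH, lorentz_smul_left, lorentz_smul_right, lorentz_add_left,
    lorentz_add_right, smul_eq_mul]
  ring

lemma fderiv_star_apply {F : Type*} [NormedAddCommGroup F] [NormedSpace ℝ F] [StarAddMonoid F]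
    [NormedStarGroup F] [StarModule ℝ F] (G : ℂ → F) (z v : ℂ) :
    fderiv ℝ (fun w => star (G w)) z v = star (fderiv ℝ G z v) := by
  have h := (starL' ℝ : F ≃L[ℝ] F).comp_fderiv (f := G) (x := z)
  have e : (⇑(starL' ℝ : F ≃L[ℝ] F) ∘ G) = fun w => star (G w) := rfl
  rw [e] at h
  rw [h]; rfl

lemma dz_star {F : Type*} [NormedAddCommGroup F] [NormedSpace ℂ F] [StarAddMonoid F]
    [NormedStarGroup F] [StarModule ℝ F] [StarModule ℂ F] (G : ℂ → F) (z : ℂ) :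
    dz (fun w => star (G w)) z = star (dzbar G z) := by
  simp only [dz, dzbar, fderiv_star_apply, star_smul, star_add]
  simp [sub_eq_add_neg]

lemma dzbar_star {F : Type*} [NormedAddCommGroup F] [NormedSpace ℂ F] [StarAddMonoid F]
    [NormedStarGroup F] [StarModule ℝ F] [StarModule ℂ F] (G : ℂ → F) (z : ℂ) :
    dzbar (fun w => star (G w)) z = star (dz G z) := by
  simp only [dz, dzbar, fderiv_star_apply, star_smul, star_sub]
  simp

lemma contDiffOn_star {F : Type*} [NormedAddCommGroup F] [NormedSpace ℝ F] [StarAddMonoid F]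
    [NormedStarGroup F] [StarModule ℝ F] {G : ℂ → F} (hG : ContDiffOn ℝ ∞ G Ω) :
    ContDiffOn ℝ ∞ (fun w => star (G w)) Ω :=
  (starL' ℝ : F ≃L[ℝ] F).contDiff.comp_contDiffOn hG

lemma dzbar_eq_star_dz {F : Type*} [NormedAddCommGroup F] [NormedSpace ℂ F] [StarAddMonoid F]
    [NormedStarGroup F] [StarModule ℝ F] [StarModule ℂ F] {G : ℂ → F} (hΩ : IsOpen Ω)
    (h : ∀ w ∈ Ω, star (G w) = G w) (hz : z ∈ Ω) :
    dzbar G z = star (dz G z) := by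
  rw [← dzbar_star, dzbar_congr_on hΩ h hz]

end WirtingerLorentz

/-! ### The moving frame of a canonical lift -/

section Constant

variable {m : ℕ} {G H : ℂ → Fin (m + 1) → ℂ} {z c : ℂ} {Ω : Set ℂ}

lemma lorentz_dz_of_const (hΩ : IsOpen Ω) (hG : ContDiffOn ℝ ∞ G Ω) (hH : ContDiffOn ℝ ∞ H Ω)
    (h : ∀ w ∈ Ω, lorentz (G w) (H w) = c) (hz : z ∈ Ω) :
    lorentz (G z) (dz H z) = -lorentz (dz G z) (H z) := by
  have h1 := dz_lorentz (diffAt_of_contDiffOn hΩ hG hz) (diffAt_of_contDiffOn hΩ hH hz)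
  rw [dz_congr_on hΩ (H := fun _ => c) h hz, dz_const] at h1
  linear_combination -h1

lemma lorentz_dzbar_of_const (hΩ : IsOpen Ω) (hG : ContDiffOn ℝ ∞ G Ω) (hH : ContDiffOn ℝ ∞ H Ω)
    (h : ∀ w ∈ Ω, lorentz (G w) (H w) = c) (hz : z ∈ Ω) :
    lorentz (G z) (dzbar H z) = -lorentz (dzbar G z) (H z) := by
  have h1 := dzbar_lorentz (diffAt_of_contDiffOn hΩ hG hz) (diffAt_of_contDiffOn hΩ hH hz)
  rw [dzbar_congr_on hΩ (H := fun _ => c) h hz, dzbar_const] at h1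
  linear_combination -h1

end Constant

/-- `Y` is a canonical lift on the coordinate domain `Ω`: a smooth real null vector field (with
values in the complexified Minkowski space) such that `|dY|² = |dz|²`. -/
structure IsCanonicalLift {m : ℕ} (Ω : Set ℂ) (Y : ℂ → Fin (m + 1) → ℂ) : Prop where
  isOpen : IsOpen Ω
  smooth : ContDiffOn ℝ ∞ Y Ω
  real : ∀ z ∈ Ω, star (Y z) = Y z
  null : ∀ z ∈ Ω, lorentz (Y z) (Y z) = 0
  dz_dz : ∀ z ∈ Ω, lorentz (dz Y z) (dz Y z) = 0
  dz_dzbar : ∀ z ∈ Ω, lorentz (dz Y z) (dzbar Y z) = 1 / 2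

namespace IsCanonicalLift

variable {m : ℕ} {Ω : Set ℂ} {Y : ℂ → Fin (m + 1) → ℂ} {z : ℂ}

lemma smooth_dz (h : IsCanonicalLift Ω Y) : ContDiffOn ℝ ∞ (dz Y) Ω :=
  contDiffOn_dz h.isOpen h.smooth

lemma smooth_dzbar (h : IsCanonicalLift Ω Y) : ContDiffOn ℝ ∞ (dzbar Y) Ω :=
  contDiffOn_dzbar h.isOpen h.smooth

lemma smooth_dzdzbar (h : IsCanonicalLift Ω Y) : ContDiffOn ℝ ∞ (dz (dzbar Y)) Ω :=
  contDiffOn_dz h.isOpen h.smooth_dzbar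

lemma smooth_dzdz (h : IsCanonicalLift Ω Y) : ContDiffOn ℝ ∞ (dz (dz Y)) Ω :=
  contDiffOn_dz h.isOpen h.smooth_dz

lemma dzbar_eq (h : IsCanonicalLift Ω Y) (hz : z ∈ Ω) : dzbar Y z = star (dz Y z) :=
  dzbar_eq_star_dz h.isOpen h.real hz

lemma Y_dz (h : IsCanonicalLift Ω Y) (hz : z ∈ Ω) : lorentz (Y z) (dz Y z) = 0 := by
  have := lorentz_dz_of_const h.isOpen h.smooth h.smooth h.null hz
  rw [lorentz_comm (dz Y z)] at this
  linear_combination (1 / 2 : ℂ) * this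

lemma Y_dzbar (h : IsCanonicalLift Ω Y) (hz : z ∈ Ω) : lorentz (Y z) (dzbar Y z) = 0 := by
  have := lorentz_dzbar_of_const h.isOpen h.smooth h.smooth h.null hz
  rw [lorentz_comm (dzbar Y z)] at this
  linear_combination (1 / 2 : ℂ) * this

lemma dzbar_dzbar (h : IsCanonicalLift Ω Y) (hz : z ∈ Ω) :
    lorentz (dzbar Y z) (dzbar Y z) = 0 := by
  rw [h.dzbar_eq hz, lorentz_star, h.dz_dz z hz, star_zero]

lemma Y_dzdzbar (h : IsCanonicalLift Ω Y) (hz : z ∈ Ω) :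
    lorentz (Y z) (dz (dzbar Y) z) = -1 / 2 := by
  rw [lorentz_dz_of_const h.isOpen h.smooth h.smooth_dzbar (fun w hw => h.Y_dzbar hw) hz,
    h.dz_dzbar z hz]
  norm_num

lemma dz_dzdzbar (h : IsCanonicalLift Ω Y) (hz : z ∈ Ω) :
    lorentz (dz Y z) (dz (dzbar Y) z) = 0 := by
  have := lorentz_dzbar_of_const h.isOpen h.smooth_dz h.smooth_dz h.dz_dz hz
  rw [lorentz_comm (dzbar (dz Y) z), dz_dzbar_comm h.isOpen h.smooth hz] at this
  linear_combination (1 / 2 : ℂ) * this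

lemma dzbar_dzdzbar (h : IsCanonicalLift Ω Y) (hz : z ∈ Ω) :
    lorentz (dzbar Y z) (dz (dzbar Y) z) = 0 := by
  have := lorentz_dz_of_const h.isOpen h.smooth_dzbar h.smooth_dzbar
    (fun w hw => h.dzbar_dzbar hw) hz
  rw [lorentz_comm (dz (dzbar Y) z)] at this
  linear_combination (1 / 2 : ℂ) * this

lemma Y_dzdz (h : IsCanonicalLift Ω Y) (hz : z ∈ Ω) : lorentz (Y z) (dz (dz Y) z) = 0 := by
  rw [lorentz_dz_of_const h.isOpen h.smooth h.smooth_dz (fun w hw => h.Y_dz hw) hz,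
    h.dz_dz z hz, neg_zero]

lemma dz_dzdz (h : IsCanonicalLift Ω Y) (hz : z ∈ Ω) : lorentz (dz Y z) (dz (dz Y) z) = 0 := by
  have := lorentz_dz_of_const h.isOpen h.smooth_dz h.smooth_dz h.dz_dz hz
  rw [lorentz_comm (dz (dz Y) z)] at this
  linear_combination (1 / 2 : ℂ) * this

lemma dzbar_dzdz (h : IsCanonicalLift Ω Y) (hz : z ∈ Ω) :
    lorentz (dzbar Y z) (dz (dz Y) z) = 0 := by
  have := lorentz_dz_of_const h.isOpen h.smooth_dzbar h.smooth_dz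
    (fun w hw => by rw [lorentz_comm]; exact h.dz_dzbar w hw) hz
  rw [this, lorentz_comm, h.dz_dzdzbar hz, neg_zero]

lemma Y_N (h : IsCanonicalLift Ω Y) (hz : z ∈ Ω) : lorentz (Y z) (nullSection Y z) = -1 := by
  simp only [nullSection, lorentz_add_right, lorentz_smul_right, h.Y_dzdzbar hz, h.null z hz]
  ring

lemma dz_N (h : IsCanonicalLift Ω Y) (hz : z ∈ Ω) : lorentz (dz Y z) (nullSection Y z) = 0 := by
  simp only [nullSection, lorentz_add_right, lorentz_smul_right, h.dz_dzdzbar hz,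
    lorentz_comm (dz Y z) (Y z), h.Y_dz hz]
  ring

lemma dzbar_N (h : IsCanonicalLift Ω Y) (hz : z ∈ Ω) :
    lorentz (dzbar Y z) (nullSection Y z) = 0 := by
  simp only [nullSection, lorentz_add_right, lorentz_smul_right, h.dzbar_dzdzbar hz,
    lorentz_comm (dzbar Y z) (Y z), h.Y_dzbar hz]
  ring

lemma N_N (h : IsCanonicalLift Ω Y) (hz : z ∈ Ω) :
    lorentz (nullSection Y z) (nullSection Y z) = 0 := by
  simp only [nullSection, lorentz_add_right, lorentz_smul_right, lorentz_add_left,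
    lorentz_smul_left, lorentz_comm (dz (dzbar Y) z) (Y z), h.Y_dzdzbar hz, h.null z hz]
  ring

lemma smooth_N (h : IsCanonicalLift Ω Y) : ContDiffOn ℝ ∞ (nullSection Y) Ω :=
  (h.smooth_dzdzbar.const_smul (2 : ℂ)).add
    ((contDiffOn_const.mul (contDiffOn_lorentz h.smooth_dzdzbar h.smooth_dzdzbar)).smul h.smooth)

lemma smooth_schwarzian (h : IsCanonicalLift Ω Y) : ContDiffOn ℝ ∞ (schwarzian Y) Ω :=
  contDiffOn_const.mul (contDiffOn_lorentz h.smooth_dzdz h.smooth_N)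

lemma smooth_hopf (h : IsCanonicalLift Ω Y) : ContDiffOn ℝ ∞ (hopf Y) Ω :=
  h.smooth_dzdz.add ((h.smooth_schwarzian.div_const 2).smul h.smooth)

lemma hopf_Y (h : IsCanonicalLift Ω Y) (hz : z ∈ Ω) : lorentz (hopf Y z) (Y z) = 0 := by
  rw [lorentz_comm]
  simp only [hopf, lorentz_add_right, lorentz_smul_right, h.Y_dzdz hz, h.null z hz]
  ring

lemma hopf_dz (h : IsCanonicalLift Ω Y) (hz : z ∈ Ω) : lorentz (hopf Y z) (dz Y z) = 0 := by
  rw [lorentz_comm]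
  simp only [hopf, lorentz_add_right, lorentz_smul_right, h.dz_dzdz hz,
    lorentz_comm (dz Y z) (Y z), h.Y_dz hz]
  ring

lemma hopf_dzbar (h : IsCanonicalLift Ω Y) (hz : z ∈ Ω) : lorentz (hopf Y z) (dzbar Y z) = 0 := by
  rw [lorentz_comm]
  simp only [hopf, lorentz_add_right, lorentz_smul_right, h.dzbar_dzdz hz,
    lorentz_comm (dzbar Y z) (Y z), h.Y_dzbar hz]
  ring

lemma hopf_N (h : IsCanonicalLift Ω Y) (hz : z ∈ Ω) :
    lorentz (hopf Y z) (nullSection Y z) = 0 := by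
  simp only [hopf, lorentz_add_left, lorentz_smul_left, h.Y_N hz, schwarzian]
  ring

lemma dzdzbar_eq (Y : ℂ → Fin (m + 1) → ℂ) (z : ℂ) : dz (dzbar Y) z =
    (1 / 2 : ℂ) • nullSection Y z - lorentz (dz (dzbar Y) z) (dz (dzbar Y) z) • Y z := by
  rw [nullSection]; module

end IsCanonicalLift

section NormalPart

variable {m : ℕ} {Ω : Set ℂ} {Y : ℂ → Fin (m + 1) → ℂ} {z : ℂ}

lemma normalPart_add (v w : Fin (m + 1) → ℂ) :
    normalPart Y z (v + w) = normalPart Y z v + normalPart Y z w := by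
  simp only [normalPart, lorentz_add_left]; module

lemma normalPart_smul (c : ℂ) (v : Fin (m + 1) → ℂ) :
    normalPart Y z (c • v) = c • normalPart Y z v := by
  simp only [normalPart, lorentz_smul_left]; module

lemma normalPart_eq_self {v : Fin (m + 1) → ℂ} (h1 : lorentz v (Y z) = 0)
    (h2 : lorentz v (dz Y z) = 0) (h3 : lorentz v (dzbar Y z) = 0)
    (h4 : lorentz v (nullSection Y z) = 0) : normalPart Y z v = v := by
  simp [normalPart, h1, h2, h3, h4]

lemma Y_mem : Y z ∈ centralSphere Y z := Submodule.subset_span (by simp)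
lemma dz_mem : dz Y z ∈ centralSphere Y z := Submodule.subset_span (by simp)
lemma dzbar_mem : dzbar Y z ∈ centralSphere Y z := Submodule.subset_span (by simp)
lemma dzdzbar_mem : dz (dzbar Y) z ∈ centralSphere Y z := Submodule.subset_span (by simp)

/-- A vector that is orthogonal to the frame `Y, Y_z, Y_z̄, N` is orthogonal to `V ⊗ ℂ`. -/
lemma lorentz_centralSphere {v w : Fin (m + 1) → ℂ} (h1 : lorentz v (Y z) = 0)
    (h2 : lorentz v (dz Y z) = 0) (h3 : lorentz v (dzbar Y z) = 0)
    (h4 : lorentz v (nullSection Y z) = 0) (hw : w ∈ centralSphere Y z) : lorentz v w = 0 := by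
  refine Submodule.span_induction (p := fun w _ => lorentz v w = 0) ?_ (by simp)
    (fun x y _ _ hx hy => by simp [hx, hy]) (fun c x _ hx => by simp [hx]) hw
  rintro x (rfl | rfl | rfl | rfl)
  · exact h1
  · exact h2
  · exact h3
  · rw [IsCanonicalLift.dzdzbar_eq]; simp [h1, h4]

lemma normalPart_of_mem (h : IsCanonicalLift Ω Y) (hz : z ∈ Ω) {w : Fin (m + 1) → ℂ}
    (hw : w ∈ centralSphere Y z) : normalPart Y z w = 0 := by
  have e1 := h.null z hz
  have e2 := h.Y_dz hz
  have e3 := h.Y_dzbar hz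
  have e4 := h.Y_N hz
  have e5 := h.dz_dz z hz
  have e6 := h.dz_dzbar z hz
  have e7 := h.dzbar_dzbar hz
  have e8 := h.dz_N hz
  have e9 := h.dzbar_N hz
  have e10 := h.N_N hz
  have hY : normalPart Y z (Y z) = 0 := by
    simp only [normalPart, e1, e2, e3, e4]; module
  refine Submodule.span_induction (p := fun w _ => normalPart Y z w = 0) ?_ (by simp [normalPart])
    (fun x y _ _ hx hy => by rw [normalPart_add, hx, hy, add_zero])
    (fun c x _ hx => by rw [normalPart_smul, hx, smul_zero]) hw
  rintro x (rfl | rfl | rfl | rfl)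
  · exact hY
  · simp only [normalPart, lorentz_comm (dz Y z) (Y z), e2, e5, e6, e8]; module
  · simp only [normalPart, lorentz_comm (dzbar Y z) (Y z), lorentz_comm (dzbar Y z) (dz Y z),
      e3, e6, e7, e9]; module
  · rw [IsCanonicalLift.dzdzbar_eq, sub_eq_add_neg, ← neg_smul, normalPart_add, normalPart_smul,
      normalPart_smul, hY, smul_zero, add_zero]
    have : normalPart Y z (nullSection Y z) = 0 := by
      simp only [normalPart, lorentz_comm (nullSection Y z) (Y z), e4, e10,
        lorentz_comm (nullSection Y z) (dz Y z), lorentz_comm (nullSection Y z) (dzbar Y z),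
        e8, e9]; module
    rw [this, smul_zero]

/-- Expansion of a vector of `V ⊗ ℂ` in the frame `Y, Y_z, Y_z̄, N`. -/
lemma eq_of_mem_centralSphere (h : IsCanonicalLift Ω Y) (hz : z ∈ Ω) {w : Fin (m + 1) → ℂ}
    (hw : w ∈ centralSphere Y z) :
    w = -(lorentz w (nullSection Y z)) • Y z - lorentz w (Y z) • nullSection Y z
    + (2 * lorentz w (dzbar Y z)) • dz Y z + (2 * lorentz w (dz Y z)) • dzbar Y z := by
  have := normalPart_of_mem h hz hw
  rw [normalPart] at this
  rw [← sub_eq_zero, ← this]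
  module

lemma normalPart_congr (h : IsCanonicalLift Ω Y) (hz : z ∈ Ω) {v w : Fin (m + 1) → ℂ}
    (hvw : v - w ∈ centralSphere Y z) : normalPart Y z v = normalPart Y z w := by
  have : v = w + (v - w) := by abel
  rw [this, normalPart_add, normalPart_of_mem h hz hvw, add_zero]

lemma normalPart_hopf (h : IsCanonicalLift Ω Y) (hz : z ∈ Ω) :
    normalPart Y z (hopf Y z) = hopf Y z :=
  normalPart_eq_self (h.hopf_Y hz) (h.hopf_dz hz) (h.hopf_dzbar hz) (h.hopf_N hz)

end NormalPart

/-! ### The second envelope -/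

/-- `Z` is a smooth real null lift of a conformal immersion that envelops the mean curvature
spheres of the canonical lift `Y`, normalised by `⟨Y, Z⟩ = -1`. -/
structure IsEnvelopePair {m : ℕ} (Ω : Set ℂ) (Y Z : ℂ → Fin (m + 1) → ℂ) : Prop
    extends IsCanonicalLift Ω Y where
  smoothZ : ContDiffOn ℝ ∞ Z Ω
  realZ : ∀ z ∈ Ω, star (Z z) = Z z
  nullZ : ∀ z ∈ Ω, lorentz (Z z) (Z z) = 0
  Y_Z : ∀ z ∈ Ω, lorentz (Y z) (Z z) = -1
  Z_mem : ∀ z ∈ Ω, Z z ∈ centralSphere Y z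
  dzZ_mem : ∀ z ∈ Ω, dz Z z ∈ centralSphere Y z
  dzbarZ_mem : ∀ z ∈ Ω, dzbar Z z ∈ centralSphere Y z
  conformalZ : ∀ z ∈ Ω, lorentz (dz Z z) (dz Z z) = 0
  immersedZ : ∀ z ∈ Ω, lorentz (dz Z z) (dzbar Z z) ≠ 0

section Envelope

variable {m : ℕ} (Y Z : ℂ → Fin (m + 1) → ℂ)

/-- The function `μ` with `Z ≡ N + μ̄ Y_z + μ Y_z̄` modulo `Y`. -/
noncomputable def envMu (z : ℂ) : ℂ := 2 * lorentz (Z z) (dz Y z)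

/-- The projection `P = Y_z + (μ/2) Y` of `Y_z` to the orthogonal complement of `Y` and `Z`. -/
noncomputable def envP (z : ℂ) : Fin (m + 1) → ℂ := dz Y z + (envMu Y Z z / 2) • Y z

/-- The coefficient `θ` of `P̄` in `Z_z`. The differentials of `Y` and `Z` both project to the plane
of `V` orthogonal to `Y` and `Z`, and `θ` vanishes where these projections differ by an orientation
preserving similarity. -/
noncomputable def envTheta (z : ℂ) : ℂ := 2 * lorentz (dz Z z) (envP Y Z z)

/-- The coefficient `ρ` of `P` in `Z_z`. It vanishes where the projections of the differentials of
`Y` and `Z` to the plane of `V` orthogonal to `Y` and `Z` differ by an orientation reversing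
similarity. -/
noncomputable def envRho (z : ℂ) : ℂ := 2 * lorentz (dz Z z) (star (envP Y Z z))

end Envelope

namespace IsEnvelopePair

variable {m : ℕ} {Ω : Set ℂ} {Y Z : ℂ → Fin (m + 1) → ℂ} {z : ℂ}

lemma smooth_dzZ (h : IsEnvelopePair Ω Y Z) : ContDiffOn ℝ ∞ (dz Z) Ω :=
  contDiffOn_dz h.isOpen h.smoothZ

lemma smooth_mu (h : IsEnvelopePair Ω Y Z) : ContDiffOn ℝ ∞ (envMu Y Z) Ω :=
  contDiffOn_const.mul (contDiffOn_lorentz h.smoothZ h.smooth_dz)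

lemma smooth_P (h : IsEnvelopePair Ω Y Z) : ContDiffOn ℝ ∞ (envP Y Z) Ω :=
  h.smooth_dz.add ((h.smooth_mu.div_const 2).smul h.smooth)

lemma smooth_theta (h : IsEnvelopePair Ω Y Z) : ContDiffOn ℝ ∞ (envTheta Y Z) Ω :=
  contDiffOn_const.mul (contDiffOn_lorentz h.smooth_dzZ h.smooth_P)

lemma smooth_rho (h : IsEnvelopePair Ω Y Z) : ContDiffOn ℝ ∞ (envRho Y Z) Ω :=
  contDiffOn_const.mul (contDiffOn_lorentz h.smooth_dzZ (contDiffOn_star h.smooth_P))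

lemma star_P (h : IsEnvelopePair Ω Y Z) (hz : z ∈ Ω) :
    star (envP Y Z z) = dzbar Y z + (star (envMu Y Z z) / 2) • Y z := by
  rw [envP, star_add, star_smul, h.real z hz, h.dzbar_eq hz]
  simp

lemma Z_dzbar (h : IsEnvelopePair Ω Y Z) (hz : z ∈ Ω) :
    lorentz (Z z) (dzbar Y z) = star (envMu Y Z z) / 2 := by
  rw [h.dzbar_eq hz, ← h.realZ z hz, lorentz_star, envMu]
  simp

lemma Z_dz (Y Z : ℂ → Fin (m + 1) → ℂ) (z : ℂ) : lorentz (Z z) (dz Y z) = envMu Y Z z / 2 := by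
  rw [envMu]; ring

lemma Z_eq (h : IsEnvelopePair Ω Y Z) (hz : z ∈ Ω) :
    Z z = -(lorentz (Z z) (nullSection Y z)) • Y z + nullSection Y z
      + star (envMu Y Z z) • dz Y z + envMu Y Z z • dzbar Y z := by
  have := eq_of_mem_centralSphere h.toIsCanonicalLift hz (h.Z_mem z hz)
  rw [h.Z_dzbar hz, Z_dz, lorentz_comm (Z z) (Y z), h.Y_Z z hz] at this
  conv_lhs => rw [this]
  module

lemma P_P (h : IsEnvelopePair Ω Y Z) (hz : z ∈ Ω) : lorentz (envP Y Z z) (envP Y Z z) = 0 := by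
  simp only [envP, lorentz_add_left, lorentz_add_right, lorentz_smul_left, lorentz_smul_right,
    h.dz_dz z hz, lorentz_comm (dz Y z) (Y z), h.Y_dz hz, h.null z hz]
  ring

lemma P_star_P (h : IsEnvelopePair Ω Y Z) (hz : z ∈ Ω) :
    lorentz (envP Y Z z) (star (envP Y Z z)) = 1 / 2 := by
  rw [h.star_P hz]
  simp only [envP, lorentz_add_left, lorentz_add_right, lorentz_smul_left, lorentz_smul_right,
    h.dz_dzbar z hz, lorentz_comm (dz Y z) (Y z), h.Y_dz hz, h.Y_dzbar hz, h.null z hz]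
  ring

lemma Y_P (h : IsEnvelopePair Ω Y Z) (hz : z ∈ Ω) : lorentz (Y z) (envP Y Z z) = 0 := by
  simp only [envP, lorentz_add_right, lorentz_smul_right, h.Y_dz hz, h.null z hz]
  ring

lemma Z_P (h : IsEnvelopePair Ω Y Z) (hz : z ∈ Ω) : lorentz (Z z) (envP Y Z z) = 0 := by
  simp only [envP, lorentz_add_right, lorentz_smul_right, Z_dz, lorentz_comm (Z z) (Y z),
    h.Y_Z z hz]
  ring

lemma Y_star_P (h : IsEnvelopePair Ω Y Z) (hz : z ∈ Ω) :
    lorentz (Y z) (star (envP Y Z z)) = 0 := by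
  rw [← h.real z hz, lorentz_star, h.Y_P hz, star_zero]

lemma Z_star_P (h : IsEnvelopePair Ω Y Z) (hz : z ∈ Ω) :
    lorentz (Z z) (star (envP Y Z z)) = 0 := by
  rw [← h.realZ z hz, lorentz_star, h.Z_P hz, star_zero]

lemma star_P_star_P (h : IsEnvelopePair Ω Y Z) (hz : z ∈ Ω) :
    lorentz (star (envP Y Z z)) (star (envP Y Z z)) = 0 := by
  rw [lorentz_star, h.P_P hz, star_zero]

/-- Expansion of a vector of `V ⊗ ℂ` in the frame `Y, Z, P, P̄`. -/
lemma eq_of_mem (h : IsEnvelopePair Ω Y Z) (hz : z ∈ Ω) {w : Fin (m + 1) → ℂ}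
    (hw : w ∈ centralSphere Y z) :
    w = -(lorentz w (Z z)) • Y z - lorentz w (Y z) • Z z
      + (2 * lorentz w (star (envP Y Z z))) • envP Y Z z
      + (2 * lorentz w (envP Y Z z)) • star (envP Y Z z) := by
  have h1 := eq_of_mem_centralSphere h.toIsCanonicalLift hz hw
  have h2 := h.Z_eq hz
  have h3 : lorentz (Z z) (nullSection Y z) = - (star (envMu Y Z z) * envMu Y Z z) / 2 := by
    have h4 := h.nullZ z hz
    conv_lhs at h4 => arg 2; rw [h2]
    simp only [lorentz_add_right, lorentz_smul_right, h.Z_dzbar hz, Z_dz,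
      lorentz_comm (Z z) (Y z), h.Y_Z z hz] at h4
    linear_combination (1 / 2 : ℂ) * h4
  rw [h3] at h2
  rw [h.star_P hz]
  conv_lhs => rw [h1]
  simp only [h2, envP, lorentz_add_right, lorentz_smul_right]
  module

lemma Y_dzZ (h : IsEnvelopePair Ω Y Z) (hz : z ∈ Ω) :
    lorentz (dz Z z) (Y z) = - (envMu Y Z z / 2) := by
  rw [lorentz_comm, lorentz_dz_of_const h.isOpen h.smooth h.smoothZ h.Y_Z hz, lorentz_comm, Z_dz]

lemma Z_dzZ (h : IsEnvelopePair Ω Y Z) (hz : z ∈ Ω) : lorentz (dz Z z) (Z z) = 0 := by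
  have := lorentz_dz_of_const h.isOpen h.smoothZ h.smoothZ h.nullZ hz
  rw [lorentz_comm (Z z)] at this
  linear_combination (1 / 2 : ℂ) * this

lemma dzZ_eq (h : IsEnvelopePair Ω Y Z) (hz : z ∈ Ω) :
    dz Z z = (envMu Y Z z / 2) • Z z + envRho Y Z z • envP Y Z z
      + envTheta Y Z z • star (envP Y Z z) := by
  have := h.eq_of_mem hz (h.dzZ_mem z hz)
  rw [h.Z_dzZ hz, h.Y_dzZ hz] at this
  conv_lhs => rw [this]
  rw [envRho, envTheta]
  module

lemma dzbarZ_eq_star (h : IsEnvelopePair Ω Y Z) (hz : z ∈ Ω) : dzbar Z z = star (dz Z z) :=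
  dzbar_eq_star_dz h.isOpen h.realZ hz

/-- Conformality of the second envelope. -/
lemma theta_mul_rho (h : IsEnvelopePair Ω Y Z) (hz : z ∈ Ω) :
    envTheta Y Z z * envRho Y Z z = 0 := by
  have := h.conformalZ z hz
  conv_lhs at this => arg 2; rw [h.dzZ_eq hz]
  simp only [lorentz_add_right, lorentz_smul_right, h.Z_dzZ hz] at this
  have e1 : envTheta Y Z z = 2 * lorentz (dz Z z) (envP Y Z z) := rfl
  have e2 : envRho Y Z z = 2 * lorentz (dz Z z) (star (envP Y Z z)) := rfl
  linear_combination this + (1 / 2 : ℂ) * envRho Y Z z * e1 + (1 / 2 : ℂ) * envTheta Y Z z * e2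

lemma theta_ne_or_rho_ne (h : IsEnvelopePair Ω Y Z) (hz : z ∈ Ω) (h1 : envTheta Y Z z = 0)
    (h2 : envRho Y Z z = 0) : False := by
  have h3 := h.dzZ_eq hz
  rw [h1, h2, zero_smul, zero_smul, add_zero, add_zero] at h3
  apply h.immersedZ z hz
  rw [h.dzbarZ_eq_star hz]
  have h4 : star (dz Z z) = star ((envMu Y Z z / 2) • Z z) := congrArg star h3
  rw [h4, star_smul, h.realZ z hz, lorentz_smul_right, h.Z_dzZ hz, mul_zero]

lemma hopf_Z (h : IsEnvelopePair Ω Y Z) (hz : z ∈ Ω) : lorentz (hopf Y z) (Z z) = 0 :=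
  lorentz_centralSphere (h.hopf_Y hz) (h.hopf_dz hz) (h.hopf_dzbar hz) (h.hopf_N hz) (h.Z_mem z hz)

lemma hopf_P (h : IsEnvelopePair Ω Y Z) (hz : z ∈ Ω) : lorentz (hopf Y z) (envP Y Z z) = 0 := by
  simp [envP, h.hopf_Y hz, h.hopf_dz hz]

lemma hopf_star_P (h : IsEnvelopePair Ω Y Z) (hz : z ∈ Ω) :
    lorentz (hopf Y z) (star (envP Y Z z)) = 0 := by
  simp [h.star_P hz, h.hopf_Y hz, h.hopf_dzbar hz]

/-- Up to the term `θ`, the function `μ` satisfies a Riccati equation. -/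
lemma theta_eq (h : IsEnvelopePair Ω Y Z) (hz : z ∈ Ω) :
    envTheta Y Z z = dz (envMu Y Z) z - schwarzian Y z - envMu Y Z z ^ 2 / 2 := by
  have h1 : dz (envMu Y Z) z = 2 * (lorentz (dz Z z) (dz Y z) + lorentz (Z z) (dz (dz Y) z)) := by
    rw [← dz_lorentz (diffAt_of_contDiffOn h.isOpen h.smoothZ hz)
      (diffAt_of_contDiffOn h.isOpen h.smooth_dz hz)]
    exact dz_const_smul (X := ℂ) 2
      (diffAt_of_contDiffOn h.isOpen (contDiffOn_lorentz h.smoothZ h.smooth_dz) hz)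
  have h2 : lorentz (Z z) (dz (dz Y) z) = schwarzian Y z / 2 := by
    have := h.hopf_Z hz
    rw [hopf, lorentz_add_left, lorentz_smul_left, h.Y_Z z hz, lorentz_comm] at this
    linear_combination this
  rw [h1, h2, envTheta, envP, lorentz_add_right, lorentz_smul_right, h.Y_dzZ hz]
  ring

lemma dzP_eq (h : IsEnvelopePair Ω Y Z) (hz : z ∈ Ω) :
    dz (envP Y Z) z = hopf Y z + (envMu Y Z z / 2) • envP Y Z z
      + (envTheta Y Z z / 2) • Y z := by
  have e : dz (envP Y Z) z = dz (dz Y) z + ((envMu Y Z z / 2) • dz Y z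
      + (dz (envMu Y Z) z / 2) • Y z) := by
    have hmu := diffAt_of_contDiffOn h.isOpen h.smooth_mu hz
    have hY := diffAt_of_contDiffOn h.isOpen h.smooth hz
    have e2 : dz (fun w => envMu Y Z w / 2) z = dz (envMu Y Z) z / 2 := by
      simp only [div_eq_inv_mul]
      exact dz_const_smul (X := ℂ) _ hmu
    have e3 : envP Y Z = fun w => dz Y w + (envMu Y Z w / 2) • Y w := rfl
    have hmu' : DifferentiableAt ℝ (fun w => envMu Y Z w / 2) z :=
      diffAt_of_contDiffOn h.isOpen (h.smooth_mu.div_const 2) hz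
    rw [e3, dz_add (diffAt_of_contDiffOn h.isOpen h.smooth_dz hz) (hmu'.fun_smul hY),
      dz_smul hmu' hY, e2]
  rw [e, h.theta_eq hz, hopf, envP]
  module

/-- The enveloping condition forces `D_z̄ κ` to be a multiple of `κ`: modulo `V`, the derivative
`Z_z` is `2 Y_{z z z̄} + μ̄ Y_zz`, and `Y_{z z z̄}` is `D_z̄ κ`. -/
lemma normalDzbar_hopf (h : IsEnvelopePair Ω Y Z) (hz : z ∈ Ω) :
    normalDzbar Y (hopf Y) z = (-(star (envMu Y Z z) / 2)) • hopf Y z := by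
  have hc := h.toIsCanonicalLift
  have dY := diffAt_of_contDiffOn h.isOpen h.smooth hz
  have dYz := diffAt_of_contDiffOn h.isOpen h.smooth_dz hz
  have dYb := diffAt_of_contDiffOn h.isOpen h.smooth_dzbar hz
  have dYzb := diffAt_of_contDiffOn h.isOpen h.smooth_dzdzbar hz
  have dmu := diffAt_of_contDiffOn h.isOpen h.smooth_mu hz
  have dmub : DifferentiableAt ℝ (fun w => star (envMu Y Z w)) z :=
    diffAt_of_contDiffOn h.isOpen (contDiffOn_star h.smooth_mu) hz
  -- the third order term `Y_zzz̄`
  have e3 : dzbar (dz (dz Y)) z = dz (dz (dzbar Y)) z := by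
    rw [dz_dzbar_comm h.isOpen h.smooth_dz hz]
    exact dz_congr_on h.isOpen (fun w hw => dz_dzbar_comm h.isOpen h.smooth hw) hz
  have hs : ContDiffOn ℝ ∞ (fun w => schwarzian Y w / 2) Ω := h.smooth_schwarzian.div_const 2
  have k1 : normalPart Y z (dzbar (hopf Y) z) = normalPart Y z (dz (dz (dzbar Y)) z) := by
    apply normalPart_congr hc hz
    have e4 : hopf Y = fun w => dz (dz Y) w + (schwarzian Y w / 2) • Y w := rfl
    have ds := diffAt_of_contDiffOn h.isOpen hs hz
    rw [e4, dzbar_add (diffAt_of_contDiffOn h.isOpen h.smooth_dzdz hz) (ds.fun_smul dY),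
      dzbar_smul ds dY, e3, add_sub_cancel_left]
    exact add_mem (Submodule.smul_mem _ _ dzbar_mem) (Submodule.smul_mem _ _ Y_mem)
  have hq : ContDiffOn ℝ ∞ (fun w => 2 * lorentz (dz (dzbar Y) w) (dz (dzbar Y) w)
      - lorentz (Z w) (nullSection Y w)) Ω :=
    (contDiffOn_const.mul (contDiffOn_lorentz h.smooth_dzdzbar h.smooth_dzdzbar)).sub
      (contDiffOn_lorentz h.smoothZ h.smooth_N)
  have dq := diffAt_of_contDiffOn h.isOpen hq hz
  have k2 : normalPart Y z (dz Z z) =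
      normalPart Y z ((2 : ℂ) • dz (dz (dzbar Y)) z + star (envMu Y Z z) • hopf Y z) := by
    apply normalPart_congr hc hz
    have e5 : dz Z z = dz (fun w => ((2 : ℂ) • dz (dzbar Y) w +
        (2 * lorentz (dz (dzbar Y) w) (dz (dzbar Y) w) - lorentz (Z w) (nullSection Y w)) • Y w) +
        (star (envMu Y Z w) • dz Y w + envMu Y Z w • dzbar Y w)) z := by
      apply dz_congr_on h.isOpen (fun w hw => ?_) hz
      conv_lhs => rw [h.Z_eq hw, nullSection]
      rw [nullSection]
      module
    have c2 : DifferentiableAt ℝ (fun w => (2 : ℂ) • dz (dzbar Y) w) z := dYzb.const_smul (2 : ℂ)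
    rw [e5, dz_add (c2.fun_add (dq.fun_smul dY)) ((dmub.fun_smul dYz).fun_add (dmu.fun_smul dYb)),
      dz_add c2 (dq.fun_smul dY), dz_add (dmub.fun_smul dYz) (dmu.fun_smul dYb),
      dz_const_smul _ dYzb, dz_smul dq dY, dz_smul dmub dYz, dz_smul dmu dYb, hopf]
    have : ∀ a b d e f g : Fin (m + 1) → ℂ, ∀ r c : ℂ,
        (2 : ℂ) • a + (b + d) + ((c • e + f) + g) - ((2 : ℂ) • a + c • (e + r • Y z))
          = b + d + f + g - (c * r) • Y z := by
      intros; module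
    rw [this]
    exact sub_mem (add_mem (add_mem (add_mem (Submodule.smul_mem _ _ dz_mem)
      (Submodule.smul_mem _ _ Y_mem)) (Submodule.smul_mem _ _ dz_mem))
      (add_mem (Submodule.smul_mem _ _ dzdzbar_mem) (Submodule.smul_mem _ _ dzbar_mem)))
      (Submodule.smul_mem _ _ Y_mem)
  rw [normalPart_of_mem hc hz (h.dzZ_mem z hz), normalPart_add, normalPart_smul, normalPart_smul,
    normalPart_hopf hc hz] at k2
  rw [normalDzbar, k1]
  have : normalPart Y z (dz (dz (dzbar Y)) z) = (1 / 2 : ℂ) •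
      ((2 : ℂ) • normalPart Y z (dz (dz (dzbar Y)) z) + star (envMu Y Z z) • hopf Y z)
      - (star (envMu Y Z z) / 2) • hopf Y z := by
    module
  rw [this, ← k2]
  module

lemma not_linearIndependent (h : IsEnvelopePair Ω Y Z) (hz : z ∈ Ω) :
    ¬ LinearIndependent ℂ ![hopf Y z, normalDzbar Y (hopf Y) z] := by
  rw [h.normalDzbar_hopf hz, LinearIndependent.pair_iff]
  intro hl
  exact one_ne_zero (hl (star (envMu Y Z z) / 2) 1 (by module)).2

/-- The Euler-Lagrange expression of the Willmore functional equals `-(θ̄/2) κ`. -/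
lemma willmoreEq_iff (h : IsEnvelopePair Ω Y Z) (hz : z ∈ Ω) :
    WillmoreEq Y z ↔ envTheta Y Z z = 0 ∨ hopf Y z = 0 := by
  have dmub : DifferentiableAt ℝ (fun w => star (envMu Y Z w)) z :=
    diffAt_of_contDiffOn h.isOpen (contDiffOn_star h.smooth_mu) hz
  have dmub' : DifferentiableAt ℝ (fun w => (-1 / 2 : ℂ) • star (envMu Y Z w)) z :=
    dmub.const_smul (-1 / 2 : ℂ)
  have e : normalDzbar Y (normalDzbar Y (hopf Y)) z
      + (starRingEnd ℂ (schwarzian Y z) / 2) • hopf Y z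
      = (-(1 / 2) * star (envTheta Y Z z)) • hopf Y z := by
    have e1 : dzbar (normalDzbar Y (hopf Y)) z =
        dzbar (fun w => ((-1 / 2 : ℂ) • star (envMu Y Z w)) • hopf Y w) z := by
      apply dzbar_congr_on h.isOpen (fun w hw => ?_) hz
      rw [h.normalDzbar_hopf hw, smul_eq_mul]; module
    have e2 : normalPart Y z (dzbar (hopf Y) z) = (-(star (envMu Y Z z) / 2)) • hopf Y z :=
      h.normalDzbar_hopf hz
    rw [normalDzbar, e1, dzbar_smul dmub' (diffAt_of_contDiffOn h.isOpen h.smooth_hopf hz),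
      dzbar_const_smul _ dmub, dzbar_star, normalPart_add, normalPart_smul, normalPart_smul,
      normalPart_hopf h.toIsCanonicalLift hz, e2, h.theta_eq hz]
    simp only [smul_eq_mul, star_sub, star_div₀, star_pow, starRingEnd_apply, star_ofNat]
    module
  rw [WillmoreEq, e, smul_eq_zero]
  simp

end IsEnvelopePair

/-! ### Real vectors in the complexified Minkowski space -/

/-- The inclusion of `ℝ^k` into its complexification. -/
def toC {k : ℕ} (v : Fin k → ℝ) : Fin k → ℂ := fun i => (v i : ℂ)

/-- The real part of a vector of the complexification of `ℝ^k`. -/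
def toRe {k : ℕ} (v : Fin k → ℂ) : Fin k → ℝ := fun i => (v i).re

lemma toC_toRe {k : ℕ} {v : Fin k → ℂ} (h : star v = v) : toC (toRe v) = v := by
  funext i
  exact Complex.conj_eq_iff_re.1 (congrFun h i)

lemma star_toC {k : ℕ} (v : Fin k → ℝ) : star (toC v) = toC v := by
  funext i; simp [toC]

lemma toC_injective {k : ℕ} : Function.Injective (toC (k := k)) := fun _ _ h => by
  funext i; exact Complex.ofReal_injective (congrFun h i)

lemma lorentz_toC {m : ℕ} (v w : Fin (m + 1) → ℝ) :
    lorentz (toC v) (toC w) = ((lorentz v w : ℝ) : ℂ) := by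
  simp [lorentz, toC]

/-- The orthogonal complement of a time-like vector is positive definite. -/
lemma lorentz_self_of_orthogonal {m : ℕ} {T v : Fin (m + 1) → ℝ} (hT : lorentz T T < 0)
    (h : lorentz T v = 0) : 0 ≤ lorentz v v ∧ (lorentz v v = 0 → v = 0) := by
  simp only [lorentz] at hT h ⊢
  have hcs := Finset.sum_mul_sq_le_sq_mul_sq Finset.univ (fun i : Fin m => T i.succ)
    (fun i : Fin m => v i.succ)
  have e : ∀ u : Fin (m + 1) → ℝ, ∑ i : Fin m, u i.succ * u i.succ = ∑ i : Fin m, u i.succ ^ 2 :=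
    fun u => Finset.sum_congr rfl fun i _ => by ring
  rw [e] at hT
  rw [e, show ∑ i : Fin m, T i.succ * v i.succ = T 0 * v 0 by linarith] at *
  set S := ∑ i : Fin m, v i.succ ^ 2 with hS
  set R := ∑ i : Fin m, T i.succ ^ 2 with hR
  have hS0 : 0 ≤ S := Finset.sum_nonneg fun i _ => sq_nonneg _
  have hR0 : 0 ≤ R := Finset.sum_nonneg fun i _ => sq_nonneg _
  have hT0 : 0 < T 0 * T 0 := by linarith
  have key : T 0 * T 0 * (v 0 * v 0) ≤ R * S := by linarith [hcs, mul_pow (T 0) (v 0) 2]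
  constructor
  · by_contra hneg
    have : T 0 * T 0 * S < T 0 * T 0 * (v 0 * v 0) := mul_lt_mul_of_pos_left (by linarith) hT0
    nlinarith
  · intro h0
    have hSz : S = 0 := by
      by_contra hne
      have hSp : 0 < S := lt_of_le_of_ne hS0 (Ne.symm hne)
      have : v 0 * v 0 = S := by linarith
      rw [this] at key
      nlinarith
    have hz := (Finset.sum_eq_zero_iff_of_nonneg (fun i _ => sq_nonneg _)).1 hSz
    funext i
    refine Fin.cases ?_ (fun j => ?_) i
    · have : v 0 * v 0 = 0 := by linarith
      simpa using this
    · simpa using hz j (Finset.mem_univ _)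

/-! ### Envelopes with the opposite orientation -/

section Definitions

variable {m : ℕ} (Y Z : ℂ → Fin (m + 1) → ℂ) (z : ℂ)

/-- The section `ξ = κ / θ` of `V^⊥`. -/
noncomputable def envXi : Fin (m + 1) → ℂ := (envTheta Y Z z)⁻¹ • hopf Y z

/-- The function `a = 2 |ξ|`. -/
noncomputable def envA : ℂ := ((2 * √(lorentz (envXi Y Z z) (envXi Y Z z)).re : ℝ) : ℂ)

/-- The unit normal vector `ψ = ξ / |ξ|`. -/
noncomputable def envPsi : Fin (m + 1) → ℂ := (2 * (envA Y Z z)⁻¹) • envXi Y Z z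

/-- The lift `X = Y / a`. -/
noncomputable def envX : Fin (m + 1) → ℂ := (envA Y Z z)⁻¹ • Y z

/-- The lift `H = a Z`. -/
noncomputable def envH : Fin (m + 1) → ℂ := envA Y Z z • Z z

/-- The vector `e = ψ + H`, which represents a sphere that contains the image of `Z`. -/
noncomputable def envE : Fin (m + 1) → ℂ := envPsi Y Z z + envH Y Z z

/-- The orthogonal projection of the vector `w` to `V ⊕ ℂψ`. -/
noncomputable def envProj (w : Fin (m + 1) → ℂ) : Fin (m + 1) → ℂ :=
  -(lorentz w (envH Y Z z)) • envX Y Z z - lorentz w (envX Y Z z) • envH Y Z z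
    + (2 * lorentz w (star (envP Y Z z))) • envP Y Z z
    + (2 * lorentz w (envP Y Z z)) • star (envP Y Z z)
    + lorentz w (envPsi Y Z z) • envPsi Y Z z

end Definitions

namespace IsEnvelopePair

variable {m : ℕ} {Ω : Set ℂ} {Y Z : ℂ → Fin (m + 1) → ℂ} {z : ℂ}

lemma lorentz_hopf_of_mem (h : IsEnvelopePair Ω Y Z) (hz : z ∈ Ω) {w : Fin (m + 1) → ℂ}
    (hw : w ∈ centralSphere Y z) : lorentz (hopf Y z) w = 0 :=
  lorentz_centralSphere (h.hopf_Y hz) (h.hopf_dz hz) (h.hopf_dzbar hz) (h.hopf_N hz) hw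

lemma dzbarP_mem (h : IsEnvelopePair Ω Y Z) (hz : z ∈ Ω) :
    dzbar (envP Y Z) z ∈ centralSphere Y z := by
  have hmu : DifferentiableAt ℝ (fun w => envMu Y Z w / 2) z :=
    diffAt_of_contDiffOn h.isOpen (h.smooth_mu.div_const 2) hz
  have hY := diffAt_of_contDiffOn h.isOpen h.smooth hz
  have e3 : envP Y Z = fun w => dz Y w + (envMu Y Z w / 2) • Y w := rfl
  rw [e3, dzbar_add (diffAt_of_contDiffOn h.isOpen h.smooth_dz hz) (hmu.fun_smul hY),
    dzbar_smul hmu hY, dz_dzbar_comm h.isOpen h.smooth hz]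
  exact add_mem dzdzbar_mem (add_mem (Submodule.smul_mem _ _ dzbar_mem)
    (Submodule.smul_mem _ _ Y_mem))

lemma star_dzP (h : IsEnvelopePair Ω Y Z) (hz : z ∈ Ω) :
    star (dz (envP Y Z) z) = star (hopf Y z) + (star (envMu Y Z z) / 2) • star (envP Y Z z)
      + (star (envTheta Y Z z) / 2) • Y z := by
  rw [h.dzP_eq hz]
  simp only [star_add, star_smul, star_div₀, star_ofNat, h.real z hz]

lemma dzbar_hopf_eq (h : IsEnvelopePair Ω Y Z) (hz : z ∈ Ω) :
    dzbar (hopf Y) z = (-(star (envMu Y Z z) / 2)) • hopf Y z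
      - (2 * lorentz (hopf Y z) (star (hopf Y z))) • envP Y Z z := by
  have hN : nullSection Y z ∈ centralSphere Y z :=
    add_mem (Submodule.smul_mem _ _ dzdzbar_mem) (Submodule.smul_mem _ _ Y_mem)
  have hw : dzbar (hopf Y) z + (star (envMu Y Z z) / 2) • hopf Y z ∈ centralSphere Y z := by
    have h1 := h.normalDzbar_hopf hz
    rw [normalDzbar, normalPart] at h1
    have h2 : dzbar (hopf Y) z + (star (envMu Y Z z) / 2) • hopf Y z =
        -(lorentz (dzbar (hopf Y) z) (nullSection Y z) • Y z
        + lorentz (dzbar (hopf Y) z) (Y z) • nullSection Y z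
        - (2 * lorentz (dzbar (hopf Y) z) (dzbar Y z)) • dz Y z
        - (2 * lorentz (dzbar (hopf Y) z) (dz Y z)) • dzbar Y z) := by
      rw [← sub_eq_zero] at h1 ⊢
      rw [← h1]; module
    rw [h2]
    exact neg_mem (sub_mem (sub_mem (add_mem (Submodule.smul_mem _ _ Y_mem)
      (Submodule.smul_mem _ _ hN)) (Submodule.smul_mem _ _ dz_mem))
      (Submodule.smul_mem _ _ dzbar_mem))
  have f1 : lorentz (dzbar (hopf Y) z) (Y z) = 0 := by
    have := lorentz_dzbar_of_const h.isOpen h.smooth_hopf h.smooth (fun w hw => h.hopf_Y hw) hz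
    rw [h.hopf_dzbar hz] at this
    linear_combination this
  have f2 : lorentz (dzbar (hopf Y) z) (Z z) = 0 := by
    have := lorentz_dzbar_of_const h.isOpen h.smooth_hopf h.smoothZ (fun w hw => h.hopf_Z hw) hz
    rw [h.lorentz_hopf_of_mem hz (h.dzbarZ_mem z hz)] at this
    linear_combination this
  have f3 : lorentz (dzbar (hopf Y) z) (envP Y Z z) = 0 := by
    have := lorentz_dzbar_of_const h.isOpen h.smooth_hopf h.smooth_P (fun w hw => h.hopf_P hw) hz
    rw [h.lorentz_hopf_of_mem hz (h.dzbarP_mem hz)] at this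
    linear_combination this
  have f4 : lorentz (dzbar (hopf Y) z) (star (envP Y Z z))
      = -lorentz (hopf Y z) (star (hopf Y z)) := by
    have := lorentz_dzbar_of_const h.isOpen h.smooth_hopf (contDiffOn_star h.smooth_P)
      (fun w hw => h.hopf_star_P hw) hz
    rw [dzbar_star, h.star_dzP hz] at this
    simp only [lorentz_add_right, lorentz_smul_right, h.hopf_star_P hz, h.hopf_Y hz] at this
    linear_combination this
  have h3 := h.eq_of_mem hz hw
  simp only [lorentz_add_left, lorentz_smul_left, f1, f2, f3, f4, h.hopf_Z hz, h.hopf_Y hz,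
    h.hopf_P hz, h.hopf_star_P hz] at h3
  rw [← sub_eq_zero] at h3 ⊢
  rw [← h3]; module

variable (h : IsEnvelopePair Ω Y Z) (hρ : ∀ z ∈ Ω, envRho Y Z z = 0)
include h hρ

lemma theta_ne_zero (hz : z ∈ Ω) : envTheta Y Z z ≠ 0 :=
  fun h0 => h.theta_ne_or_rho_ne hz h0 (hρ z hz)

lemma dzZ_eq' (hz : z ∈ Ω) :
    dz Z z = (envMu Y Z z / 2) • Z z + envTheta Y Z z • star (envP Y Z z) := by
  rw [h.dzZ_eq hz, hρ z hz]; module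

lemma dzbarZ_eq' (hz : z ∈ Ω) :
    dzbar Z z = (star (envMu Y Z z) / 2) • Z z + star (envTheta Y Z z) • envP Y Z z := by
  rw [h.dzbarZ_eq_star hz, h.dzZ_eq' hρ hz]
  simp only [star_add, star_smul, star_div₀, star_ofNat, h.realZ z hz, star_star]

/-- Since `Z` is real, so is `Z_{z z̄}`; this contains the Gauss and Codazzi equations that are
needed: `θ` is holomorphic and `κ` is a real multiple of `θ`. -/
lemma theta_holomorphic_and_real (hz : z ∈ Ω) :
    dzbar (envTheta Y Z) z = 0 ∧
      envTheta Y Z z • star (hopf Y z) = star (envTheta Y Z z) • hopf Y z := by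
  have dZ := diffAt_of_contDiffOn h.isOpen h.smoothZ hz
  have dmu : DifferentiableAt ℝ (fun w => envMu Y Z w / 2) z :=
    diffAt_of_contDiffOn h.isOpen (h.smooth_mu.div_const 2) hz
  have dth := diffAt_of_contDiffOn h.isOpen h.smooth_theta hz
  have dPb : DifferentiableAt ℝ (fun w => star (envP Y Z w)) z :=
    diffAt_of_contDiffOn h.isOpen (contDiffOn_star h.smooth_P) hz
  set A := dzbar (dz Z) z with hA
  obtain ⟨c, hc⟩ : ∃ c, c = dzbar (fun w => envMu Y Z w / 2) z := ⟨_, rfl⟩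
  have e1 : A = (envMu Y Z z / 2) • ((star (envMu Y Z z) / 2) • Z z
        + star (envTheta Y Z z) • envP Y Z z) + c • Z z
      + (envTheta Y Z z • (star (hopf Y z) + (star (envMu Y Z z) / 2) • star (envP Y Z z)
        + (star (envTheta Y Z z) / 2) • Y z) + dzbar (envTheta Y Z) z • star (envP Y Z z)) := by
    rw [hA, dzbar_congr_on h.isOpen (fun w hw => h.dzZ_eq' hρ hw) hz,
      dzbar_add (dmu.fun_smul dZ) (dth.fun_smul dPb), dzbar_smul dmu dZ, dzbar_smul dth dPb,
      dzbar_star, h.star_dzP hz, h.dzbarZ_eq' hρ hz, hc]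
  have e2 : star A = A := by
    rw [hA, ← dz_star, dz_dzbar_comm h.isOpen h.smoothZ hz]
    exact dz_congr_on h.isOpen (fun w hw => (h.dzbarZ_eq_star hw).symm) hz
  have b1 : lorentz (envP Y Z z) (star (hopf Y z)) = 0 := by
    rw [← star_star (envP Y Z z), lorentz_star, lorentz_comm, h.hopf_star_P hz, star_zero]
  have b2 : lorentz (star (envP Y Z z)) (star (hopf Y z)) = 0 := by
    rw [lorentz_star, lorentz_comm, h.hopf_P hz, star_zero]
  have b3 : lorentz (Y z) (star (hopf Y z)) = 0 := by
    rw [← h.real z hz, lorentz_star, lorentz_comm, h.hopf_Y hz, star_zero]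
  have AP : lorentz (envP Y Z z) A =
      envTheta Y Z z * star (envMu Y Z z) / 4 + dzbar (envTheta Y Z) z / 2 := by
    rw [e1]
    simp only [lorentz_add_right, lorentz_smul_right, b1, h.P_P hz, h.P_star_P hz,
      lorentz_comm _ (Y z), h.Y_P hz, lorentz_comm _ (Z z), h.Z_P hz]
    ring
  have APb : lorentz (star (envP Y Z z)) A = envMu Y Z z * star (envTheta Y Z z) / 4 := by
    rw [e1]
    simp only [lorentz_add_right, lorentz_smul_right, b2, h.star_P_star_P hz,
      lorentz_comm _ (envP Y Z z), h.P_star_P hz,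
      lorentz_comm _ (Y z), h.Y_star_P hz, lorentz_comm _ (Z z), h.Z_star_P hz]
    ring
  have AY : lorentz (Y z) A = -(envMu Y Z z * star (envMu Y Z z) / 4) - c := by
    rw [e1]
    simp only [lorentz_add_right, lorentz_smul_right, b3, h.Y_star_P hz, h.Y_P hz, h.Y_Z z hz,
      h.null z hz]
    ring
  have hth : dzbar (envTheta Y Z) z = 0 := by
    have : lorentz (envP Y Z z) A = star (lorentz (star (envP Y Z z)) A) := by
      rw [← lorentz_star, star_star, e2]
    rw [AP, APb] at this
    simp only [star_div₀, star_mul', star_star, star_ofNat] at this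
    linear_combination 2 * this
  refine ⟨hth, ?_⟩
  have hcr : star c = c := by
    have : star (lorentz (Y z) A) = lorentz (Y z) A := by
      rw [← lorentz_star, h.real z hz, e2]
    rw [AY] at this
    simp only [star_sub, star_neg, star_div₀, star_mul', star_star, star_ofNat] at this
    linear_combination -this
  rw [hth] at e1
  have e3 := e2
  rw [e1] at e3
  simp only [star_add, star_smul, star_div₀, star_star, star_ofNat, h.realZ z hz,
    h.real z hz, hcr, star_zero] at e3
  rw [← sub_eq_zero] at e3 ⊢
  rw [← neg_eq_zero, ← e3]
  module

lemma smooth_xi : ContDiffOn ℝ ∞ (envXi Y Z) Ω :=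
  (h.smooth_theta.inv fun _ hz => h.theta_ne_zero hρ hz).smul h.smooth_hopf

lemma hopf_eq (hz : z ∈ Ω) : hopf Y z = envTheta Y Z z • envXi Y Z z := by
  rw [envXi, smul_inv_smul₀ (h.theta_ne_zero hρ hz)]

omit h hρ in
lemma xi_of_orthogonal {w : Fin (m + 1) → ℂ} (hw : lorentz (hopf Y z) w = 0) :
    lorentz (envXi Y Z z) w = 0 := by
  rw [envXi, lorentz_smul_left, hw, mul_zero]

/-- The section `ξ` of `V^⊥ ⊗ ℂ` is real. -/
lemma star_xi (hz : z ∈ Ω) : star (envXi Y Z z) = envXi Y Z z := by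
  have h1 := (h.theta_holomorphic_and_real hρ hz).2
  have ht := h.theta_ne_zero hρ hz
  have ht' : star (envTheta Y Z z) ≠ 0 := by simpa using ht
  rw [envXi, star_smul, star_inv₀, inv_smul_eq_iff₀ ht', smul_comm, eq_comm, inv_smul_eq_iff₀ ht,
    h1]

lemma dzbar_xi (hz : z ∈ Ω) : dzbar (envXi Y Z) z = (-(star (envMu Y Z z) / 2)) • envXi Y Z z
    - (2 * star (envTheta Y Z z) * lorentz (envXi Y Z z) (envXi Y Z z)) • envP Y Z z := by
  have e1 : dzbar (hopf Y) z = envTheta Y Z z • dzbar (envXi Y Z) z := by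
    rw [dzbar_congr_on h.isOpen (fun w hw => h.hopf_eq hρ hw) hz,
      dzbar_smul (diffAt_of_contDiffOn h.isOpen h.smooth_theta hz)
        (diffAt_of_contDiffOn h.isOpen (h.smooth_xi hρ) hz),
      (h.theta_holomorphic_and_real hρ hz).1, zero_smul, add_zero]
  rw [h.dzbar_hopf_eq hz, h.hopf_eq hρ hz, star_smul, h.star_xi hρ hz, lorentz_smul_left,
    lorentz_smul_right] at e1
  apply smul_right_injective _ (h.theta_ne_zero hρ hz)
  beta_reduce
  rw [← e1]
  module

lemma star_xi_sq (hz : z ∈ Ω) :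
    star (lorentz (envXi Y Z z) (envXi Y Z z)) = lorentz (envXi Y Z z) (envXi Y Z z) := by
  rw [← lorentz_star, h.star_xi hρ hz]

lemma dz_xi (hz : z ∈ Ω) : dz (envXi Y Z) z = (-(envMu Y Z z / 2)) • envXi Y Z z
    - (2 * envTheta Y Z z * lorentz (envXi Y Z z) (envXi Y Z z)) • star (envP Y Z z) := by
  have e := dzbar_eq_star_dz h.isOpen (fun w hw => h.star_xi hρ hw) hz
  rw [← star_star (dz (envXi Y Z) z), ← e, h.dzbar_xi hρ hz]
  simp only [star_sub, star_smul, star_neg, star_div₀, star_mul', star_star, star_ofNat,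
    h.star_xi hρ hz, h.star_xi_sq hρ hz]

lemma dz_xi_sq (hz : z ∈ Ω) : dz (fun w => lorentz (envXi Y Z w) (envXi Y Z w)) z =
    -envMu Y Z z * lorentz (envXi Y Z z) (envXi Y Z z) := by
  have d := diffAt_of_contDiffOn h.isOpen (h.smooth_xi hρ) hz
  rw [dz_lorentz d d, h.dz_xi hρ hz]
  simp only [lorentz_sub_right, lorentz_smul_right,
    lorentz_comm _ (envXi Y Z z), xi_of_orthogonal (h.hopf_star_P hz)]
  ring

/-- The real vector `ξ` is orthogonal to the time-like vector `Y + Z`. -/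
lemma xi_sq_nonneg (hz : z ∈ Ω) : 0 ≤ (lorentz (envXi Y Z z) (envXi Y Z z)).re ∧
    (lorentz (envXi Y Z z) (envXi Y Z z) = 0 → envXi Y Z z = 0) := by
  have hY := toC_toRe (h.real z hz)
  have hZ := toC_toRe (h.realZ z hz)
  have hx := toC_toRe (h.star_xi hρ hz)
  have e1 := h.null z hz
  have e2 := h.nullZ z hz
  have e3 := h.Y_Z z hz
  have e4 := xi_of_orthogonal (Z := Z) (h.hopf_Y hz)
  have e5 := xi_of_orthogonal (Z := Z) (h.hopf_Z hz)
  rw [← hx] at e4 e5 ⊢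
  rw [← hY] at e1 e3 e4
  rw [← hZ] at e2 e3 e5
  rw [lorentz_toC] at e1 e2 e3 e4 e5 ⊢
  have hT : lorentz (toRe (Y z) + toRe (Z z)) (toRe (Y z) + toRe (Z z)) < 0 := by
    simp only [lorentz_add_left, lorentz_add_right, lorentz_comm (toRe (Z z)) (toRe (Y z))]
    norm_cast at e1 e2 e3
    rw [e1, e2, e3]; norm_num
  have := lorentz_self_of_orthogonal hT (v := toRe (envXi Y Z z)) (by
    norm_cast at e4 e5
    rw [lorentz_comm, lorentz_add_right, e4, e5, add_zero])
  refine ⟨by simpa using this.1, fun h0 => ?_⟩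
  rw [this.2 (by exact_mod_cast h0)]
  funext i; simp [toC]

omit h hρ in
lemma star_A (Y Z : ℂ → Fin (m + 1) → ℂ) (z : ℂ) : star (envA Y Z z) = envA Y Z z := by
  simp [envA]

lemma A_sq (hz : z ∈ Ω) :
    envA Y Z z * envA Y Z z = 4 * lorentz (envXi Y Z z) (envXi Y Z z) := by
  have h1 : ((lorentz (envXi Y Z z) (envXi Y Z z)).re : ℂ) =
    lorentz (envXi Y Z z) (envXi Y Z z) := Complex.conj_eq_iff_re.1 (h.star_xi_sq hρ hz)
  have h2 := Real.mul_self_sqrt (h.xi_sq_nonneg hρ hz).1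
  rw [← h1, envA, ← h2]
  simp only [Real.sqrt_mul_self (Real.sqrt_nonneg _)]
  push_cast; ring

variable (hκ : ∀ z ∈ Ω, hopf Y z ≠ 0)
include hκ

lemma xi_sq_pos (hz : z ∈ Ω) : 0 < (lorentz (envXi Y Z z) (envXi Y Z z)).re := by
  refine lt_of_le_of_ne (h.xi_sq_nonneg hρ hz).1 fun h0 => hκ z hz ?_
  have h1 : ((lorentz (envXi Y Z z) (envXi Y Z z)).re : ℂ) =
    lorentz (envXi Y Z z) (envXi Y Z z) := Complex.conj_eq_iff_re.1 (h.star_xi_sq hρ hz)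
  rw [h.hopf_eq hρ hz, (h.xi_sq_nonneg hρ hz).2 (by rw [← h1, ← h0, Complex.ofReal_zero]),
    smul_zero]

lemma A_ne_zero (hz : z ∈ Ω) : envA Y Z z ≠ 0 := by
  have := Real.sqrt_pos.2 (h.xi_sq_pos hρ hκ hz)
  rw [envA, Complex.ofReal_ne_zero]
  positivity

lemma smooth_A : ContDiffOn ℝ ∞ (envA Y Z) Ω := by
  have h1 : ContDiffOn ℝ ∞ (fun z => (lorentz (envXi Y Z z) (envXi Y Z z)).re) Ω :=
    Complex.reCLM.contDiff.comp_contDiffOn (contDiffOn_lorentz (h.smooth_xi hρ) (h.smooth_xi hρ))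
  have h2 : ContDiffOn ℝ ∞ (fun z => 2 * √(lorentz (envXi Y Z z) (envXi Y Z z)).re) Ω :=
    contDiffOn_const.mul (h1.sqrt fun z hz => (h.xi_sq_pos hρ hκ hz).ne')
  exact Complex.ofRealCLM.contDiff.comp_contDiffOn h2

lemma dz_A (hz : z ∈ Ω) : dz (envA Y Z) z = -(envMu Y Z z / 2) * envA Y Z z := by
  have d := diffAt_of_contDiffOn h.isOpen (h.smooth_A hρ hκ) hz
  have dx : DifferentiableAt ℝ (fun w => lorentz (envXi Y Z w) (envXi Y Z w)) z :=
    diffAt_of_contDiffOn h.isOpen (contDiffOn_lorentz (h.smooth_xi hρ) (h.smooth_xi hρ)) hz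
  have h1 := dz_mul d d
  rw [dz_congr_on h.isOpen (fun w hw => h.A_sq hρ hw) hz] at h1
  have h2 : dz (fun w => 4 * lorentz (envXi Y Z w) (envXi Y Z w)) z = 4 * _ :=
    dz_const_smul (X := ℂ) 4 dx
  rw [h2, h.dz_xi_sq hρ hz] at h1
  have h3 := h.A_sq hρ hz
  apply mul_left_cancel₀ (mul_ne_zero two_ne_zero (h.A_ne_zero hρ hκ hz))
  linear_combination -h1 + envMu Y Z z * h3

lemma smooth_X : ContDiffOn ℝ ∞ (envX Y Z) Ω :=
  ((h.smooth_A hρ hκ).inv fun _ hz => h.A_ne_zero hρ hκ hz).smul h.smooth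

lemma smooth_H : ContDiffOn ℝ ∞ (envH Y Z) Ω := (h.smooth_A hρ hκ).smul h.smoothZ

lemma smooth_psi : ContDiffOn ℝ ∞ (envPsi Y Z) Ω :=
  (contDiffOn_const.mul ((h.smooth_A hρ hκ).inv fun _ hz => h.A_ne_zero hρ hκ hz)).smul
    (h.smooth_xi hρ)

lemma smooth_E : ContDiffOn ℝ ∞ (envE Y Z) Ω := (h.smooth_psi hρ hκ).add (h.smooth_H hρ hκ)

lemma A_smul_X (hz : z ∈ Ω) : envA Y Z z • envX Y Z z = Y z := by
  rw [envX, smul_inv_smul₀ (h.A_ne_zero hρ hκ hz)]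

lemma A_smul_psi (hz : z ∈ Ω) : envA Y Z z • envPsi Y Z z = (2 : ℂ) • envXi Y Z z := by
  rw [envPsi, smul_smul, mul_left_comm, mul_inv_cancel₀ (h.A_ne_zero hρ hκ hz), mul_one]

lemma dz_X (hz : z ∈ Ω) : dz (envX Y Z) z = (envA Y Z z)⁻¹ • envP Y Z z := by
  have h1 : dz Y z = _ := dz_congr_on h.isOpen (fun w hw => (h.A_smul_X hρ hκ hw).symm) hz
  rw [dz_smul (diffAt_of_contDiffOn h.isOpen (h.smooth_A hρ hκ) hz)
    (diffAt_of_contDiffOn h.isOpen (h.smooth_X hρ hκ) hz), h.dz_A hρ hκ hz] at h1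
  rw [eq_inv_smul_iff₀ (h.A_ne_zero hρ hκ hz), envP, h1, ← h.A_smul_X hρ hκ hz]
  module

lemma dz_H (hz : z ∈ Ω) :
    dz (envH Y Z) z = (envA Y Z z * envTheta Y Z z) • star (envP Y Z z) := by
  have e : envH Y Z = fun w => envA Y Z w • Z w := rfl
  rw [e, dz_smul (diffAt_of_contDiffOn h.isOpen (h.smooth_A hρ hκ) hz)
    (diffAt_of_contDiffOn h.isOpen h.smoothZ hz), h.dz_A hρ hκ hz, h.dzZ_eq' hρ hz]
  module

omit hρ hκ in
lemma star_X (hz : z ∈ Ω) : star (envX Y Z z) = envX Y Z z := by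
  rw [envX, star_smul, star_inv₀, star_A, h.real z hz]

omit hρ hκ in
lemma star_H (hz : z ∈ Ω) : star (envH Y Z z) = envH Y Z z := by
  rw [envH, star_smul, star_A, h.realZ z hz]

omit hκ in
lemma star_psi (hz : z ∈ Ω) : star (envPsi Y Z z) = envPsi Y Z z := by
  rw [envPsi, star_smul, star_mul', star_inv₀, star_A, h.star_xi hρ hz, star_ofNat]

omit hκ in
lemma star_E (hz : z ∈ Ω) : star (envE Y Z z) = envE Y Z z := by
  rw [envE, star_add, h.star_psi hρ hz, h.star_H hz]

/-- The vector `e` is constant. It is differentiated in the form `a e = 2 ξ + a H`. -/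
lemma dz_E (hz : z ∈ Ω) : dz (envE Y Z) z = 0 := by
  have dA := diffAt_of_contDiffOn h.isOpen (h.smooth_A hρ hκ) hz
  have dE := diffAt_of_contDiffOn h.isOpen (h.smooth_E hρ hκ) hz
  have dx := diffAt_of_contDiffOn h.isOpen (h.smooth_xi hρ) hz
  have dH := diffAt_of_contDiffOn h.isOpen (h.smooth_H hρ hκ) hz
  have e1 : ∀ w ∈ Ω, envA Y Z w • envE Y Z w
      = (2 : ℂ) • envXi Y Z w + envA Y Z w • envH Y Z w := fun w hw => by
    rw [envE, smul_add, h.A_smul_psi hρ hκ hw]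
  have h1 := dz_congr_on h.isOpen e1 hz
  have d2 : DifferentiableAt ℝ (fun w => (2 : ℂ) • envXi Y Z w) z := dx.const_smul (2 : ℂ)
  rw [dz_smul dA dE, dz_add d2 (dA.fun_smul dH),
    dz_const_smul _ dx, dz_smul dA dH, h.dz_xi hρ hz, h.dz_H hρ hκ hz, h.dz_A hρ hκ hz] at h1
  have h2 := h.A_sq hρ hz
  have h3 := e1 z hz
  have h4 : envA Y Z z • dz (envE Y Z) z = 0 := by
    rw [← sub_eq_zero] at h1 h3
    have : envA Y Z z • dz (envE Y Z) z =
      (envA Y Z z • dz (envE Y Z) z + (-(envMu Y Z z / 2) * envA Y Z z) • envE Y Z z -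
        ((2 : ℂ) • ((-(envMu Y Z z / 2)) • envXi Y Z z -
            (2 * envTheta Y Z z * lorentz (envXi Y Z z) (envXi Y Z z)) • star (envP Y Z z)) +
          (envA Y Z z • (envA Y Z z * envTheta Y Z z) • star (envP Y Z z) +
            (-(envMu Y Z z / 2) * envA Y Z z) • envH Y Z z)))
      + (envMu Y Z z / 2) • (envA Y Z z • envE Y Z z -
        ((2 : ℂ) • envXi Y Z z + envA Y Z z • envH Y Z z))
      + (envTheta Y Z z * (envA Y Z z * envA Y Z z
        - 4 * lorentz (envXi Y Z z) (envXi Y Z z))) • star (envP Y Z z) := by module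
    rw [this, h1, h3, h2, sub_self, mul_zero, zero_smul, smul_zero]; simp
  exact (smul_eq_zero.1 h4).resolve_left (h.A_ne_zero hρ hκ hz)

omit hρ hκ in
lemma X_X (hz : z ∈ Ω) : lorentz (envX Y Z z) (envX Y Z z) = 0 := by
  simp [envX, h.null z hz]

omit hρ hκ in
lemma H_H (hz : z ∈ Ω) : lorentz (envH Y Z z) (envH Y Z z) = 0 := by
  simp [envH, h.nullZ z hz]

lemma X_H (hz : z ∈ Ω) : lorentz (envX Y Z z) (envH Y Z z) = -1 := by
  simp [envX, envH, h.Y_Z z hz, h.A_ne_zero hρ hκ hz]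

omit hρ hκ in
lemma X_P (hz : z ∈ Ω) : lorentz (envX Y Z z) (envP Y Z z) = 0 := by
  simp [envX, h.Y_P hz]

omit hρ hκ in
lemma X_star_P (hz : z ∈ Ω) : lorentz (envX Y Z z) (star (envP Y Z z)) = 0 := by
  simp [envX, h.Y_star_P hz]

omit hρ hκ in
lemma H_P (hz : z ∈ Ω) : lorentz (envH Y Z z) (envP Y Z z) = 0 := by
  simp [envH, h.Z_P hz]

omit hρ hκ in
lemma H_star_P (hz : z ∈ Ω) : lorentz (envH Y Z z) (star (envP Y Z z)) = 0 := by
  simp [envH, h.Z_star_P hz]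

lemma psi_psi (hz : z ∈ Ω) : lorentz (envPsi Y Z z) (envPsi Y Z z) = 1 := by
  have := h.A_ne_zero hρ hκ hz
  have h2 := h.A_sq hρ hz
  simp only [envPsi, lorentz_smul_left, lorentz_smul_right]
  field_simp
  linear_combination -h2

omit hρ hκ in
lemma psi_X (hz : z ∈ Ω) : lorentz (envPsi Y Z z) (envX Y Z z) = 0 := by
  simp [envPsi, envX, xi_of_orthogonal (h.hopf_Y hz)]

omit hρ hκ in
lemma psi_H (hz : z ∈ Ω) : lorentz (envPsi Y Z z) (envH Y Z z) = 0 := by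
  simp [envPsi, envH, xi_of_orthogonal (h.hopf_Z hz)]

omit hρ hκ in
lemma psi_P (hz : z ∈ Ω) : lorentz (envPsi Y Z z) (envP Y Z z) = 0 := by
  simp [envPsi, xi_of_orthogonal (h.hopf_P hz)]

omit hρ hκ in
lemma psi_star_P (hz : z ∈ Ω) : lorentz (envPsi Y Z z) (star (envP Y Z z)) = 0 := by
  simp [envPsi, xi_of_orthogonal (h.hopf_star_P hz)]

lemma dz_P (hz : z ∈ Ω) : dz (envP Y Z) z = (envMu Y Z z / 2) • envP Y Z z
    + (envA Y Z z * envTheta Y Z z / 2) • (envPsi Y Z z + envX Y Z z) := by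
  rw [h.dzP_eq hz, h.hopf_eq hρ hz]
  have e1 := h.A_smul_psi hρ hκ hz
  have e2 := h.A_smul_X hρ hκ hz
  rw [← e2]
  have e3 : envXi Y Z z = (1 / 2 : ℂ) • envA Y Z z • envPsi Y Z z := by rw [e1]; module
  rw [e3]
  module

lemma dzbar_P (hz : z ∈ Ω) : dzbar (envP Y Z) z = (-(star (envMu Y Z z) / 2)) • envP Y Z z
    + (1 / 2 * (envA Y Z z)⁻¹) • envH Y Z z := by
  have e := h.eq_of_mem hz (h.dzbarP_mem hz)
  have f1 : lorentz (dzbar (envP Y Z) z) (Y z) = -(1 / 2) := by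
    have h1 := lorentz_dzbar_of_const h.isOpen h.smooth h.smooth_P (fun w hw => h.Y_P hw) hz
    have h2 : dzbar Y z = star (envP Y Z z) - (star (envMu Y Z z) / 2) • Y z := by
      rw [h.star_P hz]; module
    rw [lorentz_comm, h1, lorentz_comm, h2, lorentz_sub_right, h.P_star_P hz, lorentz_smul_right,
      lorentz_comm, h.Y_P hz]
    ring
  have f2 : lorentz (dzbar (envP Y Z) z) (Z z) = 0 := by
    have h1 := lorentz_dzbar_of_const h.isOpen h.smoothZ h.smooth_P (fun w hw => h.Z_P hw) hz
    rw [lorentz_comm, h1, h.dzbarZ_eq' hρ hz, lorentz_add_left, lorentz_smul_left,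
      lorentz_smul_left, h.Z_P hz, h.P_P hz]
    ring
  have f3 : lorentz (dzbar (envP Y Z) z) (envP Y Z z) = 0 := by
    have h1 := lorentz_dzbar_of_const h.isOpen h.smooth_P h.smooth_P (fun w hw => h.P_P hw) hz
    rw [lorentz_comm (envP Y Z z)] at h1
    linear_combination (1 / 2 : ℂ) * h1
  have f4 : lorentz (dzbar (envP Y Z) z) (star (envP Y Z z)) = -(star (envMu Y Z z) / 4) := by
    have h1 := lorentz_dzbar_of_const h.isOpen h.smooth_P (contDiffOn_star h.smooth_P)
      (fun w hw => h.P_star_P hw) hz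
    have b1 : lorentz (envP Y Z z) (star (hopf Y z)) = 0 := by
      rw [← star_star (envP Y Z z), lorentz_star, lorentz_comm, h.hopf_star_P hz, star_zero]
    rw [dzbar_star, h.star_dzP hz] at h1
    simp only [lorentz_add_right, lorentz_smul_right, b1, h.P_star_P hz, lorentz_comm _ (Y z),
      h.Y_P hz] at h1
    linear_combination h1
  rw [f1, f2, f3, f4] at e
  rw [e, envH, smul_smul, mul_assoc, inv_mul_cancel₀ (h.A_ne_zero hρ hκ hz)]
  module

lemma dz_star_P (hz : z ∈ Ω) : dz (fun w => star (envP Y Z w)) z =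
    (-(envMu Y Z z / 2)) • star (envP Y Z z) + (1 / 2 * (envA Y Z z)⁻¹) • envH Y Z z := by
  rw [dz_star, h.dzbar_P hρ hκ hz]
  simp only [star_add, star_smul, star_neg, star_div₀, star_mul', star_star, star_ofNat,
    h.star_H hz, star_inv₀, star_A, star_one]

lemma dz_psi (hz : z ∈ Ω) :
    dz (envPsi Y Z) z = -(envA Y Z z * envTheta Y Z z) • star (envP Y Z z) := by
  have e : dz (envE Y Z) z = dz (envPsi Y Z) z + dz (envH Y Z) z :=
    dz_add (diffAt_of_contDiffOn h.isOpen (h.smooth_psi hρ hκ) hz)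
      (diffAt_of_contDiffOn h.isOpen (h.smooth_H hρ hκ) hz)
  rw [h.dz_E hρ hκ hz, h.dz_H hρ hκ hz] at e
  rw [neg_smul]
  exact eq_neg_of_add_eq_zero_left e.symm

lemma smooth_proj (w : Fin (m + 1) → ℂ) : ContDiffOn ℝ ∞ (fun z => envProj Y Z z w) Ω := by
  have c : ContDiffOn ℝ ∞ (fun _ : ℂ => w) Ω := contDiffOn_const
  have hX := h.smooth_X hρ hκ
  have hH := h.smooth_H hρ hκ
  have hp := h.smooth_psi hρ hκ
  have hP := h.smooth_P
  have hPb := contDiffOn_star h.smooth_P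
  exact (((((contDiffOn_lorentz c hH).neg.smul hX).sub ((contDiffOn_lorentz c hX).smul hH)).add
    ((contDiffOn_const.mul (contDiffOn_lorentz c hPb)).smul hP)).add
    ((contDiffOn_const.mul (contDiffOn_lorentz c hP)).smul hPb)).add
    ((contDiffOn_lorentz c hp).smul hp)

/-- The bundle `V ⊕ ℂψ` is constant. -/
lemma dz_proj (w : Fin (m + 1) → ℂ) (hz : z ∈ Ω) : dz (fun z => envProj Y Z z w) z = 0 := by
  have c : DifferentiableAt ℝ (fun _ : ℂ => w) z := differentiableAt_const _
  have hX := diffAt_of_contDiffOn h.isOpen (h.smooth_X hρ hκ) hz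
  have hH := diffAt_of_contDiffOn h.isOpen (h.smooth_H hρ hκ) hz
  have hp := diffAt_of_contDiffOn h.isOpen (h.smooth_psi hρ hκ) hz
  have hP := diffAt_of_contDiffOn h.isOpen h.smooth_P hz
  have hPb := diffAt_of_contDiffOn h.isOpen (contDiffOn_star h.smooth_P) hz
  have cl : ∀ {G : ℂ → Fin (m + 1) → ℂ}, ContDiffOn ℝ ∞ G Ω →
      DifferentiableAt ℝ (fun x => lorentz w (G x)) z := fun hG =>
    diffAt_of_contDiffOn h.isOpen (contDiffOn_lorentz contDiffOn_const hG) hz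
  have lX := cl (h.smooth_X hρ hκ)
  have lH := cl (h.smooth_H hρ hκ)
  have lp := cl (h.smooth_psi hρ hκ)
  have lP := cl h.smooth_P
  have lPb := cl (contDiffOn_star h.smooth_P)
  have l2P : DifferentiableAt ℝ (fun x => 2 * lorentz w (envP Y Z x)) z := lP.const_mul 2
  have l2Pb : DifferentiableAt ℝ (fun x => 2 * lorentz w (star (envP Y Z x))) z := lPb.const_mul 2
  have k : ∀ {G : ℂ → Fin (m + 1) → ℂ}, DifferentiableAt ℝ G z →
      dz (fun x => lorentz w (G x)) z = lorentz w (dz G z) := fun hG => by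
    rw [dz_lorentz c hG, dz_const, lorentz_zero_left, zero_add]
  have k2 : ∀ {g : ℂ → ℂ}, DifferentiableAt ℝ g z → dz (fun x => 2 * g x) z = 2 * dz g z :=
    fun hg => dz_const_smul (X := ℂ) 2 hg
  have a0 := h.A_ne_zero hρ hκ hz
  have t1 : dz (fun x => -(lorentz w (envH Y Z x)) • envX Y Z x) z = _ := dz_smul lH.fun_neg hX
  have t2 := dz_smul lX hH
  have t3 := dz_smul l2Pb hP
  have t4 := dz_smul l2P hPb
  have t5 := dz_smul lp hp
  simp only [envProj]
  rw [dz_add ((((lH.fun_neg.fun_smul hX).fun_sub (lX.fun_smul hH)).fun_add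
      (l2Pb.fun_smul hP)).fun_add (l2P.fun_smul hPb)) (lp.fun_smul hp),
    dz_add (((lH.fun_neg.fun_smul hX).fun_sub (lX.fun_smul hH)).fun_add
      (l2Pb.fun_smul hP)) (l2P.fun_smul hPb),
    dz_add ((lH.fun_neg.fun_smul hX).fun_sub (lX.fun_smul hH)) (l2Pb.fun_smul hP),
    dz_sub (lH.fun_neg.fun_smul hX) (lX.fun_smul hH), t1, t2, t3, t4, t5, dz_neg lH, k2 lP, k2 lPb,
    k hX, k hH, k hP, k hPb, k hp, h.dz_X hρ hκ hz, h.dz_H hρ hκ hz, h.dz_P hρ hκ hz,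
    h.dz_star_P hρ hκ hz, h.dz_psi hρ hκ hz]
  simp only [lorentz_add_right, lorentz_smul_right, neg_smul, lorentz_neg_right]
  generalize envA Y Z z = a at *
  have : (1 / 2 * a⁻¹) • envH Y Z z = (1 / 2 : ℂ) • a⁻¹ • envH Y Z z := by module
  rw [this]
  module

end IsEnvelopePair

/-! ### Change of the complex coordinate -/

section Comp

variable {X : Type*} [NormedAddCommGroup X] [NormedSpace ℂ X] {G : ℂ → X} {h : ℂ → ℂ} {w : ℂ}

lemma fderiv_comp_holomorphic (hG : DifferentiableAt ℝ G (h w)) (hh : DifferentiableAt ℂ h w)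
    (v : ℂ) : fderiv ℝ (fun x => G (h x)) w v = fderiv ℝ G (h w) (deriv h w * v) := by
  have e : (fun x => G (h x)) = G ∘ h := rfl
  have h1 : HasFDerivAt h ((fderiv ℂ h w).restrictScalars ℝ) w :=
    hh.hasFDerivAt.restrictScalars ℝ
  rw [e, (hG.hasFDerivAt.comp w h1).fderiv]
  simp [mul_comm]

lemma dz_comp_holomorphic (hG : DifferentiableAt ℝ G (h w)) (hh : DifferentiableAt ℂ h w) :
    dz (fun x => G (h x)) w = deriv h w • dz G (h w) := by
  conv_lhs => rw [dz]
  rw [fderiv_comp_holomorphic hG hh, fderiv_comp_holomorphic hG hh, fderiv_eq_dz G,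
    fderiv_eq_dz G (h w) (deriv h w * Complex.I)]
  simp only [map_mul, Complex.conj_I, map_one]
  match_scalars
  · linear_combination (-1 / 2 * deriv h w) * Complex.I_mul_I
  · linear_combination (1 / 2 * (starRingEnd ℂ) (deriv h w)) * Complex.I_mul_I

end Comp

/-- The lifts `Y', Z'` on `U` arise from `Y, Z` by the holomorphic change of coordinates `h` and the
positive rescaling factor `r`. -/
structure IsCoordChange {m : ℕ} (U Ω : Set ℂ) (h : ℂ → ℂ) (r : ℂ → ℝ)
    (Y Z Y' Z' : ℂ → Fin (m + 1) → ℂ) : Prop where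
  isOpen : IsOpen U
  mapsTo : Set.MapsTo h U Ω
  holo : DifferentiableOn ℂ h U
  deriv_ne : ∀ w ∈ U, deriv h w ≠ 0
  diff : ∀ w ∈ U, DifferentiableAt ℝ r w
  pos : ∀ w ∈ U, 0 < r w
  eqY : ∀ w ∈ U, Y' w = (r w : ℂ) • Y (h w)
  eqZ : ∀ w ∈ U, Z' w = ((r w : ℂ))⁻¹ • Z (h w)

namespace IsCoordChange

variable {m : ℕ} {U Ω Ω' : Set ℂ} {h : ℂ → ℂ} {r : ℂ → ℝ} {Y Z Y' Z' : ℂ → Fin (m + 1) → ℂ} {w : ℂ}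
variable (c : IsCoordChange U Ω h r Y Z Y' Z') (hp : IsEnvelopePair Ω Y Z)
include c

lemma r_ne (hw : w ∈ U) : (r w : ℂ) ≠ 0 := Complex.ofReal_ne_zero.2 (c.pos w hw).ne'

lemma diff_h (hw : w ∈ U) : DifferentiableAt ℂ h w :=
  c.holo.differentiableAt (c.isOpen.mem_nhds hw)

lemma diff_r (hw : w ∈ U) : DifferentiableAt ℝ (fun w => (r w : ℂ)) w :=
  Complex.ofRealCLM.differentiableAt.comp w (c.diff w hw)

lemma diff_rinv (hw : w ∈ U) : DifferentiableAt ℝ (fun w => ((r w : ℂ))⁻¹) w :=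
  (c.diff_r hw).inv (c.r_ne hw)

lemma diff_comp {E : Type*} [NormedAddCommGroup E] [NormedSpace ℝ E] {G : ℂ → E} (hΩ : IsOpen Ω)
    (hG : ContDiffOn ℝ ∞ G Ω) (hw : w ∈ U) :
    DifferentiableAt ℝ (fun x => G (h x)) w :=
  (diffAt_of_contDiffOn hΩ hG (c.mapsTo hw)).comp w ((c.diff_h hw).restrictScalars ℝ)

include hp

lemma P_eq (hw : w ∈ U) : envP Y' Z' w = ((r w : ℂ) * deriv h w) • envP Y Z (h w) := by
  have hw' := c.mapsTo hw
  have e1 : dz Y' w = (r w : ℂ) • deriv h w • dz Y (h w) + dz (fun w => (r w : ℂ)) w • Y (h w) := by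
    rw [dz_congr_on c.isOpen c.eqY hw, dz_smul (c.diff_r hw) (c.diff_comp hp.isOpen hp.smooth hw),
      dz_comp_holomorphic (diffAt_of_contDiffOn hp.isOpen hp.smooth hw') (c.diff_h hw)]
  have e2 : envMu Y' Z' w =
      deriv h w * envMu Y Z (h w) - 2 * (r w : ℂ)⁻¹ * dz (fun w => (r w : ℂ)) w := by
    rw [envMu, e1, c.eqZ w hw]
    simp only [lorentz_add_right, lorentz_smul_right, lorentz_smul_left,
      lorentz_comm (Z (h w)) (Y (h w)), hp.Y_Z _ hw', IsEnvelopePair.Z_dz]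
    have := c.r_ne hw
    field_simp
    ring
  have hr := c.r_ne hw
  rw [envP, e1, e2, c.eqY w hw, envP]
  match_scalars
  · ring
  · field_simp
    ring

lemma dzZ_eq (hw : w ∈ U) : ∃ b : ℂ,
    dz Z' w = ((r w : ℂ)⁻¹ * deriv h w) • dz Z (h w) + b • Z (h w) := by
  refine ⟨dz (fun w => (r w : ℂ)⁻¹) w, ?_⟩
  rw [dz_congr_on c.isOpen c.eqZ hw, dz_smul (c.diff_rinv hw)
      (c.diff_comp hp.isOpen hp.smoothZ hw),
    dz_comp_holomorphic (diffAt_of_contDiffOn hp.isOpen hp.smoothZ (c.mapsTo hw)) (c.diff_h hw),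
    smul_smul]

lemma theta_eq (hw : w ∈ U) : envTheta Y' Z' w = deriv h w ^ 2 * envTheta Y Z (h w) := by
  have hw' := c.mapsTo hw
  have hr := c.r_ne hw
  obtain ⟨b, hb⟩ := c.dzZ_eq hp hw
  rw [envTheta, hb, c.P_eq hp hw, envTheta]
  simp only [lorentz_add_left, lorentz_smul_right, lorentz_smul_left, hp.Z_P hw']
  field_simp
  ring

/-- The tangential part of the transformation rule of `P_z` drops out, since `κ` is normal. -/
lemma kappa_eq (hp' : IsEnvelopePair Ω' Y' Z') (hU : U ⊆ Ω') (hw : w ∈ U) :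
    hopf Y' w = ((r w : ℂ) * deriv h w ^ 2) • hopf Y (h w) := by
  have hw' := c.mapsTo hw
  have hr := c.r_ne hw
  have hj := c.deriv_ne w hw
  have dj : DifferentiableAt ℝ (fun w => (r w : ℂ) * deriv h w) w :=
    (c.diff_r hw).fun_mul
      ((c.holo.deriv c.isOpen).differentiableAt (c.isOpen.mem_nhds hw) |>.restrictScalars ℝ)
  have e1 : dz (envP Y' Z') w = ((r w : ℂ) * deriv h w) • deriv h w • dz (envP Y Z) (h w)
      + dz (fun w => (r w : ℂ) * deriv h w) w • envP Y Z (h w) := by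
    rw [dz_congr_on c.isOpen (fun x hx => c.P_eq hp hx) hw,
      dz_smul dj (c.diff_comp hp.isOpen hp.smooth_P hw),
      dz_comp_holomorphic (diffAt_of_contDiffOn hp.isOpen hp.smooth_P hw') (c.diff_h hw)]
  obtain ⟨b, hb⟩ : ∃ b : ℂ,
      hopf Y' w = ((r w : ℂ) * deriv h w ^ 2) • hopf Y (h w) + b • envP Y Z (h w) := by
    refine ⟨(r w : ℂ) * deriv h w * deriv h w * (envMu Y Z (h w) / 2)
      + dz (fun w => (r w : ℂ) * deriv h w) w
      - (envMu Y' Z' w / 2) * ((r w : ℂ) * deriv h w), ?_⟩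
    have e2 := hp'.dzP_eq (hU hw)
    rw [e1, hp.dzP_eq hw', c.P_eq hp hw, c.theta_eq hp hw, c.eqY w hw] at e2
    rw [← sub_eq_zero] at e2 ⊢
    rw [← neg_eq_zero, ← e2]
    module
  have f1 : lorentz (hopf Y' w) (star (envP Y Z (h w))) = 0 := by
    have := hp'.hopf_star_P (hU hw)
    rw [c.P_eq hp hw, star_smul, lorentz_smul_right] at this
    refine (mul_eq_zero.1 this).resolve_left ?_
    simp [hr, hj]
  rw [hb, lorentz_add_left, lorentz_smul_left, lorentz_smul_left, hp.hopf_star_P hw',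
    hp.P_star_P hw'] at f1
  have hb0 : b = 0 := by linear_combination 2 * f1
  rw [hb, hb0, zero_smul, add_zero]

variable (hp' : IsEnvelopePair Ω' Y' Z') (hU : U ⊆ Ω')
include hp' hU

lemma xi_eq (hw : w ∈ U) : envXi Y' Z' w = (r w : ℂ) • envXi Y Z (h w) := by
  rw [envXi, c.kappa_eq hp hp' hU hw, c.theta_eq hp hw, envXi, smul_smul, smul_smul]
  congr 1
  have := c.deriv_ne w hw
  rw [mul_inv]
  field_simp

lemma A_eq (hw : w ∈ U) : envA Y' Z' w = (r w : ℂ) * envA Y Z (h w) := by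
  have e : ∀ x : ℂ, ((r w : ℂ) * ((r w : ℂ) * x)).re = (r w) ^ 2 * x.re := fun x => by
    simp [Complex.mul_re]; ring
  rw [envA, c.xi_eq hp hp' hU hw, envA, lorentz_smul_left, lorentz_smul_right, e,
    Real.sqrt_mul (sq_nonneg _), Real.sqrt_sq (c.pos w hw).le]
  push_cast; ring

lemma X_eq (hw : w ∈ U) : envX Y' Z' w = envX Y Z (h w) := by
  have := c.r_ne hw
  rw [envX, c.A_eq hp hp' hU hw, c.eqY w hw, envX, smul_smul]
  congr 1
  rw [mul_inv]; field_simp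

lemma H_eq (hw : w ∈ U) : envH Y' Z' w = envH Y Z (h w) := by
  have := c.r_ne hw
  rw [envH, c.A_eq hp hp' hU hw, c.eqZ w hw, envH, smul_smul]
  congr 1
  field_simp

lemma psi_eq (hw : w ∈ U) : envPsi Y' Z' w = envPsi Y Z (h w) := by
  have := c.r_ne hw
  rw [envPsi, c.A_eq hp hp' hU hw, c.xi_eq hp hp' hU hw, envPsi, smul_smul]
  congr 1
  rw [mul_inv]; field_simp

lemma E_eq (hw : w ∈ U) : envE Y' Z' w = envE Y Z (h w) := by
  rw [envE, c.psi_eq hp hp' hU hw, c.H_eq hp hp' hU hw, envE]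

lemma proj_eq (hw : w ∈ U) (v : Fin (m + 1) → ℂ) :
    envProj Y' Z' w v = envProj Y Z (h w) v := by
  have e := c.P_eq hp hw
  have e1 := hp'.P_star_P (hU hw)
  rw [e, star_smul, lorentz_smul_left, lorentz_smul_right, hp.P_star_P (c.mapsTo hw)] at e1
  rw [envProj, c.psi_eq hp hp' hU hw, c.H_eq hp hp' hU hw, c.X_eq hp hp' hU hw, e, star_smul,
    envProj]
  generalize (r w : ℂ) * deriv h w = j at *
  have e2 : star j * j = 1 := by linear_combination 2 * e1
  simp only [lorentz_smul_right]
  match_scalars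
  · ring
  · ring
  · linear_combination 2 * lorentz v (star (envP Y Z (h w))) * e2
  · linear_combination 2 * lorentz v (envP Y Z (h w)) * e2
  · ring

end IsCoordChange

/-! ### Propagation of zeros -/

/-- Gronwall's inequality on the line segments that start at `z₀`: the zeros of a function whose
derivative is bounded by a multiple of the function are interior points of its zero set. -/
lemma eventually_zero_of_dz_le {F : Type*} [NormedAddCommGroup F] [NormedSpace ℂ F] {Ω : Set ℂ}
    (hΩ : IsOpen Ω) {u : ℂ → F} (hu : ContDiffOn ℝ ∞ u Ω) {c : ℂ → ℝ} (hc : ContinuousOn c Ω)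
    (h1 : ∀ z ∈ Ω, ‖dz u z‖ ≤ c z * ‖u z‖) (h2 : ∀ z ∈ Ω, ‖dzbar u z‖ ≤ c z * ‖u z‖)
    {z₀ : ℂ} (hz₀ : z₀ ∈ Ω) (h0 : u z₀ = 0) : ∀ᶠ z in nhds z₀, u z = 0 := by
  obtain ⟨δ, hδ, hball⟩ := Metric.nhds_basis_closedBall.mem_iff.1 (hΩ.mem_nhds hz₀)
  obtain ⟨C, hC⟩ := (isCompact_closedBall z₀ δ).exists_bound_of_continuousOn (hc.mono hball)
  filter_upwards [Metric.closedBall_mem_nhds z₀ hδ] with z hz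
  have hγ : ∀ t ∈ Set.Icc (0 : ℝ) 1, z₀ + t • (z - z₀) ∈ Metric.closedBall z₀ δ := by
    intro t ht
    rw [mem_closedBall_iff_norm, add_sub_cancel_left, norm_smul, Real.norm_of_nonneg ht.1]
    exact (mul_le_of_le_one_left (norm_nonneg _) ht.2).trans (mem_closedBall_iff_norm.1 hz)
  have hd : ∀ t ∈ Set.Icc (0 : ℝ) 1, HasDerivAt (fun t : ℝ => u (z₀ + t • (z - z₀)))
      (fderiv ℝ u (z₀ + t • (z - z₀)) (z - z₀)) t := by
    intro t ht
    have e1 := (diffAt_of_contDiffOn hΩ hu (hball (hγ t ht))).hasFDerivAt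
    have e2 : HasDerivAt (fun t : ℝ => z₀ + t • (z - z₀)) (z - z₀) t := by
      simpa using ((hasDerivAt_id t).smul_const (z - z₀)).const_add z₀
    exact e1.comp_hasDerivAt t e2
  have key := eq_zero_of_abs_deriv_le_mul_abs_self_of_eq_zero_right
    (f := fun t : ℝ => u (z₀ + t • (z - z₀)))
    (f' := fun t : ℝ => fderiv ℝ u (z₀ + t • (z - z₀)) (z - z₀)) (a := 0) (b := 1)
    (K := ‖z - z₀‖ * (2 * C)) (fun t ht => (hd t ht).continuousAt.continuousWithinAt)
    (fun t ht => (hd t ⟨ht.1, ht.2.le⟩).hasDerivWithinAt) (by simpa using h0) ?_ 1 (by simp)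
  · simpa using key
  · intro t ht
    have hm := hγ t ⟨ht.1, ht.2.le⟩
    have hb := (le_abs_self _).trans (hC _ hm)
    have k1 := (h1 _ (hball hm)).trans (mul_le_mul_of_nonneg_right hb (norm_nonneg _))
    have k2 := (h2 _ (hball hm)).trans (mul_le_mul_of_nonneg_right hb (norm_nonneg _))
    rw [fderiv_eq_dz]
    refine (norm_add_le _ _).trans ?_
    rw [norm_smul, norm_smul, RCLike.norm_conj]
    calc _ ≤ ‖z - z₀‖ * (C * ‖u (z₀ + t • (z - z₀))‖)
          + ‖z - z₀‖ * (C * ‖u (z₀ + t • (z - z₀))‖) := by gcongr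
      _ = _ := by ring

lemma eventually_eq_of_dz_eq_zero {m : ℕ} {Ω : Set ℂ}
    (hΩ : IsOpen Ω) {u : ℂ → Fin (m + 1) → ℂ} (hu : ContDiffOn ℝ ∞ u Ω)
    (hr : ∀ z ∈ Ω, star (u z) = u z)
    (h1 : ∀ z ∈ Ω, dz u z = 0) {z₀ : ℂ} (hz₀ : z₀ ∈ Ω) : ∀ᶠ z in nhds z₀, u z = u z₀ := by
  have hd := fun z (hz : z ∈ Ω) => diffAt_of_contDiffOn hΩ hu hz
  have e1 : ∀ z ∈ Ω, dz (fun w => u w - u z₀) z = 0 := fun z hz => by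
    rw [dz_sub (hd z hz) (differentiableAt_const _), h1 z hz, dz_const, sub_zero]
  have e2 : ∀ z ∈ Ω, dzbar (fun w => u w - u z₀) z = 0 := fun z hz => by
    rw [dzbar_sub (hd z hz) (differentiableAt_const _), dzbar_eq_star_dz hΩ hr hz, h1 z hz,
      dzbar_const, star_zero, sub_zero]
  have := eventually_zero_of_dz_le (u := fun w => u w - u z₀) hΩ (hu.sub contDiffOn_const)
    (c := fun _ => 0) continuousOn_const
    (fun z hz => by simp [e1 z hz]) (fun z hz => by simp [e2 z hz]) hz₀ (sub_self _)
  filter_upwards [this] with z hz using sub_eq_zero.1 hz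

/-- The function `⟨ξ, ξ⟩` satisfies the linear equation `⟨ξ, ξ⟩_z = -μ ⟨ξ, ξ⟩`, so the zero set of
`κ` is open. -/
lemma IsEnvelopePair.eventually_hopf_eq_zero {m : ℕ} {Ω : Set ℂ} {Y Z : ℂ → Fin (m + 1) → ℂ}
    (h : IsEnvelopePair Ω Y Z) (hρ : ∀ z ∈ Ω, envRho Y Z z = 0) {z₀ : ℂ} (hz₀ : z₀ ∈ Ω)
    (h0 : hopf Y z₀ = 0) : ∀ᶠ z in nhds z₀, hopf Y z = 0 := by
  have hs := h.smooth_xi hρ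
  have e2 : ∀ z ∈ Ω, dzbar (fun w => lorentz (envXi Y Z w) (envXi Y Z w)) z =
      -star (envMu Y Z z) * lorentz (envXi Y Z z) (envXi Y Z z) := fun z hz => by
    rw [dzbar_eq_star_dz h.isOpen (fun w hw => h.star_xi_sq hρ hw) hz, h.dz_xi_sq hρ hz,
      star_mul', h.star_xi_sq hρ hz, star_neg]
  have := eventually_zero_of_dz_le h.isOpen (contDiffOn_lorentz hs hs)
    (c := fun z => ‖envMu Y Z z‖) h.smooth_mu.continuousOn.norm
    (fun z hz => by rw [h.dz_xi_sq hρ hz, norm_mul, norm_neg])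
    (fun z hz => by rw [e2 z hz, norm_mul, norm_neg, norm_star])
    hz₀ (by simp [envXi, h0])
  filter_upwards [this, h.isOpen.mem_nhds hz₀] with z hz hz'
  rw [h.hopf_eq hρ hz', (h.xi_sq_nonneg hρ hz').2 hz, smul_zero]

/-! ### The light-like vectors that represent the points of the sphere -/

section NullLift

variable {n : ℕ}

lemma nullLiftC_eq (x : EuclideanSpace ℝ (Fin (n + 1))) : nullLiftC x = toC (nullLift x) := rfl

lemma lorentz_nullLift (x y : EuclideanSpace ℝ (Fin (n + 1))) :
    lorentz (nullLift x) (nullLift y) = inner ℝ x y - 1 := by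
  simp [lorentz, nullLift, PiLp.inner_apply, mul_comm]

lemma lorentz_nullLift_self {x : EuclideanSpace ℝ (Fin (n + 1))} (hx : ‖x‖ = 1) :
    lorentz (nullLift x) (nullLift x) = 0 := by
  rw [lorentz_nullLift, real_inner_self_eq_norm_sq, hx]; norm_num

lemma lorentz_nullLift_neg {x y : EuclideanSpace ℝ (Fin (n + 1))} (hx : ‖x‖ = 1) (hy : ‖y‖ = 1)
    (hxy : x ≠ y) : lorentz (nullLift x) (nullLift y) < 0 := by
  rw [lorentz_nullLift]
  linarith [(inner_lt_one_iff_real_of_norm_eq_one hx hy).2 hxy]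

/-- The linear part of the affine map `nullLift`. -/
noncomputable def spatialL (n : ℕ) :
    EuclideanSpace ℝ (Fin (n + 1)) →L[ℝ] (Fin (n + 2) → ℝ) :=
  ContinuousLinearMap.pi (Fin.cons 0 fun i => EuclideanSpace.proj i)

@[simp] lemma spatialL_zero (x : EuclideanSpace ℝ (Fin (n + 1))) : spatialL n x 0 = 0 := rfl

@[simp] lemma spatialL_succ (x : EuclideanSpace ℝ (Fin (n + 1))) (i : Fin (n + 1)) :
    spatialL n x i.succ = x i := rfl

lemma lorentz_spatialL (x y : EuclideanSpace ℝ (Fin (n + 1))) :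
    lorentz (spatialL n x) (spatialL n y) = inner ℝ x y := by
  simp [lorentz, PiLp.inner_apply, mul_comm]

lemma nullLift_eq (x : EuclideanSpace ℝ (Fin (n + 1))) :
    nullLift x = spatialL n x + nullLift 0 := by
  funext i
  refine Fin.cases ?_ (fun j => ?_) i <;> simp [nullLift]

lemma fderiv_nullLift {F : ℂ → EuclideanSpace ℝ (Fin (n + 1))} {z : ℂ}
    (hF : DifferentiableAt ℝ F z) (v : ℂ) :
    fderiv ℝ (fun w => nullLift (F w)) z v = spatialL n (fderiv ℝ F z v) := by
  rw [show (fun w => nullLift (F w)) = fun w => spatialL n (F w) + nullLift 0 from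
    funext fun w => nullLift_eq (F w), fderiv_add_const]
  have := ((spatialL n).hasFDerivAt.comp z hF.hasFDerivAt).fderiv
  have e : (⇑(spatialL n) ∘ F) = fun w => spatialL n (F w) := rfl
  rw [e] at this
  rw [this]; rfl

lemma contDiff_nullLift : ContDiff ℝ ∞ (nullLift (n := n)) := by
  have : (nullLift (n := n)) = fun x => spatialL n x + nullLift 0 := funext nullLift_eq
  rw [this]
  exact (spatialL n).contDiff.add contDiff_const

/-- The inclusion `toC` as a continuous `ℝ`-linear map. -/
noncomputable def toCL (k : ℕ) : (Fin k → ℝ) →L[ℝ] (Fin k → ℂ) :=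
  ContinuousLinearMap.pi fun i => Complex.ofRealCLM.comp (ContinuousLinearMap.proj i)

lemma fderiv_toC {k : ℕ} {G : ℂ → Fin k → ℝ} {z : ℂ} (hG : DifferentiableAt ℝ G z) (v : ℂ) :
    fderiv ℝ (fun w => toC (G w)) z v = toC (fderiv ℝ G z v) := by
  have := ((toCL k).hasFDerivAt.comp z hG.hasFDerivAt).fderiv
  have e : (⇑(toCL k) ∘ G) = fun w => toC (G w) := rfl
  rw [e] at this
  rw [this]; rfl

lemma contDiffOn_toC {k : ℕ} {G : ℂ → Fin k → ℝ} {Ω : Set ℂ} (hG : ContDiffOn ℝ ∞ G Ω) :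
    ContDiffOn ℝ ∞ (fun w => toC (G w)) Ω := (toCL k).contDiff.comp_contDiffOn hG

end NullLift

section Conformal

variable {n : ℕ} {Ω : Set ℂ} {F Fhat : ℂ → EuclideanSpace ℝ (Fin (n + 1))} {z : ℂ}

lemma norm_fderiv_one_pos (hc : IsConformalMap (fderiv ℝ F z)) : 0 < ‖fderiv ℝ F z 1‖ := by
  obtain ⟨c, hc0, li, hli⟩ := hc
  rw [hli]
  simpa [norm_smul] using hc0

lemma conformal_inner (hc : IsConformalMap (fderiv ℝ F z)) (v w : ℂ) :
    inner ℝ (fderiv ℝ F z v) (fderiv ℝ F z w) = ‖fderiv ℝ F z 1‖ ^ 2 * inner ℝ v w := by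
  obtain ⟨c, hc0, li, hli⟩ := hc
  rw [hli]
  simp [norm_smul, inner_smul_left, inner_smul_right]
  ring

lemma conformal_nullLiftC (hF : DifferentiableAt ℝ F z) (hc : IsConformalMap (fderiv ℝ F z)) :
    lorentz (dz (fun w => nullLiftC (F w)) z) (dz (fun w => nullLiftC (F w)) z) = 0 ∧
    lorentz (dz (fun w => nullLiftC (F w)) z) (dzbar (fun w => nullLiftC (F w)) z) =
      (‖fderiv ℝ F z 1‖ ^ 2 / 2 : ℝ) := by
  have hd : ∀ v, fderiv ℝ (fun w => nullLiftC (F w)) z v = toC (spatialL n (fderiv ℝ F z v)) := by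
    intro v
    simp only [nullLiftC_eq]
    rw [fderiv_toC (G := fun w => nullLift (F w))
      (contDiff_nullLift.contDiffAt.differentiableAt (by simp) |>.comp z hF), fderiv_nullLift hF]
  simp only [dz, dzbar, hd, lorentz_smul_left, lorentz_smul_right, lorentz_sub_left,
    lorentz_sub_right, lorentz_add_right, lorentz_toC, lorentz_spatialL, conformal_inner hc]
  have i1 : inner ℝ (1 : ℂ) Complex.I = 0 := by simp
  have i2 : inner ℝ Complex.I (1 : ℂ) = 0 := by simp [Complex.inner]
  have i3 : inner ℝ (1 : ℂ) (1 : ℂ) = 1 := by simp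
  have i4 : inner ℝ Complex.I Complex.I = 1 := by simp
  simp only [i1, i2, i3, i4]
  push_cast
  constructor
  · linear_combination (1 / 4 * (‖fderiv ℝ F z 1‖ : ℂ) ^ 2) * Complex.I_mul_I
  · linear_combination (-1 / 4 * (‖fderiv ℝ F z 1‖ : ℂ) ^ 2) * Complex.I_mul_I

/-- Rescaling a null lift by a function rescales the induced metric. -/
lemma lorentz_dz_smul_null {m : ℕ} {y : ℂ → Fin (m + 1) → ℂ} {l : ℂ → ℂ} (hΩ : IsOpen Ω)
    (hy : ContDiffOn ℝ ∞ y Ω) (hl : ContDiffOn ℝ ∞ l Ω)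
    (h0 : ∀ w ∈ Ω, lorentz (y w) (y w) = 0) (hz : z ∈ Ω) :
    lorentz (dz (fun w => l w • y w) z) (dz (fun w => l w • y w) z) =
      l z ^ 2 * lorentz (dz y z) (dz y z) ∧
    lorentz (dz (fun w => l w • y w) z) (dzbar (fun w => l w • y w) z) =
      l z ^ 2 * lorentz (dz y z) (dzbar y z) := by
  have dy := diffAt_of_contDiffOn hΩ hy hz
  have dl := diffAt_of_contDiffOn hΩ hl hz
  have e1 : lorentz (y z) (dz y z) = 0 := by
    have := lorentz_dz_of_const hΩ hy hy h0 hz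
    rw [lorentz_comm (dz y z)] at this
    linear_combination (1 / 2 : ℂ) * this
  have e2 : lorentz (y z) (dzbar y z) = 0 := by
    have := lorentz_dzbar_of_const hΩ hy hy h0 hz
    rw [lorentz_comm (dzbar y z)] at this
    linear_combination (1 / 2 : ℂ) * this
  rw [dz_smul dl dy, dzbar_smul dl dy]
  simp only [lorentz_add_left, lorentz_add_right, lorentz_smul_left, lorentz_smul_right, e1, e2,
    h0 z hz, lorentz_comm (dz y z) (y z)]
  constructor <;> ring

/-- The lift `Z` of `F̂` that is normalised by `⟨Y, Z⟩ = -1`, where `Y` is the canonical lift of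
`F`. -/
noncomputable def envelopeLift (F Fhat : ℂ → EuclideanSpace ℝ (Fin (n + 1))) (z : ℂ) :
    Fin (n + 2) → ℂ :=
  (-(lorentz (canonicalLift F z) (nullLiftC (Fhat z)))⁻¹) • nullLiftC (Fhat z)

variable (hΩ : IsOpen Ω) (hF : ContDiffOn ℝ ∞ F Ω) (hF1 : ∀ z ∈ Ω, ‖F z‖ = 1)
    (hFc : ∀ z ∈ Ω, IsConformalMap (fderiv ℝ F z))

include hΩ hF hFc in
lemma smooth_norm_fderiv : ContDiffOn ℝ ∞ (fun z => ‖fderiv ℝ F z 1‖) Ω := by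
  have h1 : ContDiffOn ℝ ∞ (fun z => fderiv ℝ F z 1) Ω :=
    (hF.fderiv_of_isOpen hΩ (by simp)).clm_apply contDiffOn_const
  exact h1.norm ℝ fun z hz => norm_pos_iff.1 (norm_fderiv_one_pos (hFc z hz))

include hF in
lemma contDiffOn_nullLiftC : ContDiffOn ℝ ∞ (fun z => nullLiftC (F z)) Ω :=
  contDiffOn_toC (G := fun z => nullLift (F z)) (contDiff_nullLift.comp_contDiffOn hF)

lemma star_nullLiftC (x : EuclideanSpace ℝ (Fin (n + 1))) : star (nullLiftC x) = nullLiftC x :=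
  star_toC _

include hΩ hF hF1 hFc in
lemma isCanonicalLift_canonicalLift : IsCanonicalLift Ω (canonicalLift F) := by
  have hl : ContDiffOn ℝ ∞ (fun z => ((‖fderiv ℝ F z 1‖⁻¹ : ℝ) : ℂ)) Ω :=
    Complex.ofRealCLM.contDiff.comp_contDiffOn ((smooth_norm_fderiv hΩ hF hFc).inv
      fun z hz => (norm_fderiv_one_pos (hFc z hz)).ne')
  have hy := contDiffOn_nullLiftC hF
  have h0 : ∀ w ∈ Ω, lorentz (nullLiftC (F w)) (nullLiftC (F w)) = 0 := fun w hw => by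
    rw [nullLiftC_eq, lorentz_toC, lorentz_nullLift_self (hF1 w hw), Complex.ofReal_zero]
  have e : canonicalLift F =
    fun z => ((‖fderiv ℝ F z 1‖⁻¹ : ℝ) : ℂ) • nullLiftC (F z) := rfl
  refine ⟨hΩ, hl.smul hy, fun z hz => ?_, fun z hz => ?_, fun z hz => ?_, fun z hz => ?_⟩
  · rw [canonicalLift, star_smul, star_nullLiftC]; simp
  · rw [canonicalLift, lorentz_smul_left, lorentz_smul_right, h0 z hz]; simp
  · rw [e, (lorentz_dz_smul_null hΩ hy hl h0 hz).1,
      (conformal_nullLiftC (diffAt_of_contDiffOn hΩ hF hz) (hFc z hz)).1, mul_zero]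
  · rw [e, (lorentz_dz_smul_null hΩ hy hl h0 hz).2,
      (conformal_nullLiftC (diffAt_of_contDiffOn hΩ hF hz) (hFc z hz)).2]
    have := (norm_fderiv_one_pos (hFc z hz)).ne'
    norm_cast
    push_cast
    have h' : (‖fderiv ℝ F z 1‖ : ℂ) ≠ 0 := Complex.ofReal_ne_zero.2 this
    field_simp

include hF1 hFc in
lemma lorentz_canonicalLift_ne (hF1' : ∀ z ∈ Ω, ‖Fhat z‖ = 1) (hne : ∀ z ∈ Ω, Fhat z ≠ F z)
    (hz : z ∈ Ω) : lorentz (canonicalLift F z) (nullLiftC (Fhat z)) ≠ 0 := by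
  rw [canonicalLift, lorentz_smul_left, nullLiftC_eq, nullLiftC_eq, lorentz_toC]
  exact mul_ne_zero (Complex.ofReal_ne_zero.2 (inv_ne_zero (norm_fderiv_one_pos (hFc z hz)).ne'))
    (Complex.ofReal_ne_zero.2 (lorentz_nullLift_neg (hF1 z hz) (hF1' z hz) (hne z hz).symm).ne)

include hΩ hF hF1 hFc in
lemma isEnvelopePair (hG : ContDiffOn ℝ ∞ Fhat Ω) (hG1 : ∀ z ∈ Ω, ‖Fhat z‖ = 1)
    (hGc : ∀ z ∈ Ω, IsConformalMap (fderiv ℝ Fhat z)) (hne : ∀ z ∈ Ω, Fhat z ≠ F z)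
    (henv : ∀ z ∈ Ω, nullLiftC (Fhat z) ∈ centralSphere (canonicalLift F) z ∧
      ∀ v : ℂ, fderiv ℝ (fun w => nullLiftC (Fhat w)) z v ∈ centralSphere (canonicalLift F) z) :
    IsEnvelopePair Ω (canonicalLift F) (envelopeLift F Fhat) := by
  have hcan := isCanonicalLift_canonicalLift hΩ hF hF1 hFc
  have hy := contDiffOn_nullLiftC hG
  have hn : ∀ z ∈ Ω, lorentz (canonicalLift F z) (nullLiftC (Fhat z)) ≠ 0 :=
    fun z hz => lorentz_canonicalLift_ne hF1 hFc hG1 hne hz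
  have hl : ContDiffOn ℝ ∞
      (fun z => -(lorentz (canonicalLift F z) (nullLiftC (Fhat z)))⁻¹) Ω :=
    ((contDiffOn_lorentz hcan.smooth hy).inv hn).neg
  have h0 : ∀ w ∈ Ω, lorentz (nullLiftC (Fhat w)) (nullLiftC (Fhat w)) = 0 := fun w hw => by
    rw [nullLiftC_eq, lorentz_toC, lorentz_nullLift_self (hG1 w hw), Complex.ofReal_zero]
  have e : envelopeLift F Fhat =
    fun z => (-(lorentz (canonicalLift F z) (nullLiftC (Fhat z)))⁻¹) • nullLiftC (Fhat z) := rfl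
  have hmem : ∀ z ∈ Ω, dz (fun w => nullLiftC (Fhat w)) z ∈ centralSphere (canonicalLift F) z :=
    fun z hz => Submodule.smul_mem _ _ (sub_mem ((henv z hz).2 _)
      (Submodule.smul_mem _ _ ((henv z hz).2 _)))
  have hmem' : ∀ z ∈ Ω,
      dzbar (fun w => nullLiftC (Fhat w)) z ∈ centralSphere (canonicalLift F) z :=
    fun z hz => Submodule.smul_mem _ _ (add_mem ((henv z hz).2 _)
      (Submodule.smul_mem _ _ ((henv z hz).2 _)))
  refine { hcan with
    smoothZ := hl.smul hy
    realZ := fun z hz => ?_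
    nullZ := fun z hz => ?_
    Y_Z := fun z hz => ?_
    Z_mem := fun z hz => Submodule.smul_mem _ _ (henv z hz).1
    dzZ_mem := fun z hz => ?_
    dzbarZ_mem := fun z hz => ?_
    conformalZ := fun z hz => ?_
    immersedZ := fun z hz => ?_ }
  · rw [envelopeLift, star_smul, star_neg, star_inv₀, ← lorentz_star, hcan.real z hz,
      star_nullLiftC]
  · rw [envelopeLift, lorentz_smul_left, lorentz_smul_right, h0 z hz]; simp
  · rw [envelopeLift, lorentz_smul_right, neg_mul, inv_mul_cancel₀ (hn z hz)]
  · rw [e, dz_smul (diffAt_of_contDiffOn hΩ hl hz) (diffAt_of_contDiffOn hΩ hy hz)]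
    exact add_mem (Submodule.smul_mem _ _ (hmem z hz)) (Submodule.smul_mem _ _ (henv z hz).1)
  · rw [e, dzbar_smul (diffAt_of_contDiffOn hΩ hl hz) (diffAt_of_contDiffOn hΩ hy hz)]
    exact add_mem (Submodule.smul_mem _ _ (hmem' z hz)) (Submodule.smul_mem _ _ (henv z hz).1)
  · rw [e, (lorentz_dz_smul_null hΩ hy hl h0 hz).1,
      (conformal_nullLiftC (diffAt_of_contDiffOn hΩ hG hz) (hGc z hz)).1, mul_zero]
  · rw [e, (lorentz_dz_smul_null hΩ hy hl h0 hz).2,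
      (conformal_nullLiftC (diffAt_of_contDiffOn hΩ hG hz) (hGc z hz)).2]
    have := norm_fderiv_one_pos (hGc z hz)
    exact mul_ne_zero (pow_ne_zero _ (neg_ne_zero.2 (inv_ne_zero (hn z hz))))
      (Complex.ofReal_ne_zero.2 (by positivity))

end Conformal

/-! ### Charts of a Riemann surface -/

section Charts

variable {n : ℕ} {M : Type*} [TopologicalSpace M] [ChartedSpace ℂ M] [IsManifold 𝓘(ℂ) ω M]

lemma differentiableOn_transition {φ φ' : OpenPartialHomeomorph M ℂ} (hφ : φ ∈ atlas ℂ M)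
    (hφ' : φ' ∈ atlas ℂ M) : ContDiffOn ℂ ω (φ'.symm ≫ₕ φ) (φ'.symm ≫ₕ φ).source := by
  have h := (contDiffGroupoid ω 𝓘(ℂ)).compatible hφ' hφ
  rw [contDiffGroupoid, mem_groupoid_of_pregroupoid] at h
  simpa [contDiffPregroupoid] using h.1

variable (M) in
lemma isManifold_real : IsManifold 𝓘(ℝ, ℂ) ∞ M := by
  apply isManifold_of_contDiffOn
  intro φ' φ hφ' hφ
  have := ((differentiableOn_transition hφ hφ').restrict_scalars ℝ).of_le (le_top : ∞ ≤ ω)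
  simpa using this

lemma contDiffOn_comp_symm {E : Type*} [NormedAddCommGroup E] [NormedSpace ℝ E] {u : M → E}
    (hu : ContMDiff 𝓘(ℝ, ℂ) 𝓘(ℝ, E) ∞ u) {φ : OpenPartialHomeomorph M ℂ} (hφ : φ ∈ atlas ℂ M) :
    ContDiffOn ℝ ∞ (fun z => u (φ.symm z)) φ.target := by
  have := isManifold_real M
  have h1 := contMDiffOn_symm_of_mem_maximalAtlas (I := 𝓘(ℝ, ℂ)) (n := ∞)
    (IsManifold.subset_maximalAtlas hφ)
  exact (hu.comp_contMDiffOn h1).contDiffOn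

omit [IsManifold 𝓘(ℂ) ω M] in
/-- On a connected surface, a property that is defined by means of charts but does not depend on
the chart holds everywhere or nowhere, if it and its negation are open. -/
lemma chart_dichotomy [PreconnectedSpace M] (Q : OpenPartialHomeomorph M ℂ → ℂ → Prop)
    (hinv : ∀ φ ∈ atlas ℂ M, ∀ φ' ∈ atlas ℂ M, ∀ p ∈ φ.source, p ∈ φ'.source →
      Q φ (φ p) → Q φ' (φ' p))
    (ho : ∀ φ ∈ atlas ℂ M, ∀ z ∈ φ.target, Q φ z → ∀ᶠ w in nhds z, Q φ w)
    (ho' : ∀ φ ∈ atlas ℂ M, ∀ z ∈ φ.target, ¬ Q φ z → ∀ᶠ w in nhds z, ¬ Q φ w) :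
    (∀ φ ∈ atlas ℂ M, ∀ z ∈ φ.target, Q φ z) ∨ (∀ φ ∈ atlas ℂ M, ∀ z ∈ φ.target, ¬ Q φ z) := by
  set S : Set M := {p | Q (chartAt ℂ p) (chartAt ℂ p p)} with hS
  have hiff : ∀ φ ∈ atlas ℂ M, ∀ p ∈ φ.source, p ∈ S ↔ Q φ (φ p) := fun φ hφ p hp =>
    ⟨hinv _ (chart_mem_atlas ℂ p) _ hφ p (mem_chart_source ℂ p) hp,
      hinv _ hφ _ (chart_mem_atlas ℂ p) p hp (mem_chart_source ℂ p)⟩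
  have h1 : IsOpen S := isOpen_iff_mem_nhds.2 fun p hp => by
    have hs := mem_chart_source ℂ p
    filter_upwards [((chartAt ℂ p).continuousAt hs).eventually
      (ho _ (chart_mem_atlas ℂ p) _ ((chartAt ℂ p).map_source hs) hp),
      (chartAt ℂ p).open_source.mem_nhds hs] with q hq hq'
    exact (hiff _ (chart_mem_atlas ℂ p) q hq').2 hq
  have h2 : IsOpen Sᶜ := isOpen_iff_mem_nhds.2 fun p hp => by
    have hs := mem_chart_source ℂ p
    filter_upwards [((chartAt ℂ p).continuousAt hs).eventually
      (ho' _ (chart_mem_atlas ℂ p) _ ((chartAt ℂ p).map_source hs) hp),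
      (chartAt ℂ p).open_source.mem_nhds hs] with q hq hq'
    exact fun hqS => hq ((hiff _ (chart_mem_atlas ℂ p) q hq').1 hqS)
  have key : ∀ φ ∈ atlas ℂ M, ∀ z ∈ φ.target, (φ.symm z ∈ S ↔ Q φ z) := fun φ hφ z hz => by
    rw [hiff φ hφ _ (φ.map_target hz), φ.right_inv hz]
  rcases isClopen_iff.1 (⟨isOpen_compl_iff.1 h2, h1⟩ : IsClopen S) with h | h
  · right
    intro φ hφ z hz hQ
    have := (key φ hφ z hz).2 hQ
    rw [h] at this
    exact this
  · left
    intro φ hφ z hz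
    rw [← key φ hφ z hz, h]
    trivial

variable {f fhat : M → Sph n}

omit [ChartedSpace ℂ M] [IsManifold 𝓘(ℂ) ω M] in
lemma norm_localRep (f : M → Sph n) (φ : OpenPartialHomeomorph M ℂ) (z : ℂ) :
    ‖localRep f φ z‖ = 1 :=
  mem_sphere_zero_iff_norm.1 (f (φ.symm z)).2

lemma isEnvelopePair_chart (hf : IsConformalImmersion f) (hfhat : IsConformalImmersion fhat)
    (hne : ∀ p, fhat p ≠ f p) (henv : EnvelopsCentralSpheres f fhat)
    {φ : OpenPartialHomeomorph M ℂ} (hφ : φ ∈ atlas ℂ M) :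
    IsEnvelopePair φ.target (canonicalLift (localRep f φ))
      (envelopeLift (localRep f φ) (localRep fhat φ)) :=
  isEnvelopePair φ.open_target (contDiffOn_comp_symm hf.1 hφ) (fun z _ => norm_localRep f φ z)
    (hf.2 φ hφ) (contDiffOn_comp_symm hfhat.1 hφ) (fun z _ => norm_localRep fhat φ z)
    (hfhat.2 φ hφ) (fun z _ h => hne (φ.symm z) (Subtype.ext h)) (henv φ hφ)

lemma deriv_transition_ne {φ φ' : OpenPartialHomeomorph M ℂ} (hφ : φ ∈ atlas ℂ M)
    (hφ' : φ' ∈ atlas ℂ M) {w : ℂ} (hw : w ∈ (φ'.symm ≫ₕ φ).source) :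
    deriv (φ'.symm ≫ₕ φ) w ≠ 0 := by
  have h1 : DifferentiableAt ℂ (φ'.symm ≫ₕ φ) w :=
    ((differentiableOn_transition hφ hφ').differentiableOn (by simp)).differentiableAt
      ((φ'.symm ≫ₕ φ).open_source.mem_nhds hw)
  have hw2 : (φ'.symm ≫ₕ φ) w ∈ (φ.symm ≫ₕ φ').source := by
    simp only [OpenPartialHomeomorph.trans_source, OpenPartialHomeomorph.symm_source,
      Set.mem_inter_iff, Set.mem_preimage, OpenPartialHomeomorph.coe_trans,
      Function.comp_apply] at hw ⊢
    exact ⟨φ.map_source hw.2, by rw [φ.left_inv hw.2]; exact φ'.map_target hw.1⟩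
  have h2 : DifferentiableAt ℂ (φ.symm ≫ₕ φ') ((φ'.symm ≫ₕ φ) w) :=
    ((differentiableOn_transition hφ' hφ).differentiableOn (by simp)).differentiableAt
      ((φ.symm ≫ₕ φ').open_source.mem_nhds hw2)
  have h3 := h2.hasDerivAt.comp w h1.hasDerivAt
  have h4 : (φ.symm ≫ₕ φ') ∘ (φ'.symm ≫ₕ φ) =ᶠ[nhds w] id := by
    filter_upwards [(φ'.symm ≫ₕ φ).open_source.mem_nhds hw] with x hx
    simp only [OpenPartialHomeomorph.trans_source, OpenPartialHomeomorph.symm_source,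
      Set.mem_inter_iff, Set.mem_preimage] at hx
    simp [φ.left_inv hx.2, φ'.right_inv hx.1]
  have h5 := (h3.congr_of_eventuallyEq h4.symm).unique (hasDerivAt_id w)
  intro h0
  rw [h0, mul_zero] at h5
  exact zero_ne_one h5

/-- Canonical lifts rescale by the conformal factors of the immersion in the two charts, and the
lifts of the envelope by the inverse factor. -/
lemma isCoordChange_chart (hf : IsConformalImmersion f) {φ φ' : OpenPartialHomeomorph M ℂ}
    (hφ : φ ∈ atlas ℂ M) (hφ' : φ' ∈ atlas ℂ M) :
    IsCoordChange (φ'.symm ≫ₕ φ).source φ.target (φ'.symm ≫ₕ φ)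
      (fun w => ‖fderiv ℝ (localRep f φ) ((φ'.symm ≫ₕ φ) w) 1‖ * ‖fderiv ℝ (localRep f φ') w 1‖⁻¹)
      (canonicalLift (localRep f φ)) (envelopeLift (localRep f φ) (localRep fhat φ))
      (canonicalLift (localRep f φ')) (envelopeLift (localRep f φ') (localRep fhat φ')) := by
  have hU : ∀ {w}, w ∈ (φ'.symm ≫ₕ φ).source → w ∈ φ'.target ∧ φ'.symm w ∈ φ.source := fun hw => by
    simpa using hw
  have hm : ∀ {w}, w ∈ (φ'.symm ≫ₕ φ).source → (φ'.symm ≫ₕ φ) w ∈ φ.target := fun hw =>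
    φ.map_source (hU hw).2
  have hrep : ∀ (u : M → Sph n) {w}, w ∈ (φ'.symm ≫ₕ φ).source →
      localRep u φ' w = localRep u φ ((φ'.symm ≫ₕ φ) w) := fun u w hw => by
    simp [localRep, φ.left_inv (hU hw).2]
  have hpos : ∀ {w}, w ∈ (φ'.symm ≫ₕ φ).source →
      0 < ‖fderiv ℝ (localRep f φ) ((φ'.symm ≫ₕ φ) w) 1‖ := fun hw =>
    norm_fderiv_one_pos (hf.2 φ hφ _ (hm hw))
  have hpos' : ∀ {w}, w ∈ (φ'.symm ≫ₕ φ).source → 0 < ‖fderiv ℝ (localRep f φ') w 1‖ := fun hw =>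
    norm_fderiv_one_pos (hf.2 φ' hφ' _ (hU hw).1)
  have hY : ∀ w ∈ (φ'.symm ≫ₕ φ).source, canonicalLift (localRep f φ') w =
      ((‖fderiv ℝ (localRep f φ) ((φ'.symm ≫ₕ φ) w) 1‖ * ‖fderiv ℝ (localRep f φ') w 1‖⁻¹ : ℝ) : ℂ)
        • canonicalLift (localRep f φ) ((φ'.symm ≫ₕ φ) w) := fun w hw => by
    rw [canonicalLift, canonicalLift, hrep f hw, smul_smul]
    congr 1
    norm_cast
    have := (hpos hw).ne'
    field_simp
  have hd : ∀ w ∈ (φ'.symm ≫ₕ φ).source, DifferentiableAt ℂ (φ'.symm ≫ₕ φ) w := fun w hw =>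
    ((differentiableOn_transition hφ hφ').differentiableOn (by simp)).differentiableAt
      ((φ'.symm ≫ₕ φ).open_source.mem_nhds hw)
  refine ⟨(φ'.symm ≫ₕ φ).open_source, fun w hw => hm hw,
    fun w hw => (hd w hw).differentiableWithinAt, fun w hw => deriv_transition_ne hφ hφ' hw,
    fun w hw => ?_, fun w hw => mul_pos (hpos hw) (inv_pos.2 (hpos' hw)), hY, fun w hw => ?_⟩
  · have s1 := diffAt_of_contDiffOn φ.open_target (smooth_norm_fderiv φ.open_target
      (contDiffOn_comp_symm hf.1 hφ) (hf.2 φ hφ)) (hm hw)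
    have s2 := diffAt_of_contDiffOn φ'.open_target (smooth_norm_fderiv φ'.open_target
      (contDiffOn_comp_symm hf.1 hφ') (hf.2 φ' hφ')) (hU hw).1
    exact (s1.comp w ((hd w hw).restrictScalars ℝ)).mul (s2.inv (hpos' hw).ne')
  · rw [envelopeLift, envelopeLift, hY w hw, hrep fhat hw, lorentz_smul_left, smul_smul, mul_inv,
      mul_neg]

end Charts

/-! ### Lorentz frames and Möbius transformations -/

/-- The time-like unit vector `(1, 0, …, 0)`. -/
def timeVec (n : ℕ) : Fin (n + 2) → ℝ := nullLift (0 : EuclideanSpace ℝ (Fin (n + 1)))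

section MoebiusGroup

variable {n : ℕ}

lemma lorentz_timeVec (v : Fin (n + 2) → ℝ) : lorentz v (timeVec n) = -v 0 := by
  simp [lorentz, timeVec, nullLift]

lemma exists_spatialL_eq {v : Fin (n + 2) → ℝ} (hv : v 0 = 0) :
    ∃ x : EuclideanSpace ℝ (Fin (n + 1)), v = spatialL n x := by
  refine ⟨WithLp.toLp 2 fun i => v i.succ, ?_⟩
  funext i
  refine Fin.cases ?_ (fun j => ?_) i
  · simpa using hv
  · simp

/-- A Lorentz transformation that maps a given time-like unit vector `E` to `(1, 0, …, 0)`. It is,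
up to sign, the reflection in the time-like vector `E ± (1, 0, …, 0)`. -/
lemma exists_lorentz_equiv {E : Fin (n + 2) → ℝ} (hE : lorentz E E = -1) :
    ∃ A : (Fin (n + 2) → ℝ) ≃ₗ[ℝ] (Fin (n + 2) → ℝ),
      (∀ v w, lorentz (A v) (A w) = lorentz v w) ∧ A E = timeVec n := by
  obtain ⟨s, hs, hs0⟩ : ∃ s : ℝ, s * s = 1 ∧ 0 ≤ s * E 0 := by
    rcases le_total 0 (E 0) with h | h
    · exact ⟨1, by norm_num, by linarith⟩
    · exact ⟨-1, by norm_num, by linarith⟩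
  have tt : lorentz (timeVec n) (timeVec n) = -1 := by
    rw [lorentz_timeVec]; simp [timeVec, nullLift]
  have tE : lorentz (timeVec n) E = -E 0 := by rw [lorentz_comm, lorentz_timeVec]
  set u := E + s • timeVec n with hu
  have huu : lorentz u u = -2 - 2 * (s * E 0) := by
    simp only [hu, lorentz_add_left, lorentz_add_right, lorentz_smul_left, lorentz_smul_right, hE,
      tt, tE, lorentz_timeVec]
    linear_combination -hs
  have huu0 : lorentz u u ≠ 0 := by rw [huu]; linarith
  let R : (Fin (n + 2) → ℝ) →ₗ[ℝ] (Fin (n + 2) → ℝ) :=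
    { toFun := fun v => (-s) • (v - (2 * lorentz v u / lorentz u u) • u)
      map_add' := fun v w => by rw [lorentz_add_left]; module
      map_smul' := fun c v => by rw [lorentz_smul_left, RingHom.id_apply]; module }
  have hR : ∀ v, R v = (-s) • (v - (2 * lorentz v u / lorentz u u) • u) := fun _ => rfl
  have hRR : Function.Involutive R := fun v => by
    rw [hR, hR]
    simp only [lorentz_smul_left, lorentz_sub_left]
    have e : 2 * (-s * (lorentz v u - 2 * lorentz v u / lorentz u u * lorentz u u)) / lorentz u u
        = s * (2 * lorentz v u / lorentz u u) := by field_simp; ring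
    rw [e]
    generalize 2 * lorentz v u / lorentz u u = k
    match_scalars
    · linear_combination hs
    all_goals ring
  refine ⟨LinearEquiv.ofInvolutive R hRR, fun v w => ?_, ?_⟩
  · change lorentz (R v) (R w) = _
    rw [hR, hR]
    simp only [lorentz_smul_left, lorentz_sub_left, lorentz_smul_right, lorentz_sub_right,
      lorentz_comm u w]
    have hk : 2 * lorentz w u / lorentz u u * lorentz u u = 2 * lorentz w u :=
      div_mul_cancel₀ _ huu0
    linear_combination lorentz v w * hs + s * s * (2 * lorentz v u / lorentz u u) * hk
  · change R E = _
    have hEu : lorentz E u = -1 - s * E 0 := by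
      simp only [hu, lorentz_add_right, lorentz_smul_right, hE, lorentz_timeVec]; ring
    have : 2 * lorentz E u / lorentz u u = 1 := by
      rw [div_eq_one_iff_eq huu0, huu, hEu]; ring
    rw [hR, this, hu]
    match_scalars
    · ring
    · linear_combination hs

lemma exists_smul_nullLift {v : Fin (n + 2) → ℝ} (hv : lorentz v v = 0) (h0 : v ≠ 0) :
    ∃ y : Sph n, ∃ c : ℝ, c ≠ 0 ∧ v = c • nullLift y.1 := by
  have e : ∑ i : Fin (n + 1), v i.succ ^ 2 = v 0 ^ 2 := by
    rw [lorentz] at hv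
    rw [← sub_eq_zero, ← hv, pow_two]
    simp only [pow_two]
  have hv0 : v 0 ≠ 0 := fun hz => h0 <| by
    rw [hz, zero_pow two_ne_zero,
      Finset.sum_eq_zero_iff_of_nonneg (fun i _ => sq_nonneg _)] at e
    funext i
    refine Fin.cases hz (fun j => ?_) i
    simpa using e j (Finset.mem_univ _)
  refine ⟨⟨WithLp.toLp 2 fun i => v i.succ / v 0, ?_⟩, v 0, hv0, ?_⟩
  · rw [mem_sphere_zero_iff_norm, EuclideanSpace.norm_eq, Real.sqrt_eq_one]
    simp only [Real.norm_eq_abs, sq_abs, div_pow]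
    rw [← Finset.sum_div, e, div_self (pow_ne_zero 2 hv0)]
  · funext i
    refine Fin.cases ?_ (fun j => ?_) i
    · simp [nullLift]
    · simp [nullLift, mul_div_cancel₀ _ hv0]

lemma nullLift_ne_zero (x : EuclideanSpace ℝ (Fin (n + 1))) : nullLift x ≠ 0 := fun h => by
  have := congrFun h 0
  simp [nullLift] at this

lemma eq_of_smul_nullLift {x y : EuclideanSpace ℝ (Fin (n + 1))} {c d : ℝ} (hc : c ≠ 0)
    (h : c • nullLift x = d • nullLift y) : x = y := by
  have h0 : c = d := by simpa [nullLift] using congrFun h 0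
  subst h0
  ext i
  have := congrFun (smul_right_injective _ hc h) i.succ
  simpa [nullLift] using this

/-- Every Lorentz transformation induces a Möbius transformation of the sphere. -/
lemma exists_isMoebius (A : (Fin (n + 2) → ℝ) ≃ₗ[ℝ] (Fin (n + 2) → ℝ))
    (hA : ∀ v w, lorentz (A v) (A w) = lorentz v w) :
    ∃ T : Sph n → Sph n, IsMoebius T ∧
      ∀ x : Sph n, ∃ c : ℝ, c ≠ 0 ∧ A (nullLift x.1) = c • nullLift (T x).1 := by
  have : ∀ x : Sph n, ∃ y : Sph n, ∃ c : ℝ, c ≠ 0 ∧ A (nullLift x.1) = c • nullLift y.1 := fun x =>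
    exists_smul_nullLift
      (by rw [hA, lorentz_nullLift_self (mem_sphere_zero_iff_norm.1 x.2)])
      (fun h => nullLift_ne_zero x.1 (A.map_eq_zero_iff.1 h))
  choose T hT using this
  exact ⟨T, ⟨A, hA, hT⟩, hT⟩

end MoebiusGroup

/-- `E₀, …, E₃, e` is a Lorentz orthonormal frame of a five-dimensional subspace, with `E₀`
time-like. -/
structure IsLorentzFrame {m : ℕ} (e : Fin (m + 1) → ℝ) (E : Fin 4 → Fin (m + 1) → ℝ) : Prop where
  e_e : lorentz e e = 1
  e_E : ∀ i, lorentz e (E i) = 0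
  E_E : ∀ i j, lorentz (E i) (E j) = if i = j then (if i = 0 then -1 else 1) else 0

section Frame

variable {m : ℕ} {e : Fin (m + 1) → ℝ} {E : Fin 4 → Fin (m + 1) → ℝ}

/-- The vector with the coordinates `c` with respect to the frame `E`. -/
noncomputable def frameMap (E : Fin 4 → Fin (m + 1) → ℝ) : (Fin 4 → ℝ) →L[ℝ] (Fin (m + 1) → ℝ) :=
  (Fintype.linearCombination ℝ E).toContinuousLinearMap

/-- The coordinates with respect to the frame `E` of the projection of a vector. -/
noncomputable def frameCoord (E : Fin 4 → Fin (m + 1) → ℝ) :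
    (Fin (m + 1) → ℝ) →L[ℝ] (Fin 4 → ℝ) :=
  ContinuousLinearMap.pi
    ![-lorentzL ℝ m (E 0), lorentzL ℝ m (E 1), lorentzL ℝ m (E 2), lorentzL ℝ m (E 3)]

lemma frameMap_apply (c : Fin 4 → ℝ) :
    frameMap E c = c 0 • E 0 + c 1 • E 1 + c 2 • E 2 + c 3 • E 3 := by
  simp [frameMap, Fintype.linearCombination_apply, Fin.sum_univ_four]

lemma frameCoord_zero (v : Fin (m + 1) → ℝ) : frameCoord E v 0 = -lorentz (E 0) v := rfl
lemma frameCoord_one (v : Fin (m + 1) → ℝ) : frameCoord E v 1 = lorentz (E 1) v := rfl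
lemma frameCoord_two (v : Fin (m + 1) → ℝ) : frameCoord E v 2 = lorentz (E 2) v := rfl
lemma frameCoord_three (v : Fin (m + 1) → ℝ) : frameCoord E v 3 = lorentz (E 3) v := rfl

lemma IsLorentzFrame.lorentz_frameMap (h : IsLorentzFrame e E) (c d : Fin 4 → ℝ) :
    lorentz (frameMap E c) (frameMap E d) = lorentz c d := by
  rw [frameMap_apply, frameMap_apply]
  simp only [lorentz_add_left, lorentz_add_right, lorentz_smul_left, lorentz_smul_right, h.E_E]
  simp [lorentz, Fin.sum_univ_three]
  ring

end Frame

/-! ### Surfaces of constant mean curvature one in hyperbolic space -/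

/-- `X` and `H` are null lifts of a surface and of its hyperbolic Gauss map, in the span of the
Lorentz frame `E₀, …, E₃, e`. They are normalised by `⟨X, e⟩ = ⟨X, H⟩ = -1`, `⟨H, e⟩ = 0`, so that
`X + e` is a surface in the hyperboloid `e^⊥` with the unit normal `H - X - e`. The two lifts induce
orthogonal traceless tensors: `X` is conformal and `⟨dX, dH⟩` has trace zero. -/
structure IsGaussPair {m : ℕ} {M : Type*} [TopologicalSpace M] [ChartedSpace ℂ M]
    (e : Fin (m + 1) → ℝ) (E : Fin 4 → Fin (m + 1) → ℝ) (X H : M → Fin (m + 1) → ℝ) : Prop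
    extends IsLorentzFrame e E where
  smoothX : ContMDiff 𝓘(ℝ, ℂ) 𝓘(ℝ, Fin (m + 1) → ℝ) ∞ X
  smoothH : ContMDiff 𝓘(ℝ, ℂ) 𝓘(ℝ, Fin (m + 1) → ℝ) ∞ H
  mem_X : ∀ p, frameMap E (frameCoord E (X p)) = X p + e
  mem_H : ∀ p, frameMap E (frameCoord E (H p)) = H p
  X_X : ∀ p, lorentz (X p) (X p) = 0
  H_H : ∀ p, lorentz (H p) (H p) = 0
  X_H : ∀ p, lorentz (X p) (H p) = -1
  e_X : ∀ p, lorentz e (X p) = -1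
  e_H : ∀ p, lorentz e (H p) = 0
  future : ∀ p, 0 < frameCoord E (X p) 0
  conformal : ∀ φ ∈ atlas ℂ M, ∀ z ∈ φ.target, ∃ t : ℝ, 0 < t ∧
    lorentz (fderiv ℝ (fun w => X (φ.symm w)) z 1) (fderiv ℝ (fun w => X (φ.symm w)) z 1) = t ∧
    lorentz (fderiv ℝ (fun w => X (φ.symm w)) z Complex.I)
      (fderiv ℝ (fun w => X (φ.symm w)) z Complex.I) = t ∧
    lorentz (fderiv ℝ (fun w => X (φ.symm w)) z 1)
      (fderiv ℝ (fun w => X (φ.symm w)) z Complex.I) = 0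
  H_dX : ∀ φ ∈ atlas ℂ M, ∀ z ∈ φ.target, ∀ v : ℂ,
    lorentz (H (φ.symm z)) (fderiv ℝ (fun w => X (φ.symm w)) z v) = 0
  traceless : ∀ φ ∈ atlas ℂ M, ∀ z ∈ φ.target,
    lorentz (fderiv ℝ (fun w => X (φ.symm w)) z 1) (fderiv ℝ (fun w => H (φ.symm w)) z 1) +
    lorentz (fderiv ℝ (fun w => X (φ.symm w)) z Complex.I)
      (fderiv ℝ (fun w => H (φ.symm w)) z Complex.I) = 0

namespace IsGaussPair

variable {M : Type*} [TopologicalSpace M] [ChartedSpace ℂ M]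

/-- Since `X` is conformal with factor `t`, and the second fundamental form with respect to the
normal `ν = H - X - e` is `-⟨dX, dν⟩ = ⟨dX, dX⟩ - ⟨dX, dH⟩`, whose second term is trace-free, the
mean curvature is `1`. -/
lemma isCMC1 [IsManifold 𝓘(ℂ) ω M] {m : ℕ} {e : Fin (m + 1) → ℝ} {E : Fin 4 → Fin (m + 1) → ℝ}
    {X H : M → Fin (m + 1) → ℝ} (h : IsGaussPair e E X H) :
    IsCMC1 (fun p => frameCoord E (X p)) := by
  have hL := h.toIsLorentzFrame.lorentz_frameMap
  have hX_e : ∀ p, lorentz (X p) e = -1 := fun p => by rw [lorentz_comm, h.e_X]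
  have hH_e : ∀ p, lorentz (H p) e = 0 := fun p => by rw [lorentz_comm, h.e_H]
  have hH_X : ∀ p, lorentz (H p) (X p) = -1 := fun p => by rw [lorentz_comm, h.X_H]
  have memN : ∀ p, frameMap E (frameCoord E (H p - X p)) = H p - X p - e := fun p => by
    rw [map_sub, map_sub, h.mem_X, h.mem_H]; abel
  have sm : ∀ {u : M → Fin (m + 1) → ℝ}, ContMDiff 𝓘(ℝ, ℂ) 𝓘(ℝ, Fin (m + 1) → ℝ) ∞ u →
      ContMDiff 𝓘(ℝ, ℂ) 𝓘(ℝ, Fin 4 → ℝ) ∞ (fun p => frameCoord E (u p)) := fun hu =>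
    (frameCoord E).contDiff.comp_contMDiff hu
  refine ⟨sm h.smoothX, fun p => ⟨?_, h.future p⟩, fun p => frameCoord E (H p - X p),
    sm (h.smoothH.sub h.smoothX), fun p => ⟨?_, ?_⟩, fun φ hφ z hz => ?_⟩
  · rw [← hL, h.mem_X]
    simp only [lorentz_add_left, lorentz_add_right, h.X_X, h.e_X, hX_e, h.e_e]; norm_num
  · rw [← hL, memN]
    simp only [lorentz_sub_left, lorentz_sub_right, h.X_X, h.e_X, hX_e, h.e_e, h.H_H, h.X_H,
      h.e_H, hH_e, hH_X]
    norm_num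
  · rw [← hL, memN, h.mem_X]
    simp only [lorentz_sub_left, lorentz_add_right, h.X_X, h.e_X, hX_e, h.e_e,
      hH_e, hH_X]
    norm_num
  have hx := contDiffOn_comp_symm h.smoothX hφ
  have hh := contDiffOn_comp_symm h.smoothH hφ
  have hΩ := φ.open_target
  set x : ℂ → Fin (m + 1) → ℝ := fun w => X (φ.symm w) with hxdef
  set y : ℂ → Fin (m + 1) → ℝ := fun w => H (φ.symm w) with hydef
  have fd : ∀ {k l : ℕ} (A : (Fin k → ℝ) →L[ℝ] (Fin l → ℝ)) {u : ℂ → Fin k → ℝ},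
      ContDiffOn ℝ ∞ u φ.target → ∀ w ∈ φ.target, ∀ v : ℂ,
      fderiv ℝ (fun w => A (u w)) w v = A (fderiv ℝ u w v) := by
    intro k l A u hu w hw v
    have := (A.hasFDerivAt.comp w (diffAt_of_contDiffOn hΩ hu hw).hasFDerivAt).fderiv
    have e : (⇑A ∘ u) = fun w => A (u w) := rfl
    rw [e] at this
    rw [this]; rfl
  have hsG : ContDiffOn ℝ ∞ (fun w => frameCoord E (x w)) φ.target :=
    (frameCoord E).contDiff.comp_contDiffOn hx
  have hsN : ContDiffOn ℝ ∞ (fun w => frameCoord E (y w - x w)) φ.target :=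
    (frameCoord E).contDiff.comp_contDiffOn (hh.sub hx)
  -- the tangent vectors in the coordinates of the frame correspond to those of `X` and `H`
  have dG : ∀ w ∈ φ.target, ∀ v : ℂ, frameMap E (fderiv ℝ (fun w => frameCoord E (x w)) w v) =
      fderiv ℝ x w v := fun w hw v => by
    rw [← fd (frameMap E) hsG w hw v]
    have : (fun w => frameMap E (frameCoord E (x w))) = fun w => x w + e :=
      funext fun w => h.mem_X _
    rw [this, fderiv_add_const]
  have dN : ∀ w ∈ φ.target, ∀ v : ℂ,
      frameMap E (fderiv ℝ (fun w => frameCoord E (y w - x w)) w v) =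
      fderiv ℝ y w v - fderiv ℝ x w v := fun w hw v => by
    rw [← fd (frameMap E) hsN w hw v]
    have : (fun w => frameMap E (frameCoord E (y w - x w))) = fun w => y w - x w - e :=
      funext fun w => memN _
    rw [this, fderiv_sub_const, fderiv_fun_sub (diffAt_of_contDiffOn hΩ hh hw)
      (diffAt_of_contDiffOn hΩ hx hw)]
    rfl
  have fst : ∀ v w : ℂ, lorentz (fderiv ℝ (fun w => frameCoord E (x w)) z v)
      (fderiv ℝ (fun w => frameCoord E (x w)) z w) =
      lorentz (fderiv ℝ x z v) (fderiv ℝ x z w) := fun v w => by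
    rw [← hL, dG z hz, dG z hz]
  have e_dx : ∀ w ∈ φ.target, ∀ v : ℂ, lorentz e (fderiv ℝ x w v) = 0 := fun w hw v => by
    have h1 := fderiv_lorentz (differentiableAt_const e) (diffAt_of_contDiffOn hΩ hx hw) v
    have h2 : (fun w => lorentz e (x w)) = fun _ => (-1 : ℝ) := funext fun w => h.e_X _
    rw [h2] at h1
    simpa using h1.symm
  have x_dx : ∀ w ∈ φ.target, ∀ v : ℂ, lorentz (x w) (fderiv ℝ x w v) = 0 := fun w hw v => by
    have dx := diffAt_of_contDiffOn hΩ hx hw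
    have h1 := fderiv_lorentz dx dx v
    have h2 : (fun w => lorentz (x w) (x w)) = fun _ => (0 : ℝ) := funext fun w => h.X_X _
    rw [h2, lorentz_comm (fderiv ℝ x w v)] at h1
    have h3 : (0 : ℝ) = lorentz (x w) (fderiv ℝ x w v) + lorentz (x w) (fderiv ℝ x w v) := by
      simpa using h1
    linarith
  have nrm : ∀ w ∈ φ.target, ∀ v : ℂ, lorentz (frameCoord E (y w - x w))
      (fderiv ℝ (fun w => frameCoord E (x w)) w v) = 0 := fun w hw v => by
    rw [← hL, dG w hw, memN, lorentz_sub_left, lorentz_sub_left, e_dx w hw]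
    have := x_dx w hw v
    have h2 := h.H_dX φ hφ w hw v
    rw [hxdef] at this
    rw [h2, this]; norm_num
  -- differentiate `⟨dG, ν⟩ = 0`
  have snd : ∀ a b : ℂ, secondForm (fun w => frameCoord E (x w)) (frameCoord E (y z - x z)) z a b =
      lorentz (fderiv ℝ x z b) (fderiv ℝ x z a) - lorentz (fderiv ℝ x z b) (fderiv ℝ y z a) := by
    intro a b
    have hsG' : ContDiffOn ℝ ∞ (fun w => fderiv ℝ (fun w => frameCoord E (x w)) w b) φ.target :=
      (hsG.fderiv_of_isOpen hΩ (by simp)).clm_apply contDiffOn_const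
    have h1 := fderiv_lorentz (diffAt_of_contDiffOn hΩ hsG' hz) (diffAt_of_contDiffOn hΩ hsN hz) a
    have h2 : fderiv ℝ (fun w => lorentz (fderiv ℝ (fun w => frameCoord E (x w)) w b)
        (frameCoord E (y w - x w))) z a = 0 := by
      have : fderiv ℝ (fun w => lorentz (fderiv ℝ (fun w => frameCoord E (x w)) w b)
          (frameCoord E (y w - x w))) z = fderiv ℝ (fun _ => (0 : ℝ)) z :=
        Filter.EventuallyEq.fderiv_eq (Filter.mem_of_superset (hΩ.mem_nhds hz)
          fun w hw => (lorentz_comm _ _).trans (nrm w hw b))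
      rw [this]; simp
    rw [h2, ← hL (fderiv ℝ (fun w => frameCoord E (x w)) z b), dG z hz, dN z hz,
      lorentz_sub_right] at h1
    rw [secondForm]
    linarith
  obtain ⟨t, ht, c1, c2, c3⟩ := h.conformal φ hφ z hz
  have tr := h.traceless φ hφ z hz
  rw [← hxdef] at c1 c2 c3 tr
  rw [← hydef] at tr
  have hdet : firstFormDet (fun w => frameCoord E (x w)) z = t ^ 2 := by
    rw [firstFormDet, fst, fst, fst, c1, c2, c3]; ring
  refine ⟨by rw [hdet]; positivity, fun v => nrm z hz v, ?_⟩
  change meanCurvature (fun w => frameCoord E (x w)) (frameCoord E (y z - x z)) z = 1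
  rw [meanCurvature, hdet, snd, snd, snd, fst, fst, fst, c1, c2, c3]
  field_simp
  linear_combination -t * tr

/-- The hyperbolic surface `X + e` and its Gauss map in the hemisphere model. -/
lemma exists_moebius {n : ℕ} {e : Fin (n + 2) → ℝ} {E : Fin 4 → Fin (n + 2) → ℝ}
    {X H : M → Fin (n + 2) → ℝ} (h : IsGaussPair e E X H) {f fhat : M → Sph n}
    (hfX : ∀ p, ∃ t : ℝ, t ≠ 0 ∧ nullLift (f p).1 = t • X p)
    (hfH : ∀ p, ∃ t : ℝ, t ≠ 0 ∧ nullLift (fhat p).1 = t • H p) :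
    ∃ (T : Sph n → Sph n)
      (L : EuclideanSpace ℝ (Fin 4) →ₗᵢ[ℝ] EuclideanSpace ℝ (Fin (n + 1))),
      IsMoebius T ∧
      (∀ p, (T (f p)).1 = L (hemisphereModel (frameCoord E (X p)))) ∧
      (∀ p, ∃ y ∈ idealBoundary, (T (fhat p)).1 = L y) := by
  obtain ⟨A, hA, hAE⟩ := exists_lorentz_equiv (n := n) (E := E 0) (by simp [h.E_E])
  obtain ⟨T, hT, hTA⟩ := exists_isMoebius A hA
  have hsp : ∀ v, lorentz v (E 0) = 0 → ∃ x : EuclideanSpace ℝ (Fin (n + 1)), A v = spatialL n x :=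
    fun v hv => exists_spatialL_eq (by
      have := lorentz_timeVec (A v)
      rw [← hAE, hA, hv] at this
      linarith)
  obtain ⟨u1, h1⟩ := hsp (E 1) (by simp [h.E_E])
  obtain ⟨u2, h2⟩ := hsp (E 2) (by simp [h.E_E])
  obtain ⟨u3, h3⟩ := hsp (E 3) (by simp [h.E_E])
  obtain ⟨u4, h4⟩ := hsp (-e) (by simp [h.e_E])
  have on : Orthonormal ℝ ![u1, u2, u3, u4] := by
    rw [orthonormal_iff_ite]
    have hE_e : ∀ i, lorentz (E i) e = 0 := fun i => by rw [lorentz_comm, h.e_E]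
    have hv : ∀ i, A (![E 1, E 2, E 3, -e] i) = spatialL n (![u1, u2, u3, u4] i) := fun i => by
      fin_cases i
      exacts [h1, h2, h3, h4]
    intro i j
    rw [← lorentz_spatialL, ← hv, ← hv, hA]
    fin_cases i <;> fin_cases j <;> simp [h.E_E, h.e_E, hE_e, h.e_e]
  let L0 : EuclideanSpace ℝ (Fin 4) →ₗ[ℝ] EuclideanSpace ℝ (Fin (n + 1)) :=
    (Fintype.linearCombination ℝ ![u1, u2, u3, u4]) ∘ₗ
      (WithLp.linearEquiv 2 ℝ (Fin 4 → ℝ)).toLinearMap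
  have hL0 : ∀ y, L0 y = ∑ i, y i • ![u1, u2, u3, u4] i := fun y => rfl
  let L : EuclideanSpace ℝ (Fin 4) →ₗᵢ[ℝ] EuclideanSpace ℝ (Fin (n + 1)) :=
    L0.isometryOfInner fun x y => by
      rw [hL0, hL0, on.inner_sum]
      simp [PiLp.inner_apply, mul_comm]
  have hL : ∀ y, L y = y 0 • u1 + y 1 • u2 + y 2 • u3 + y 3 • u4 := fun y => by
    change L0 y = _
    rw [hL0, Fin.sum_univ_four]; rfl
  have hAmap : ∀ c : Fin 4 → ℝ, A (frameMap E c) =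
      c 0 • timeVec n + spatialL n (c 1 • u1 + c 2 • u2 + c 3 • u3) := fun c => by
    rw [frameMap_apply]
    simp only [map_add, map_smul, hAE, h1, h2, h3]
    abel
  refine ⟨T, L, hT, fun p => ?_, fun p => ?_⟩
  · obtain ⟨c, hc, hc'⟩ := hTA (f p)
    obtain ⟨t, ht, ht'⟩ := hfX p
    set g := frameCoord E (X p) with hg
    have hg0 : g 0 ≠ 0 := (h.future p).ne'
    have hAX : A (X p) = g 0 • nullLift (L (hemisphereModel g)) := by
      have : X p = frameMap E g + -e := by rw [hg, h.mem_X]; abel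
      rw [this, map_add, hAmap, h4, nullLift_eq (L _), smul_add, ← map_smul (spatialL n), hL,
        timeVec]
      have e1 : g 0 • (hemisphereModel g 0 • u1 + hemisphereModel g 1 • u2 +
          hemisphereModel g 2 • u3 + hemisphereModel g 3 • u4) =
          g 1 • u1 + g 2 • u2 + g 3 • u3 + u4 := by
        simp only [hemisphereModel, smul_add, smul_smul]
        simp [mul_div_cancel₀ _ hg0, hg0]
      rw [e1]
      simp only [map_add]
      abel
    rw [ht', map_smul, hAX, smul_smul] at hc'
    exact (eq_of_smul_nullLift (mul_ne_zero ht hg0) hc').symm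
  · obtain ⟨c, hc, hc'⟩ := hTA (fhat p)
    obtain ⟨t, ht, ht'⟩ := hfH p
    set k := frameCoord E (H p) with hk
    have hkk : k 1 ^ 2 + k 2 ^ 2 + k 3 ^ 2 = k 0 ^ 2 := by
      have := h.toIsLorentzFrame.lorentz_frameMap k k
      rw [hk, h.mem_H, h.H_H, ← hk] at this
      simp [lorentz, Fin.sum_univ_three] at this
      linarith
    have hk0 : k 0 ≠ 0 := fun h0 => by
      have hH0 : H p = 0 := by
        rw [h0] at hkk
        have e1 : k 1 = 0 := by nlinarith [sq_nonneg (k 1), sq_nonneg (k 2), sq_nonneg (k 3)]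
        have e2 : k 2 = 0 := by nlinarith [sq_nonneg (k 1), sq_nonneg (k 2), sq_nonneg (k 3)]
        have e3 : k 3 = 0 := by nlinarith [sq_nonneg (k 1), sq_nonneg (k 2), sq_nonneg (k 3)]
        rw [← h.mem_H p, ← hk, frameMap_apply, h0, e1, e2, e3]; simp
      have := h.X_H p
      rw [hH0] at this
      simp at this
    refine ⟨!₂[k 1 / k 0, k 2 / k 0, k 3 / k 0, 0], ⟨?_, by simp⟩, ?_⟩
    · rw [EuclideanSpace.norm_eq, Real.sqrt_eq_one, Fin.sum_univ_four]
      simp only [Real.norm_eq_abs, sq_abs]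
      simp
      field_simp
      exact hkk
    · have hAH : A (H p) = k 0 • nullLift (L !₂[k 1 / k 0, k 2 / k 0, k 3 / k 0, 0]) := by
        rw [← h.mem_H p, ← hk, hAmap, nullLift_eq (L _), smul_add, ← map_smul (spatialL n), hL,
          timeVec]
        have e1 : k 0 •
            ((!₂[k 1 / k 0, k 2 / k 0, k 3 / k 0, 0] : EuclideanSpace ℝ (Fin 4)) 0 • u1 +
            (!₂[k 1 / k 0, k 2 / k 0, k 3 / k 0, 0] : EuclideanSpace ℝ (Fin 4)) 1 • u2 +
            (!₂[k 1 / k 0, k 2 / k 0, k 3 / k 0, 0] : EuclideanSpace ℝ (Fin 4)) 2 • u3 +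
            (!₂[k 1 / k 0, k 2 / k 0, k 3 / k 0, 0] : EuclideanSpace ℝ (Fin 4)) 3 • u4) =
            k 1 • u1 + k 2 • u2 + k 3 • u3 := by
          simp only [smul_add, smul_smul]
          simp [mul_div_cancel₀ _ hk0]
        rw [e1]
        abel
      rw [ht', map_smul, hAH, smul_smul] at hc'
      exact (eq_of_smul_nullLift (mul_ne_zero ht hk0) hc').symm

end IsGaussPair

/-! ### The Lorentz frame at a point of the surface -/

section PointFrame

variable {m : ℕ} {Ω : Set ℂ} {Y Z : ℂ → Fin (m + 1) → ℂ} {z : ℂ}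

/-- The orthonormal frame of `e^⊥ ∩ (V ⊕ ℝψ)` that consists of the point `X + e` of hyperbolic
space, two tangent vectors of the surface and its normal vector. -/
noncomputable def envFrame (Y Z : ℂ → Fin (m + 1) → ℂ) (z : ℂ) : Fin 4 → Fin (m + 1) → ℂ :=
  ![envX Y Z z + envE Y Z z, envP Y Z z + star (envP Y Z z),
    Complex.I • (envP Y Z z - star (envP Y Z z)), -(envPsi Y Z z + envX Y Z z)]

namespace IsEnvelopePair

variable (h : IsEnvelopePair Ω Y Z) (hρ : ∀ z ∈ Ω, envRho Y Z z = 0)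
  (hκ : ∀ z ∈ Ω, hopf Y z ≠ 0)

include h hρ hκ in
lemma E_E (hz : z ∈ Ω) : lorentz (envE Y Z z) (envE Y Z z) = 1 := by
  simp only [envE, lorentz_add_left, lorentz_add_right, h.psi_psi hρ hκ hz, h.psi_H hz,
    lorentz_comm (envH Y Z z) (envPsi Y Z z), h.H_H hz]
  ring

include h hρ hκ in
lemma E_X (hz : z ∈ Ω) : lorentz (envE Y Z z) (envX Y Z z) = -1 := by
  simp only [envE, lorentz_add_left, h.psi_X hz,
    lorentz_comm (envH Y Z z) (envX Y Z z), h.X_H hρ hκ hz]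
  ring

include h in
lemma E_H (hz : z ∈ Ω) : lorentz (envE Y Z z) (envH Y Z z) = 0 := by
  simp only [envE, lorentz_add_left, h.psi_H hz, h.H_H hz]
  ring

include h hρ in
lemma star_frame (hz : z ∈ Ω) (i : Fin 4) : star (envFrame Y Z z i) = envFrame Y Z z i := by
  fin_cases i
  · simp [envFrame, h.star_X hz, h.star_E hρ hz]
  · simp [envFrame, add_comm]
  · simp only [envFrame, Fin.reduceFinMk, Matrix.cons_val, star_smul, star_sub, star_star]
    rw [show star Complex.I = -Complex.I from Complex.conj_I]
    module
  · simp [envFrame, h.star_X hz, h.star_psi hρ hz]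

include h hρ hκ in
lemma lorentz_frame (hz : z ∈ Ω) (i j : Fin 4) :
    lorentz (envFrame Y Z z i) (envFrame Y Z z j) =
      if i = j then (if i = 0 then -1 else 1) else 0 := by
  have e1 := h.X_X (Z := Z) hz
  have e2 := h.X_H hρ hκ hz
  have e3 := h.X_P hz
  have e4 := h.X_star_P hz
  have e5 := h.H_H hz
  have e6 := h.H_P hz
  have e7 := h.H_star_P hz
  have e8 := h.psi_psi hρ hκ hz
  have e9 := h.psi_X hz
  have e10 := h.psi_H hz
  have e11 := h.psi_P hz
  have e12 := h.psi_star_P hz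
  have e13 := h.P_P hz
  have e14 := h.P_star_P hz
  have e15 := h.star_P_star_P hz
  have f2 := e2; have f3 := e3; have f4 := e4; have f6 := e6; have f7 := e7; have f9 := e9
  have f10 := e10; have f11 := e11; have f12 := e12; have f14 := e14
  rw [lorentz_comm] at f2 f3 f4 f6 f7 f9 f10 f11 f12 f14
  fin_cases i <;> fin_cases j <;>
    simp [envFrame, envE, e1, e2, e3, e4, e5, e6, e7, e8, e9, e10, e11, e12, e13, e14, e15, f2, f3,
      f4, f6, f7, f9, f10, f11, f12, f14] <;> ring_nf
  simp

include h hρ hκ in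
lemma lorentz_E_frame (hz : z ∈ Ω) (i : Fin 4) :
    lorentz (envE Y Z z) (envFrame Y Z z i) = 0 := by
  have e3 := h.X_P hz
  have e5 := h.H_H hz
  have e6 := h.H_P hz
  have e7 := h.H_star_P hz
  have e8 := h.psi_psi hρ hκ hz
  have e9 := h.psi_X hz
  have e10 := h.psi_H hz
  have e11 := h.psi_P hz
  have e12 := h.psi_star_P hz
  have f2 := h.X_H hρ hκ hz
  have f10 := e10
  rw [lorentz_comm] at f2 f10
  fin_cases i <;> simp [envFrame, envE, e5, e6, e7, e8, e9, e10, e11, e12, f2, f10]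

/-- The orthogonal projection to `V ⊕ ℂψ` in terms of the orthonormal frame. -/
lemma proj_eq_frame (Y Z : ℂ → Fin (m + 1) → ℂ) (z : ℂ) (w : Fin (m + 1) → ℂ) :
    envProj Y Z z w = -lorentz (envFrame Y Z z 0) w • envFrame Y Z z 0
      + lorentz (envFrame Y Z z 1) w • envFrame Y Z z 1
      + lorentz (envFrame Y Z z 2) w • envFrame Y Z z 2
      + lorentz (envFrame Y Z z 3) w • envFrame Y Z z 3
      + lorentz (envE Y Z z) w • envE Y Z z := by
  have e2 : lorentz (envFrame Y Z z 2) w • envFrame Y Z z 2 =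
      -(lorentz (envP Y Z z) w - lorentz (star (envP Y Z z)) w) •
        (envP Y Z z - star (envP Y Z z)) := by
    simp only [envFrame, Matrix.cons_val, lorentz_smul_left, lorentz_sub_left, smul_smul]
    congr 1
    linear_combination (lorentz (envP Y Z z) w - lorentz (star (envP Y Z z)) w) * Complex.I_mul_I
  rw [e2]
  simp only [envProj, envFrame, Matrix.cons_val, envE, lorentz_add_left, lorentz_neg_left,
    lorentz_comm w]
  module

include h hρ hκ in
lemma proj_X (hz : z ∈ Ω) : envProj Y Z z (envX Y Z z) = envX Y Z z := by
  rw [envProj, h.X_H hρ hκ hz, h.X_X hz, h.X_P hz, h.X_star_P hz, lorentz_comm, h.psi_X hz]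
  module

include h hρ hκ in
lemma proj_H (hz : z ∈ Ω) : envProj Y Z z (envH Y Z z) = envH Y Z z := by
  rw [envProj, lorentz_comm _ (envX Y Z z), h.X_H hρ hκ hz, h.H_H hz, h.H_P hz, h.H_star_P hz,
    lorentz_comm, h.psi_H hz]
  module

include h hρ in
lemma star_proj (hz : z ∈ Ω) {w : Fin (m + 1) → ℂ} (hw : star w = w) :
    star (envProj Y Z z w) = envProj Y Z z w := by
  have e : ∀ v, star (lorentz w v) = lorentz w (star v) := fun v => by
    rw [← lorentz_star, hw]
  simp only [envProj, star_add, star_sub, star_smul, star_neg, star_mul', star_ofNat, e, star_star,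
    h.star_X hz, h.star_H hz, h.star_psi hρ hz]
  module

end IsEnvelopePair

end PointFrame

/-! ### From local to global -/

section Family

variable {m : ℕ} {M : Type*} [TopologicalSpace M] [ChartedSpace ℂ M]

/-- A family of canonical lifts and envelopes in the charts of a Riemann surface, compatible with
the changes of charts. -/
structure IsEnvelopeFamily (Y Z : OpenPartialHomeomorph M ℂ → ℂ → Fin (m + 1) → ℂ) : Prop where
  pair : ∀ φ ∈ atlas ℂ M, IsEnvelopePair φ.target (Y φ) (Z φ)
  change : ∀ φ ∈ atlas ℂ M, ∀ φ' ∈ atlas ℂ M, ∃ r : ℂ → ℝ,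
    IsCoordChange (φ'.symm ≫ₕ φ).source φ.target (φ'.symm ≫ₕ φ) r (Y φ) (Z φ) (Y φ') (Z φ')

omit [ChartedSpace ℂ M] in
lemma mem_transition_source {φ φ' : OpenPartialHomeomorph M ℂ} {p : M} (hp : p ∈ φ.source)
    (hp' : p ∈ φ'.source) :
    φ' p ∈ (φ'.symm ≫ₕ φ).source ∧ (φ'.symm ≫ₕ φ) (φ' p) = φ p := by
  simp [φ'.left_inv hp', φ'.map_source hp', hp]

omit [ChartedSpace ℂ M] in
lemma transition_source_subset (φ φ' : OpenPartialHomeomorph M ℂ) :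
    (φ'.symm ≫ₕ φ).source ⊆ φ'.target := fun w hw => by
  simp at hw; exact hw.1

namespace IsEnvelopeFamily

variable [PreconnectedSpace M] {Y Z : OpenPartialHomeomorph M ℂ → ℂ → Fin (m + 1) → ℂ}
  (F : IsEnvelopeFamily Y Z)
include F

/-- The sets `{θ = 0}` and `{ρ = 0}` are closed, disjoint and cover the connected surface. -/
lemma theta_dichotomy : (∀ φ ∈ atlas ℂ M, ∀ z ∈ φ.target, envTheta (Y φ) (Z φ) z = 0) ∨
    (∀ φ ∈ atlas ℂ M, ∀ z ∈ φ.target, envRho (Y φ) (Z φ) z = 0) := by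
  refine (chart_dichotomy (fun φ z => envTheta (Y φ) (Z φ) z = 0) ?_ ?_ ?_).imp_right
    fun h φ hφ z hz => (mul_eq_zero.1 ((F.pair φ hφ).theta_mul_rho hz)).resolve_left (h φ hφ z hz)
  · intro φ hφ φ' hφ' p hp hp' h
    obtain ⟨r, c⟩ := F.change φ hφ φ' hφ'
    obtain ⟨h1, h2⟩ := mem_transition_source hp hp'
    rw [c.theta_eq (F.pair φ hφ) h1, h2, h, mul_zero]
  · intro φ hφ z hz h
    have hp := F.pair φ hφ
    have hc := (hp.smooth_rho.continuousOn).continuousAt (hp.isOpen.mem_nhds hz)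
    filter_upwards [hc.eventually_ne fun h' => hp.theta_ne_or_rho_ne hz h h',
      hp.isOpen.mem_nhds hz] with w hw hw'
    exact (mul_eq_zero.1 (hp.theta_mul_rho hw')).resolve_right hw
  · intro φ hφ z hz h
    have hp := F.pair φ hφ
    exact ((hp.smooth_theta.continuousOn).continuousAt (hp.isOpen.mem_nhds hz)).eventually_ne h

variable (hρ : ∀ φ ∈ atlas ℂ M, ∀ z ∈ φ.target, envRho (Y φ) (Z φ) z = 0)
include hρ

/-- The zero set of `κ` is closed and, for `ρ = 0`, also open. -/
lemma hopf_dichotomy : (∀ φ ∈ atlas ℂ M, ∀ z ∈ φ.target, hopf (Y φ) z = 0) ∨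
    (∀ φ ∈ atlas ℂ M, ∀ z ∈ φ.target, hopf (Y φ) z ≠ 0) := by
  refine chart_dichotomy (fun φ z => hopf (Y φ) z = 0) ?_ ?_ ?_
  · intro φ hφ φ' hφ' p hp hp' h
    obtain ⟨r, c⟩ := F.change φ hφ φ' hφ'
    obtain ⟨h1, h2⟩ := mem_transition_source hp hp'
    rw [c.kappa_eq (F.pair φ hφ) (F.pair φ' hφ') (transition_source_subset φ φ') h1, h2, h,
      smul_zero]
  · intro φ hφ z hz h
    exact (F.pair φ hφ).eventually_hopf_eq_zero (hρ φ hφ) hz h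
  · intro φ hφ z hz h
    have hp := F.pair φ hφ
    exact ((hp.smooth_hopf.continuousOn).continuousAt (hp.isOpen.mem_nhds hz)).eventually_ne h

variable (hκ : ∀ φ ∈ atlas ℂ M, ∀ z ∈ φ.target, hopf (Y φ) z ≠ 0)
include hκ

lemma E_const {φ₀ : OpenPartialHomeomorph M ℂ} (hφ₀ : φ₀ ∈ atlas ℂ M) {z₀ : ℂ}
    (hz₀ : z₀ ∈ φ₀.target) : ∀ φ ∈ atlas ℂ M, ∀ z ∈ φ.target,
      envE (Y φ) (Z φ) z = envE (Y φ₀) (Z φ₀) z₀ := by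
  have hloc : ∀ φ ∈ atlas ℂ M, ∀ z ∈ φ.target, ∀ᶠ w in nhds z,
      envE (Y φ) (Z φ) w = envE (Y φ) (Z φ) z := fun φ hφ z hz => by
    have hp := F.pair φ hφ
    exact eventually_eq_of_dz_eq_zero hp.isOpen (hp.smooth_E (hρ φ hφ) (hκ φ hφ))
      (fun w hw => hp.star_E (hρ φ hφ) hw) (fun w hw => hp.dz_E (hρ φ hφ) (hκ φ hφ) hw) hz
  refine (chart_dichotomy (fun φ z => envE (Y φ) (Z φ) z = envE (Y φ₀) (Z φ₀) z₀)
    ?_ ?_ ?_).resolve_right fun h => h φ₀ hφ₀ z₀ hz₀ rfl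
  · intro φ hφ φ' hφ' p hp hp' h
    obtain ⟨r, c⟩ := F.change φ hφ φ' hφ'
    obtain ⟨h1, h2⟩ := mem_transition_source hp hp'
    rw [c.E_eq (F.pair φ hφ) (F.pair φ' hφ') (transition_source_subset φ φ') h1, h2, h]
  · intro φ hφ z hz h
    filter_upwards [hloc φ hφ z hz] with w hw
    rw [hw, h]
  · intro φ hφ z hz h
    filter_upwards [hloc φ hφ z hz] with w hw
    rwa [hw]

lemma proj_const {φ₀ : OpenPartialHomeomorph M ℂ} (hφ₀ : φ₀ ∈ atlas ℂ M) {z₀ : ℂ}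
    (hz₀ : z₀ ∈ φ₀.target) {v : Fin (m + 1) → ℂ} (hv : star v = v) :
    ∀ φ ∈ atlas ℂ M, ∀ z ∈ φ.target,
      envProj (Y φ) (Z φ) z v = envProj (Y φ₀) (Z φ₀) z₀ v := by
  have hloc : ∀ φ ∈ atlas ℂ M, ∀ z ∈ φ.target, ∀ᶠ w in nhds z,
      envProj (Y φ) (Z φ) w v = envProj (Y φ) (Z φ) z v := fun φ hφ z hz => by
    have hp := F.pair φ hφ
    exact eventually_eq_of_dz_eq_zero (u := fun w => envProj (Y φ) (Z φ) w v) hp.isOpen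
      (hp.smooth_proj (hρ φ hφ) (hκ φ hφ) v)
      (fun w hw => hp.star_proj (hρ φ hφ) hw hv)
      (fun w hw => hp.dz_proj (hρ φ hφ) (hκ φ hφ) v hw) hz
  refine (chart_dichotomy (fun φ z => envProj (Y φ) (Z φ) z v = envProj (Y φ₀) (Z φ₀) z₀ v)
    ?_ ?_ ?_).resolve_right fun h => h φ₀ hφ₀ z₀ hz₀ rfl
  · intro φ hφ φ' hφ' p hp hp' h
    obtain ⟨r, c⟩ := F.change φ hφ φ' hφ'
    obtain ⟨h1, h2⟩ := mem_transition_source hp hp'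
    rw [c.proj_eq (F.pair φ hφ) (F.pair φ' hφ') (transition_source_subset φ φ') h1, h2, h]
  · intro φ hφ z hz h
    filter_upwards [hloc φ hφ z hz] with w hw
    rw [hw, h]
  · intro φ hφ z hz h
    filter_upwards [hloc φ hφ z hz] with w hw
    rwa [hw]

end IsEnvelopeFamily

end Family

section Global

variable {n : ℕ} {M : Type*} [TopologicalSpace M] [ChartedSpace ℂ M] [IsManifold 𝓘(ℂ) ω M]
  {f fhat : M → Sph n}

lemma isEnvelopeFamily (hf : IsConformalImmersion f) (hfhat : IsConformalImmersion fhat)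
    (hne : ∀ p, fhat p ≠ f p) (henv : EnvelopsCentralSpheres f fhat) :
    IsEnvelopeFamily (fun φ : OpenPartialHomeomorph M ℂ => canonicalLift (localRep f φ))
      (fun φ => envelopeLift (localRep f φ) (localRep fhat φ)) :=
  ⟨fun _ hφ => isEnvelopePair_chart hf hfhat hne henv hφ,
    fun _ hφ _ hφ' => ⟨_, isCoordChange_chart hf hφ hφ'⟩⟩

/-- The Euler-Lagrange expression is `-(θ̄/2) κ`, so it vanishes when `θ` or `κ` does. -/
lemma isSWillmore_of_theta_or_hopf (hf : IsConformalImmersion f)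
    (hfhat : IsConformalImmersion fhat)
    (hne : ∀ p, fhat p ≠ f p) (henv : EnvelopsCentralSpheres f fhat)
    (h : ∀ φ ∈ atlas ℂ M, ∀ z ∈ φ.target,
      envTheta (canonicalLift (localRep f φ))
        (envelopeLift (localRep f φ) (localRep fhat φ)) z = 0 ∨
      hopf (canonicalLift (localRep f φ)) z = 0) : IsSWillmore f :=
  ⟨fun _ hφ _ hz => ((isEnvelopePair_chart hf hfhat hne henv hφ).willmoreEq_iff hz).2 (h _ hφ _ hz),
    fun _ hφ _ hz => (isEnvelopePair_chart hf hfhat hne henv hφ).not_linearIndependent hz⟩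

/-- The multiple of the null lift of `f` that has the product `-1` with `e`. -/
noncomputable def normLift (f : M → Sph n) (e : M → Fin (n + 2) → ℝ) (p : M) : Fin (n + 2) → ℝ :=
  (-(lorentz (e p) (nullLift (f p).1))⁻¹) • nullLift (f p).1

omit [TopologicalSpace M] [ChartedSpace ℂ M] [IsManifold 𝓘(ℂ) ω M] in
lemma eq_toC_normLift {f : M → Sph n} {e : M → Fin (n + 2) → ℝ} {p : M} {s : ℂ}
    {v : Fin (n + 2) → ℂ}
    (hs : v = s • nullLiftC (f p).1) (he : lorentz (toC (e p)) v = -1) :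
    lorentz (e p) (nullLift (f p).1) ≠ 0 ∧ v = toC (normLift f e p) := by
  rw [hs, lorentz_smul_right, nullLiftC_eq, lorentz_toC] at he
  have h0 : lorentz (e p) (nullLift (f p).1) ≠ 0 := fun h => by
    rw [h] at he; simp at he
  refine ⟨h0, ?_⟩
  have h1 : ((lorentz (e p) (nullLift (f p).1) : ℝ) : ℂ) ≠ 0 := Complex.ofReal_ne_zero.2 h0
  have h2 : s = -((lorentz (e p) (nullLift (f p).1) : ℝ) : ℂ)⁻¹ := by
    field_simp; linear_combination he
  rw [hs, h2]
  funext i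
  simp [normLift, toC, nullLiftC]

omit [IsManifold 𝓘(ℂ) ω M] in
lemma smooth_normLift {f : M → Sph n} {e : M → Fin (n + 2) → ℝ}
    (hf : ContMDiff 𝓘(ℝ, ℂ) 𝓘(ℝ, EuclideanSpace ℝ (Fin (n + 1))) ∞ (fun p => (f p).1))
    (he : ContMDiff 𝓘(ℝ, ℂ) 𝓘(ℝ, Fin (n + 2) → ℝ) ∞ e)
    (h0 : ∀ p, lorentz (e p) (nullLift (f p).1) ≠ 0) :
    ContMDiff 𝓘(ℝ, ℂ) 𝓘(ℝ, Fin (n + 2) → ℝ) ∞ (normLift f e) := by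
  have hn : ContMDiff 𝓘(ℝ, ℂ) 𝓘(ℝ, Fin (n + 2) → ℝ) ∞ (fun p => nullLift (f p).1) :=
    contDiff_nullLift.comp_contMDiff hf
  have hl : ContMDiff 𝓘(ℝ, ℂ) 𝓘(ℝ, ℝ) ∞ (fun p => lorentz (e p) (nullLift (f p).1)) :=
    (lorentzL ℝ (n + 1)).isBoundedBilinearMap.contDiff.comp_contMDiff (he.prodMk_space hn)
  exact ((hl.inv₀ h0).neg).smul hn

end Global

/-! ### The surface in hyperbolic space and its Gauss map -/

section Main

variable {n : ℕ} {M : Type*} [TopologicalSpace M] [ChartedSpace ℂ M] [IsManifold 𝓘(ℂ) ω M]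
  [PreconnectedSpace M] {f fhat : M → Sph n}

/-- If `ρ` vanishes identically and `κ` nowhere, the lifts `X = Y/a` and `H = aZ` are globally
defined and form a Gauss pair with respect to the constant vector `e = ψ + H` and the frame of
`e^⊥ ∩ (V ⊕ ℝψ)` at the point `p₀`, which by constancy of `V ⊕ ℝψ` serves for all points. -/
lemma exists_isGaussPair (hf : IsConformalImmersion f) (hfhat : IsConformalImmersion fhat)
    (F : IsEnvelopeFamily (fun φ : OpenPartialHomeomorph M ℂ => canonicalLift (localRep f φ))
      (fun φ => envelopeLift (localRep f φ) (localRep fhat φ)))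
    (hρ : ∀ φ ∈ atlas ℂ M, ∀ z ∈ φ.target, envRho (canonicalLift (localRep f φ))
      (envelopeLift (localRep f φ) (localRep fhat φ)) z = 0)
    (hκ : ∀ φ ∈ atlas ℂ M, ∀ z ∈ φ.target, hopf (canonicalLift (localRep f φ)) z ≠ 0) (p₀ : M) :
    ∃ (e : Fin (n + 2) → ℝ) (E : Fin 4 → Fin (n + 2) → ℝ) (X H : M → Fin (n + 2) → ℝ),
      IsGaussPair e E X H ∧
      (∀ p, ∃ t : ℝ, t ≠ 0 ∧ nullLift (f p).1 = t • X p) ∧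
      (∀ p, ∃ t : ℝ, t ≠ 0 ∧ nullLift (fhat p).1 = t • H p) := by
  obtain ⟨Y, hY⟩ : ∃ Y : OpenPartialHomeomorph M ℂ → ℂ → Fin (n + 2) → ℂ,
    Y = fun φ => canonicalLift (localRep f φ) := ⟨_, rfl⟩
  obtain ⟨Z, hZ⟩ : ∃ Z : OpenPartialHomeomorph M ℂ → ℂ → Fin (n + 2) → ℂ,
    Z = fun φ => envelopeLift (localRep f φ) (localRep fhat φ) := ⟨_, rfl⟩
  have hYe : ∀ φ z, Y φ z = ((‖fderiv ℝ (localRep f φ) z 1‖⁻¹ : ℝ) : ℂ) •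
      nullLiftC (f (φ.symm z)).1 := fun φ z => by rw [hY]; rfl
  have hZe : ∀ φ z, ∃ s : ℂ, Z φ z = s • nullLiftC (fhat (φ.symm z)).1 := fun φ z => by
    rw [hZ]; exact ⟨_, rfl⟩
  have hpos : ∀ φ ∈ atlas ℂ M, ∀ z ∈ φ.target, 0 < ‖fderiv ℝ (localRep f φ) z 1‖ :=
    fun φ hφ z hz => norm_fderiv_one_pos (hf.2 φ hφ z hz)
  rw [← hY, ← hZ] at F
  replace hρ : ∀ φ ∈ atlas ℂ M, ∀ z ∈ φ.target, envRho (Y φ) (Z φ) z = 0 := by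
    rw [hY, hZ]; exact hρ
  replace hκ : ∀ φ ∈ atlas ℂ M, ∀ z ∈ φ.target, hopf (Y φ) z ≠ 0 := by rw [hY]; exact hκ
  clear hY hZ
  have hpt : ∀ p : M, ∃ φ ∈ atlas ℂ M, ∃ z ∈ φ.target, φ.symm z = p := fun p =>
    ⟨_, chart_mem_atlas ℂ p, _, mem_chart_target ℂ p, (chartAt ℂ p).left_inv (mem_chart_source ℂ p)⟩
  obtain ⟨φ₀, hφ₀, z₀, hz₀, hp₀⟩ := hpt p₀
  have h₀ := F.pair φ₀ hφ₀
  set e := toRe (envE (Y φ₀) (Z φ₀) z₀) with he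
  set E : Fin 4 → Fin (n + 2) → ℝ := fun i => toRe (envFrame (Y φ₀) (Z φ₀) z₀ i) with hE
  have toC_e : ∀ φ ∈ atlas ℂ M, ∀ z ∈ φ.target, toC e = envE (Y φ) (Z φ) z := fun φ hφ z hz => by
    rw [he, toC_toRe (h₀.star_E (hρ φ₀ hφ₀) hz₀), F.E_const hρ hκ hφ₀ hz₀ φ hφ z hz]
  have toC_E : ∀ i, toC (E i) = envFrame (Y φ₀) (Z φ₀) z₀ i := fun i =>
    toC_toRe (h₀.star_frame (hρ φ₀ hφ₀) hz₀ i)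
  set X : M → Fin (n + 2) → ℝ := normLift f fun _ => e with hX
  set H : M → Fin (n + 2) → ℝ := normLift fhat X with hH
  have toC_X' : ∀ φ ∈ atlas ℂ M, ∀ z ∈ φ.target,
      lorentz e (nullLift (f (φ.symm z)).1) ≠ 0 ∧ envX (Y φ) (Z φ) z = toC (X (φ.symm z)) :=
    fun φ hφ z hz => eq_toC_normLift (e := fun _ => e) (by rw [envX, hYe, smul_smul])
      (by rw [toC_e φ hφ z hz, (F.pair φ hφ).E_X (hρ φ hφ) (hκ φ hφ) hz])
  have toC_X : ∀ φ ∈ atlas ℂ M, ∀ z ∈ φ.target, toC (X (φ.symm z)) = envX (Y φ) (Z φ) z :=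
    fun φ hφ z hz => (toC_X' φ hφ z hz).2.symm
  have toC_H' : ∀ φ ∈ atlas ℂ M, ∀ z ∈ φ.target,
      lorentz (X (φ.symm z)) (nullLift (fhat (φ.symm z)).1) ≠ 0 ∧
        envH (Y φ) (Z φ) z = toC (H (φ.symm z)) := fun φ hφ z hz => by
    obtain ⟨s, hs⟩ := hZe φ z
    exact eq_toC_normLift (e := X) (by rw [envH, hs, smul_smul])
      (by rw [toC_X φ hφ z hz, (F.pair φ hφ).X_H (hρ φ hφ) (hκ φ hφ) hz])
  have toC_H : ∀ φ ∈ atlas ℂ M, ∀ z ∈ φ.target, toC (H (φ.symm z)) = envH (Y φ) (Z φ) z :=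
    fun φ hφ z hz => (toC_H' φ hφ z hz).2.symm
  have hXne : ∀ p, lorentz e (nullLift (f p).1) ≠ 0 := fun p => by
    obtain ⟨φ, hφ, z, hz, rfl⟩ := hpt p
    exact (toC_X' φ hφ z hz).1
  have hHne : ∀ p, lorentz (X p) (nullLift (fhat p).1) ≠ 0 := fun p => by
    obtain ⟨φ, hφ, z, hz, rfl⟩ := hpt p
    exact (toC_H' φ hφ z hz).1
  -- `X` is a positive multiple of the null lift
  have hneg : ∀ p, lorentz e (nullLift (f p).1) < 0 := fun p => by
    obtain ⟨φ, hφ, z, hz, rfl⟩ := hpt p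
    have hp := F.pair φ hφ
    have h1 : lorentz (toC e) (Y φ z) = -envA (Y φ) (Z φ) z := by
      rw [← hp.A_smul_X (hρ φ hφ) (hκ φ hφ) hz, lorentz_smul_right, toC_e φ hφ z hz,
        hp.E_X (hρ φ hφ) (hκ φ hφ) hz, mul_neg_one]
    have hsq := Real.sqrt_pos.2 (hp.xi_sq_pos (hρ φ hφ) (hκ φ hφ) hz)
    rw [hYe, lorentz_smul_right, nullLiftC_eq, lorentz_toC, envA] at h1
    norm_cast at h1
    by_contra hge
    have h2 : 0 ≤ ‖fderiv ℝ (localRep f φ) z 1‖⁻¹ * lorentz e (nullLift (f (φ.symm z)).1) :=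
      mul_nonneg (inv_nonneg.2 (norm_nonneg _)) (not_lt.1 hge)
    rw [h1] at h2
    linarith
  have hXmul : ∀ p, X p = (-(lorentz e (nullLift (f p).1))⁻¹) • nullLift (f p).1 := fun p => rfl
  have hHmul : ∀ p, H p = (-(lorentz (X p) (nullLift (fhat p).1))⁻¹) • nullLift (fhat p).1 :=
    fun p => rfl
  have frame : IsLorentzFrame e E := by
    refine ⟨?_, fun i => ?_, fun i j => ?_⟩
    · have := h₀.E_E (hρ φ₀ hφ₀) (hκ φ₀ hφ₀) hz₀
      rw [← toC_e φ₀ hφ₀ z₀ hz₀, lorentz_toC] at this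
      exact_mod_cast this
    · have := h₀.lorentz_E_frame (hρ φ₀ hφ₀) (hκ φ₀ hφ₀) hz₀ i
      rw [← toC_e φ₀ hφ₀ z₀ hz₀, ← toC_E, lorentz_toC] at this
      exact_mod_cast this
    · have := h₀.lorentz_frame (hρ φ₀ hφ₀) (hκ φ₀ hφ₀) hz₀ i j
      rw [← toC_E, ← toC_E, lorentz_toC] at this
      refine Complex.ofReal_injective (this.trans ?_)
      split_ifs <;> simp
  have hproj : ∀ v : Fin (n + 2) → ℝ, envProj (Y φ₀) (Z φ₀) z₀ (toC v) =
      toC (frameMap E (frameCoord E v) + lorentz e v • e) := fun v => by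
    rw [IsEnvelopePair.proj_eq_frame, ← toC_E, ← toC_E, ← toC_E, ← toC_E, ← toC_e φ₀ hφ₀ z₀ hz₀,
      frameMap_apply, frameCoord_zero, frameCoord_one, frameCoord_two, frameCoord_three]
    simp only [lorentz_toC]
    funext i
    simp [toC]
  have hEX : ∀ p, lorentz e (X p) = -1 := fun p => by
    obtain ⟨φ, hφ, z, hz, rfl⟩ := hpt p
    have := (F.pair φ hφ).E_X (hρ φ hφ) (hκ φ hφ) hz
    rw [← toC_e φ hφ z hz, ← toC_X φ hφ z hz, lorentz_toC] at this
    exact_mod_cast this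
  have hEH : ∀ p, lorentz e (H p) = 0 := fun p => by
    obtain ⟨φ, hφ, z, hz, rfl⟩ := hpt p
    have := (F.pair φ hφ).E_H hz
    rw [← toC_e φ hφ z hz, ← toC_H φ hφ z hz, lorentz_toC] at this
    exact_mod_cast this
  have hsX : ContMDiff 𝓘(ℝ, ℂ) 𝓘(ℝ, Fin (n + 2) → ℝ) ∞ X :=
    smooth_normLift hf.1 contMDiff_const hXne
  have hsH : ContMDiff 𝓘(ℝ, ℂ) 𝓘(ℝ, Fin (n + 2) → ℝ) ∞ H :=
    smooth_normLift hfhat.1 hsX hHne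
  have dX : ∀ φ ∈ atlas ℂ M, ∀ z ∈ φ.target, ∀ v : ℂ,
      toC (fderiv ℝ (fun w => X (φ.symm w)) z v) = (envA (Y φ) (Z φ) z)⁻¹ •
        (v • envP (Y φ) (Z φ) z + star v • star (envP (Y φ) (Z φ) z)) := fun φ hφ z hz v => by
    have hp := F.pair φ hφ
    have hd := diffAt_of_contDiffOn φ.open_target (contDiffOn_comp_symm hsX hφ) hz
    have hdz : dz (fun w => toC (X (φ.symm w))) z =
        (envA (Y φ) (Z φ) z)⁻¹ • envP (Y φ) (Z φ) z := by
      rw [dz_congr_on φ.open_target (fun w hw => toC_X φ hφ w hw) hz]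
      exact hp.dz_X (hρ φ hφ) (hκ φ hφ) hz
    rw [← fderiv_toC hd, fderiv_eq_dz, dzbar_eq_star_dz φ.open_target (fun w _ => star_toC _) hz,
      hdz, star_smul, star_inv₀, IsEnvelopePair.star_A, starRingEnd_apply]
    module
  have dH : ∀ φ ∈ atlas ℂ M, ∀ z ∈ φ.target, ∀ v : ℂ,
      toC (fderiv ℝ (fun w => H (φ.symm w)) z v) = envA (Y φ) (Z φ) z •
        ((v * envTheta (Y φ) (Z φ) z) • star (envP (Y φ) (Z φ) z)
        + (star v * star (envTheta (Y φ) (Z φ) z)) • envP (Y φ) (Z φ) z) := fun φ hφ z hz v => by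
    have hp := F.pair φ hφ
    have hd := diffAt_of_contDiffOn φ.open_target (contDiffOn_comp_symm hsH hφ) hz
    have hdz : dz (fun w => toC (H (φ.symm w))) z =
        (envA (Y φ) (Z φ) z * envTheta (Y φ) (Z φ) z) • star (envP (Y φ) (Z φ) z) := by
      rw [dz_congr_on φ.open_target (fun w hw => toC_H φ hφ w hw) hz]
      exact hp.dz_H (hρ φ hφ) (hκ φ hφ) hz
    rw [← fderiv_toC hd, fderiv_eq_dz, dzbar_eq_star_dz φ.open_target (fun w _ => star_toC _) hz,
      hdz, star_smul, star_mul', IsEnvelopePair.star_A, starRingEnd_apply, star_star]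
    module
  refine ⟨e, E, X, H, { frame with
    smoothX := hsX
    smoothH := hsH
    mem_X := fun p => ?_
    mem_H := fun p => ?_
    X_X := fun p => ?_
    H_H := fun p => ?_
    X_H := fun p => ?_
    e_X := hEX
    e_H := hEH
    future := fun p => ?_
    conformal := fun φ hφ z hz => ?_
    H_dX := fun φ hφ z hz v => ?_
    traceless := fun φ hφ z hz => ?_ }, fun p => ?_, fun p => ?_⟩
  · obtain ⟨φ, hφ, z, hz, rfl⟩ := hpt p
    have h1 := hproj (X (φ.symm z))
    rw [← F.proj_const hρ hκ hφ₀ hz₀ (star_toC _) φ hφ z hz, toC_X φ hφ z hz,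
      (F.pair φ hφ).proj_X (hρ φ hφ) (hκ φ hφ) hz, ← toC_X φ hφ z hz] at h1
    have h2 := toC_injective h1
    rw [hEX] at h2
    conv_rhs => rw [h2]
    module
  · obtain ⟨φ, hφ, z, hz, rfl⟩ := hpt p
    have h1 := hproj (H (φ.symm z))
    rw [← F.proj_const hρ hκ hφ₀ hz₀ (star_toC _) φ hφ z hz, toC_H φ hφ z hz,
      (F.pair φ hφ).proj_H (hρ φ hφ) (hκ φ hφ) hz, ← toC_H φ hφ z hz] at h1
    have h2 := toC_injective h1
    rw [hEH] at h2
    conv_rhs => rw [h2]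
    module
  · rw [hXmul, lorentz_smul_left, lorentz_smul_right,
      lorentz_nullLift_self (mem_sphere_zero_iff_norm.1 (f p).2)]
    simp
  · rw [hHmul, lorentz_smul_left, lorentz_smul_right,
      lorentz_nullLift_self (mem_sphere_zero_iff_norm.1 (fhat p).2)]
    simp
  · rw [hHmul, lorentz_smul_right, neg_mul, inv_mul_cancel₀ (hHne p)]
  · have e0 : E 0 = X p₀ + e := by
      apply toC_injective
      have : toC (X p₀ + e) = toC (X p₀) + toC e := map_add (toCL _) _ _
      rw [toC_E, this, ← hp₀, toC_X φ₀ hφ₀ z₀ hz₀, toC_e φ₀ hφ₀ z₀ hz₀]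
      rfl
    have h1 : lorentz (X p₀) (X p) ≤ 0 := by
      rw [hXmul, hXmul p, lorentz_smul_left, lorentz_smul_right, ← mul_assoc]
      refine mul_nonpos_of_nonneg_of_nonpos (mul_nonneg ?_ ?_) ?_
      · exact neg_nonneg.2 (inv_nonpos.2 (hneg _).le)
      · exact neg_nonneg.2 (inv_nonpos.2 (hneg _).le)
      · rw [lorentz_nullLift]
        have := real_inner_le_norm (f p₀).1 (f p).1
        rw [mem_sphere_zero_iff_norm.1 (f p₀).2, mem_sphere_zero_iff_norm.1 (f p).2] at this
        linarith
    rw [frameCoord_zero, e0, lorentz_add_left, hEX]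
    linarith
  · have hp := F.pair φ hφ
    have ha := hp.A_ne_zero (hρ φ hφ) (hκ φ hφ) hz
    have b1 := hp.P_P hz
    have b2 := hp.P_star_P hz
    have b3 := hp.star_P_star_P hz
    have b4 := b2
    rw [lorentz_comm] at b4
    obtain ⟨α, hα⟩ : ∃ α : ℝ, envA (Y φ) (Z φ) z = (α : ℂ) := ⟨_, rfl⟩
    have hα0 : α ≠ 0 := fun h => ha (by rw [hα, h, Complex.ofReal_zero])
    have key : ∀ v w : ℂ, ((lorentz (fderiv ℝ (fun w => X (φ.symm w)) z v)
        (fderiv ℝ (fun w => X (φ.symm w)) z w) : ℝ) : ℂ) =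
        ((α⁻¹ ^ 2 : ℝ) : ℂ) * ((v * star w + star v * w) / 2) := fun v w => by
      rw [← lorentz_toC, dX φ hφ z hz, dX φ hφ z hz, hα]
      simp only [lorentz_smul_left, lorentz_smul_right, lorentz_add_left, lorentz_add_right, b1, b2,
        b3, b4]
      push_cast
      ring
    refine ⟨α⁻¹ ^ 2, by positivity, Complex.ofReal_injective ?_, Complex.ofReal_injective ?_,
      Complex.ofReal_injective ?_⟩
    · rw [key]; simp
    · rw [key]; simp
    · rw [key]; simp
  · have hp := F.pair φ hφ
    apply Complex.ofReal_injective
    rw [← lorentz_toC, dX φ hφ z hz, toC_H φ hφ z hz]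
    simp [hp.H_P hz, hp.H_star_P hz]
  · have hp := F.pair φ hφ
    have ha := hp.A_ne_zero (hρ φ hφ) (hκ φ hφ) hz
    have b1 := hp.P_P hz
    have b2 := hp.P_star_P hz
    have b3 := hp.star_P_star_P hz
    have b4 := b2
    rw [lorentz_comm] at b4
    apply Complex.ofReal_injective
    push_cast
    rw [← lorentz_toC, ← lorentz_toC, dX φ hφ z hz, dX φ hφ z hz, dH φ hφ z hz, dH φ hφ z hz]
    simp only [lorentz_smul_left, lorentz_smul_right, lorentz_add_left, lorentz_add_right, b1, b2,
      b3, b4, star_one, show star Complex.I = -Complex.I from Complex.conj_I]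
    linear_combination ((envA (Y φ) (Z φ) z)⁻¹ * envA (Y φ) (Z φ) z *
      (envTheta (Y φ) (Z φ) z + star (envTheta (Y φ) (Z φ) z)) / 2) * Complex.I_mul_I
  · refine ⟨-lorentz e (nullLift (f p).1), neg_ne_zero.2 (hXne p), ?_⟩
    rw [hXmul, smul_smul, neg_mul_neg, mul_inv_cancel₀ (hXne p), one_smul]
  · refine ⟨-lorentz (X p) (nullLift (fhat p).1), neg_ne_zero.2 (hHne p), ?_⟩
    rw [hHmul, smul_smul, neg_mul_neg, mul_inv_cancel₀ (hHne p), one_smul]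

end Main

end Moebius

theorem mainTheorem2 {n : ℕ} {M : Type*} [TopologicalSpace M] [ChartedSpace ℂ M]
    [IsManifold 𝓘(ℂ) ω M] [ConnectedSpace M]
    (f fhat : M → Moebius.Sph n)
    (hf : Moebius.IsConformalImmersion f)
    (hfhat : Moebius.IsConformalImmersion fhat)
    (hne : ∀ p, fhat p ≠ f p)
    (henv : Moebius.EnvelopsCentralSpheres f fhat) :
    Moebius.IsSWillmore f ∨
    ∃ (T : Moebius.Sph n → Moebius.Sph n)
      (L : EuclideanSpace ℝ (Fin 4) →ₗᵢ[ℝ] EuclideanSpace ℝ (Fin (n + 1)))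
      (g : M → Fin 4 → ℝ),
      Moebius.IsMoebius T ∧ Moebius.IsCMC1 g ∧
      (∀ p, (T (f p)).1 = L (Moebius.hemisphereModel (g p))) ∧
      (∀ p, ∃ y ∈ Moebius.idealBoundary, (T (fhat p)).1 = L y) := by
  have F := Moebius.isEnvelopeFamily hf hfhat hne henv
  rcases F.theta_dichotomy with hθ | hρ
  · exact Or.inl (Moebius.isSWillmore_of_theta_or_hopf hf hfhat hne henv
      fun φ hφ z hz => Or.inl (hθ φ hφ z hz))
  rcases F.hopf_dichotomy hρ with hκ | hκ
  · exact Or.inl (Moebius.isSWillmore_of_theta_or_hopf hf hfhat hne henv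
      fun φ hφ z hz => Or.inr (hκ φ hφ z hz))
  obtain ⟨p₀⟩ := (inferInstance : Nonempty M)
  obtain ⟨e, E, X, H, hG, hX, hH⟩ := Moebius.exists_isGaussPair hf hfhat F hρ hκ p₀
  obtain ⟨T, L, hT, h1, h2⟩ := hG.exists_moebius hX hH
  exact Or.inr ⟨T, L, _, hT, hG.isCMC1, h1, h2⟩
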